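/- Let $k$ be a perfect field of characteristic $p>0$, let $K=W(k)[1/p]$ with valuation $v$ normalised by $v(p)=1$ and $|x|=p^{-v(x)}$, and let $n,m\ge 0$. Let $\mathcal A=K\langle T_1^{\pm},\dots,T_n^{\pm},T_{n+1},\dots,T_{n+m}\rangle$ be the ring of series $\sum_u x_uT^u$ with $x_u\in K$, $x_u\to 0$, where $u\in\mathbb Z^n\times\mathbb Z_{\ge 0}^m$. For $i\le n$ write $x=\sum_{d\in\mathbb Z}a_dT_i^d$ (with $a_d$ not involving $T_i$), let $v(a_d)$ be the Gauss valuation and put $w^{(i)}_j(x)=\min\{d : v(a_d)\le j\}$. For $r\in\mathbb R$ let $\mathcal A^r\subset\mathcal A$ be the subring of those $x$ for which there is a $c>0$ such that $w^{(i)}_j(x)\ge -c\,p^{rj}$ for all $i=1,\dots,n$ and all sufficiently large integers $j$. Let $\Omega_{\mathcal A^r}$ and $\Omega_{\mathcal A}$ be the modules of continuous differentials, free on $dT_1,\dots,dT_{n+m}$. A $\nabla$-module over $\mathcal A^r$ is a finitely generated locally free $\mathcal A^r$-module $M$ with a connection $\nabla:M\to M\otimes\Omega_{\mathcal A^r}$;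 it is integrable if its curvature vanishes. Proposition. Let $r<1$ and let $M$ be a rank one integrable $\nabla$-module over $\mathcal A^r$. Then there is an integer $N\ge 0$ such that $M^{\otimes p^N}$ (with the tensor product connection) has regular singularities, in the following sense: after base change to $\mathcal A$, the module $\mathcal A\otimes_{\mathcal A^r}M^{\otimes p^N}$ is free with a basis element $e$ such that $$\nabla(e)=\sum_{i=1}^{n}\Bigl(\frac{c_i}{T_i}+g_i\Bigr)dT_i\otimes e+\sum_{i=n+1}^{n+m}g_i\,dT_i\otimes e$$ with $c_i\in K$ and $g_i\in K\langle T_1,\dots,T_{n+m}\rangle$. -/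

import Mathlib

open scoped TensorProduct NNReal
open Filter Topology

set_option linter.unusedSectionVars false

/-- The field `K = W(k)[1/p]`, the fraction field of the ring of `p`-typical Witt vectors. -/
def WittField (p : ℕ) [Fact p.Prime] (k : Type*) [Field k] [CharP k p] [PerfectRing k p] :=
  FractionRing (WittVector p k)

namespace WittField

variable (p : ℕ) [Fact p.Prime] (k : Type*) [Field k] [CharP k p] [PerfectRing k p]

noncomputable instance : Field (WittField p k) :=
  inferInstanceAs (Field (FractionRing (WittVector p k)))

noncomputable instance : Algebra (WittVector p k) (WittField p k) :=
  inferInstanceAs (Algebra (WittVector p k) (FractionRing (WittVector p k)))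

instance : IsFractionRing (WittVector p k) (WittField p k) :=
  inferInstanceAs (IsFractionRing (WittVector p k) (FractionRing (WittVector p k)))

/-- The prime `(p)` of `W(k)`. -/
noncomputable def primeP : IsDedekindDomain.HeightOneSpectrum (WittVector p k) where
  asIdeal := Ideal.span {(p : WittVector p k)}
  isPrime := (Ideal.span_singleton_prime (WittVector.irreducible p).ne_zero).2
    (WittVector.irreducible p).prime
  ne_bot := by
    simpa using (WittVector.irreducible (p := p) (k := k)).ne_zero

theorem one_lt_p : (1 : ℝ≥0) < (p : ℝ≥0) := by
  exact_mod_cast (Fact.out : p.Prime).one_lt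

/-- The `p`-adic absolute value `|x| = p ^ (-v(x))` on `K`, where `v(p) = 1`. -/
noncomputable def absP : AbsoluteValue (WittField p k) ℝ :=
  (primeP p k).adicAbv (one_lt_p p)

noncomputable instance : NormedField (WittField p k) := (absP p k).toNormedField

theorem norm_def (x : WittField p k) : ‖x‖ = absP p k x := rfl

instance : IsUltrametricDist (WittField p k) :=
  IsUltrametricDist.isUltrametricDist_of_isNonarchimedean_norm
    ((primeP p k).isNonarchimedean_adicAbv (one_lt_p p))

theorem toNNReal_exp_neg (N : ℕ) :
    (WithZeroMulInt.toNNReal (ne_zero_of_lt (one_lt_p p))) (WithZero.exp (-(N : ℤ))) =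
      (p : ℝ≥0) ^ (-(N : ℤ)) := by
  rw [WithZeroMulInt.toNNReal_neg_apply _ (WithZero.exp_ne_zero)]
  rfl

theorem norm_algebraMap_le_iff (a : WittVector p k) (N : ℕ) :
    ‖algebraMap (WittVector p k) (WittField p k) a‖ ≤ (p : ℝ) ^ (-(N : ℤ)) ↔
      a ∈ (Ideal.span {(p : WittVector p k)}) ^ N := by
  have h := (primeP p k).intValuation_le_pow_iff_mem a N
  change _ ↔ a ∈ (primeP p k).asIdeal ^ N
  rw [← h, ← (primeP p k).valuation_of_algebraMap (K := WittField p k)]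
  have hm := WithZeroMulInt.toNNReal_strictMono (one_lt_p p)
  rw [← hm.le_iff_le]
  rw [toNNReal_exp_neg]
  rw [← NNReal.coe_le_coe]
  push_cast
  rfl

theorem exists_of_norm_le_one (x : WittField p k) (hx : ‖x‖ ≤ 1) :
    ∃ a : WittVector p k, algebraMap _ _ a = x := by
  have h1 : (primeP p k).valuation (WittField p k) x ≤ 1 := by
    rw [← WithZeroMulInt.toNNReal_le_one_iff (one_lt_p p)]
    exact_mod_cast hx
  obtain ⟨a, ha⟩ := IsDedekindDomain.HeightOneSpectrum.mem_integers_of_valuation_le_one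
    (WittField p k) x (R := WittVector p k) (fun v => by
      have : v = primeP p k := by
        ext1
        rw [IsLocalRing.eq_maximalIdeal v.isMaximal,
          IsLocalRing.eq_maximalIdeal (primeP p k).isMaximal]
      rw [this]
      exact h1)
  exact ⟨a, ha⟩

theorem norm_p : ‖(p : WittField p k)‖ = (p : ℝ)⁻¹ := by
  have h := (primeP p k).intValuation_singleton (r := (p : WittVector p k))
    (WittVector.irreducible p).ne_zero rfl
  rw [← (primeP p k).valuation_of_algebraMap (K := WittField p k)] at h
  have h2 := toNNReal_exp_neg p 1
  simp only [Nat.cast_one] at h2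
  rw [← h] at h2
  have h4 : algebraMap (WittVector p k) (WittField p k) p = p := map_natCast _ p
  rw [← h4]
  refine (congrArg NNReal.toReal h2 : _).trans ?_
  simp

instance : CompleteSpace (WittField p k) := by
  have hp : (1 : ℝ) < p := by exact_mod_cast one_lt_p p
  refine Metric.complete_of_convergent_controlled_sequences
    (fun N => (p : ℝ) ^ (-(N : ℤ))) (fun N => by positivity) fun u hu => ?_
  have h0 : ∀ n, ∃ a : WittVector p k, algebraMap _ (WittField p k) a = u n - u 0 := fun n => by
    apply exists_of_norm_le_one
    have := (hu 0 n 0 (by simp) le_rfl).le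
    simpa [dist_eq_norm] using this
  choose a ha using h0
  obtain ⟨L, hL⟩ := IsPrecomplete.prec
    (inferInstance : IsPrecomplete (Ideal.span {(p : WittVector p k)}) (WittVector p k))
    (f := a) (by
      intro m n hmn
      rw [SModEq.sub_mem, smul_eq_mul, Ideal.mul_top, ← norm_algebraMap_le_iff, map_sub, ha, ha]
      have := (hu m m n le_rfl hmn).le
      simpa [dist_eq_norm] using this)
  refine ⟨u 0 + algebraMap _ _ L, ?_⟩
  rw [tendsto_iff_norm_sub_tendsto_zero]
  refine squeeze_zero (g := fun n : ℕ => ((p : ℝ)⁻¹) ^ n) (fun _ => norm_nonneg _) (fun n => ?_)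
    (tendsto_pow_atTop_nhds_zero_of_lt_one (by positivity) (inv_lt_one_of_one_lt₀ hp))
  have := hL n
  rw [SModEq.sub_mem, smul_eq_mul, Ideal.mul_top, ← norm_algebraMap_le_iff, map_sub, ha] at this
  calc _ = ‖u n - u 0 - algebraMap _ _ L‖ := by congr 1; ring
    _ ≤ _ := this
    _ = _ := by simp

end WittField

/-- Families `(a_u)`, `u ∈ ℤ^σ`, of elements of `K` with `a_u → 0`. The family `a` stands for the
series `∑ a_u T^u`, so this is `K⟨T_s, T_s⁻¹ : s ∈ σ⟩`. -/
def nullFamilies (K σ : Type*) [NormedField K] : Submodule K ((σ → ℤ) → K) where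
  carrier := {a | Tendsto a cofinite (𝓝 0)}
  add_mem' {a b} ha hb := by
    have h : Tendsto (fun u => a u + b u) cofinite (𝓝 (0 + 0)) := Tendsto.add ha hb
    rwa [add_zero] at h
  zero_mem' := tendsto_const_nhds
  smul_mem' c a ha := by
    have h : Tendsto (fun u => c * a u) cofinite (𝓝 (c * 0)) := Tendsto.const_mul c ha
    rwa [mul_zero] at h

/-- The ring `K⟨T_s, T_s⁻¹ : s ∈ σ⟩` of series `∑ a_u T^u` with `a_u → 0`. -/
def Laurent (K σ : Type*) [NormedField K] : Type _ := ↥(nullFamilies K σ)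

namespace Laurent

variable {K σ : Type*} [NormedField K]

noncomputable instance : AddCommGroup (Laurent K σ) :=
  inferInstanceAs (AddCommGroup ↥(nullFamilies K σ))

noncomputable instance : Module K (Laurent K σ) :=
  inferInstanceAs (Module K ↥(nullFamilies K σ))

/-- The coefficient of `T^u`. -/
def coeff (a : Laurent K σ) (u : σ → ℤ) : K := a.1 u

theorem coeff_null (a : Laurent K σ) : Tendsto a.coeff cofinite (𝓝 0) := a.2

@[ext] theorem ext {a b : Laurent K σ} (h : ∀ u, a.coeff u = b.coeff u) : a = b :=
  Subtype.ext (funext h)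

@[simp] theorem coeff_add (a b : Laurent K σ) (u) : (a + b).coeff u = a.coeff u + b.coeff u := rfl
@[simp] theorem coeff_zero (u) : (0 : Laurent K σ).coeff u = 0 := rfl
@[simp] theorem coeff_smul (c : K) (a : Laurent K σ) (u) : (c • a).coeff u = c * a.coeff u := rfl

open Classical in
/-- The monomial `c T^u`. -/
noncomputable def monomial (u : σ → ℤ) (c : K) : Laurent K σ :=
  ⟨fun v => if v = u then c else 0, by
    refine tendsto_const_nhds.congr' ?_
    have : {u}ᶜ ∈ (cofinite : Filter (σ → ℤ)) := (Set.finite_singleton u).compl_mem_cofinite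
    filter_upwards [this] with v hv
    rw [if_neg (by simpa using hv)]⟩

open Classical in
theorem coeff_monomial (u v : σ → ℤ) (c : K) :
    (monomial u c).coeff v = if v = u then c else 0 := rfl

theorem exists_bound (a : Laurent K σ) (p : ℝ) (hp : 1 < p) :
    ∃ N : ℕ, ∀ u, ‖a.coeff u‖ ≤ p ^ N := by
  have h := a.coeff_null.norm
  rw [norm_zero] at h
  have h1 : ∀ᶠ u in cofinite, ‖a.coeff u‖ < 1 := h.eventually_lt_const one_pos
  rw [eventually_cofinite] at h1
  obtain ⟨C, hC⟩ := (h1.image fun u => ‖a.coeff u‖).bddAbove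
  obtain ⟨N, hN⟩ := pow_unbounded_of_one_lt C hp
  refine ⟨N, fun u => ?_⟩
  by_cases hu : ‖a.coeff u‖ < 1
  · exact hu.le.trans (one_le_pow₀ hp.le)
  · exact (hC ⟨u, hu, rfl⟩).trans hN.le

variable [IsUltrametricDist K]

theorem pair_null (a b : Laurent K σ) :
    Tendsto (fun x : (σ → ℤ) × (σ → ℤ) => a.coeff x.1 * b.coeff x.2) cofinite (𝓝 0) :=
  tendsto_mul_cofinite_nhds_zero a.coeff_null b.coeff_null

theorem conv_null (a b : Laurent K σ) (w : σ → ℤ) :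
    Tendsto (fun u => a.coeff u * b.coeff (w - u)) cofinite (𝓝 0) := by
  have hinj : Function.Injective (fun u : σ → ℤ => (u, w - u)) := fun u v h => (Prod.ext_iff.1 h).1
  exact (pair_null a b).comp hinj.tendsto_cofinite

theorem null_mul (a b : Laurent K σ) :
    Tendsto (fun w => ∑' u, a.coeff u * b.coeff (w - u)) cofinite (𝓝 0) := by
  rw [NormedAddGroup.tendsto_nhds_zero]
  intro ε hε
  have h := (NormedAddGroup.tendsto_nhds_zero.1 (pair_null a b)) (ε / 2) (by positivity)
  rw [eventually_cofinite] at h ⊢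
  refine (h.image fun x => x.1 + x.2).subset fun w hw => ?_
  by_contra hcon
  apply hw
  refine lt_of_le_of_lt (IsUltrametricDist.norm_tsum_le_of_forall_le_of_nonneg
    (by positivity : 0 ≤ ε / 2) fun u => ?_) (half_lt_self hε)
  by_contra hu
  exact hcon ⟨(u, w - u), fun h' => hu h'.le, by simp⟩

variable [CompleteSpace K]

theorem conv_summable (a b : Laurent K σ) (w : σ → ℤ) :
    Summable (fun u => a.coeff u * b.coeff (w - u)) :=
  NonarchimedeanAddGroup.summable_of_tendsto_cofinite_zero (conv_null a b w)

noncomputable instance : Mul (Laurent K σ) :=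
  ⟨fun a b => ⟨fun w => ∑' u, a.coeff u * b.coeff (w - u), null_mul a b⟩⟩

noncomputable instance : One (Laurent K σ) := ⟨monomial 0 1⟩

theorem coeff_mul (a b : Laurent K σ) (w : σ → ℤ) :
    (a * b).coeff w = ∑' u, a.coeff u * b.coeff (w - u) := rfl

open Classical in
theorem coeff_one (v : σ → ℤ) : (1 : Laurent K σ).coeff v = if v = 0 then 1 else 0 := rfl

protected theorem mul_comm' (a b : Laurent K σ) : a * b = b * a := by
  ext w
  rw [coeff_mul, coeff_mul, ← (Equiv.subLeft w).tsum_eq]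
  simp [mul_comm]

protected theorem one_mul' (a : Laurent K σ) : 1 * a = a := by
  ext w
  rw [coeff_mul, tsum_eq_single 0]
  · simp [coeff_one]
  · intro u hu
    simp [coeff_one, hu]

protected theorem add_mul' (a b c : Laurent K σ) : (a + b) * c = a * c + b * c := by
  ext w
  simp only [coeff_add, coeff_mul]
  rw [← (conv_summable a c w).tsum_add (conv_summable b c w)]
  simp [add_mul]

protected theorem mul_assoc' (a b c : Laurent K σ) : a * b * c = a * (b * c) := by
  ext w
  simp only [coeff_mul]
  have h3 : Tendsto (fun x : ((σ → ℤ) × (σ → ℤ)) × (σ → ℤ) =>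
      a.coeff x.1.1 * b.coeff x.1.2 * c.coeff x.2) cofinite (𝓝 0) :=
    tendsto_mul_cofinite_nhds_zero (pair_null a b) c.coeff_null
  have hinj : Function.Injective (fun x : (σ → ℤ) × (σ → ℤ) =>
      (((x.1, x.2 - x.1), w - x.2) : ((σ → ℤ) × (σ → ℤ)) × (σ → ℤ))) := by
    rintro ⟨t, u⟩ ⟨t', u'⟩ h
    simp only [Prod.mk.injEq] at h
    simp only [Prod.mk.injEq]
    exact ⟨h.1.1, by simpa using h.2⟩
  have hs : Summable (Function.uncurry fun t u : σ → ℤ =>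
      a.coeff t * b.coeff (u - t) * c.coeff (w - u)) :=
    NonarchimedeanAddGroup.summable_of_tendsto_cofinite_zero (h3.comp hinj.tendsto_cofinite)
  calc ∑' u, (∑' t, a.coeff t * b.coeff (u - t)) * c.coeff (w - u)
      = ∑' u, ∑' t, a.coeff t * b.coeff (u - t) * c.coeff (w - u) := by
        refine tsum_congr fun u => ?_
        rw [(conv_summable a b u).tsum_mul_right]
    _ = ∑' t, ∑' u, a.coeff t * b.coeff (u - t) * c.coeff (w - u) := Summable.tsum_comm hs
    _ = ∑' t, a.coeff t * ∑' s, b.coeff s * c.coeff (w - t - s) := by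
        refine tsum_congr fun t => ?_
        rw [← (conv_summable b c (w - t)).tsum_mul_left]
        refine Eq.trans (tsum_congr fun u => ?_) ((Equiv.subRight t).tsum_eq _)
        simp only [Equiv.subRight_apply]
        rw [mul_assoc, sub_sub_sub_cancel_right]

noncomputable instance : CommRing (Laurent K σ) :=
  { (inferInstance : AddCommGroup (Laurent K σ)) with
    mul := (· * ·)
    one := 1
    mul_comm := Laurent.mul_comm'
    one_mul := Laurent.one_mul'
    mul_one := fun a => by rw [Laurent.mul_comm', Laurent.one_mul']
    mul_assoc := Laurent.mul_assoc'
    left_distrib := fun a b c => by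
      rw [Laurent.mul_comm', Laurent.add_mul', Laurent.mul_comm' b, Laurent.mul_comm' c]
    right_distrib := Laurent.add_mul'
    zero_mul := fun a => by ext w; simp [coeff_mul]
    mul_zero := fun a => by ext w; simp [coeff_mul] }

theorem smul_mul' (c : K) (a b : Laurent K σ) : c • a * b = c • (a * b) := by
  ext w
  simp only [coeff_smul, coeff_mul]
  rw [← (conv_summable a b w).tsum_mul_left]
  simp [mul_assoc]

noncomputable instance : Algebra K (Laurent K σ) :=
  Algebra.ofModule smul_mul' fun c a b => by
    rw [mul_comm, smul_mul', mul_comm]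

open Classical in
theorem coeff_algebraMap (c : K) (v : σ → ℤ) :
    (algebraMap K (Laurent K σ) c).coeff v = if v = 0 then c else 0 := by
  rw [Algebra.algebraMap_eq_smul_one, coeff_smul, coeff_one]
  simp

/-- If a coefficient of a product is large then some product of coefficients is large. -/
theorem exists_of_le_coeff_mul (a b : Laurent K σ) (w : σ → ℤ) {ε δ : ℝ} (hε : 0 ≤ ε) (hδ : ε < δ)
    (h : δ ≤ ‖(a * b).coeff w‖) : ∃ u, ε < ‖a.coeff u‖ * ‖b.coeff (w - u)‖ := by
  by_contra! hcon
  rw [coeff_mul] at h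
  have := IsUltrametricDist.norm_tsum_le_of_forall_le_of_nonneg hε
    (f := fun u => a.coeff u * b.coeff (w - u)) (fun u => by simpa using hcon u)
  linarith

variable [DecidableEq σ]

/-- The partial derivative `∂/∂T_s`: the coefficient of `T^u` in `∂a/∂T_s` is
`(u_s + 1) a_{u + e_s}`. -/
def derivFun (s : σ) (a : Laurent K σ) : Laurent K σ :=
  ⟨fun u => ((u s + 1 : ℤ) : K) * a.coeff (u + Pi.single s 1), by
    have hinj : Function.Injective (fun u : σ → ℤ => u + Pi.single s 1) := fun u v h => by
      simpa using h
    have h : Tendsto (fun u : σ → ℤ => ‖a.coeff (u + Pi.single s 1)‖) cofinite (𝓝 0) := by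
      have h := a.coeff_null.norm
      rw [norm_zero] at h
      exact h.comp hinj.tendsto_cofinite
    refine squeeze_zero_norm (fun u : σ → ℤ => ?_) h
    rw [norm_mul]
    exact mul_le_of_le_one_left (norm_nonneg _) (IsUltrametricDist.norm_intCast_le_one K _)⟩

theorem coeff_derivFun (s : σ) (a : Laurent K σ) (u : σ → ℤ) :
    (derivFun s a).coeff u = ((u s + 1 : ℤ) : K) * a.coeff (u + Pi.single s 1) := rfl

theorem derivFun_mul (s : σ) (a b : Laurent K σ) :
    derivFun s (a * b) = a * derivFun s b + b * derivFun s a := by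
  ext w
  have h1 := conv_summable a b (w + Pi.single s 1)
  have h2 := conv_summable a (derivFun s b) w
  have h3 := (Equiv.subLeft (w + Pi.single s 1)).summable_iff.2
    (conv_summable b (derivFun s a) w)
  rw [coeff_derivFun, coeff_add, coeff_mul, coeff_mul, coeff_mul b,
    ← (Equiv.subLeft (w + Pi.single s 1)).tsum_eq (fun u => b.coeff u * _)]
  refine Eq.trans ?_ (h2.tsum_add h3)
  rw [← h1.tsum_mul_left]
  refine tsum_congr fun u => ?_
  simp only [Equiv.subLeft_apply, coeff_derivFun]
  have e1 : w + Pi.single s 1 - u = w - u + Pi.single s 1 := by abel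
  have e2 : w - (w + Pi.single s 1 - u) + Pi.single s 1 = u := by abel
  have e3 : (w - (w + (Pi.single s 1 : σ → ℤ) - u)) s = u s - 1 := by
    simp only [Pi.sub_apply, Pi.add_apply, Pi.single_eq_same]
    ring
  rw [e2, e3, e1]
  simp only [Pi.sub_apply]
  push_cast
  ring

/-- The derivation `∂/∂T_s`. -/
noncomputable def deriv (s : σ) : Derivation K (Laurent K σ) (Laurent K σ) :=
  Derivation.mk'
    { toFun := derivFun s
      map_add' := fun a b => by ext u; exact mul_add _ _ _
      map_smul' := fun c a => by ext u; exact mul_left_comm _ _ _ }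
    (derivFun_mul s)

theorem coeff_deriv (s : σ) (a : Laurent K σ) (u : σ → ℤ) :
    (deriv s a).coeff u = ((u s + 1 : ℤ) : K) * a.coeff (u + Pi.single s 1) := rfl

end Laurent

/-- The restriction of a derivation to a subalgebra that it preserves. -/
def derivationRestrict {K B : Type*} [CommRing K] [CommRing B] [Algebra K B] (d : Derivation K B B)
    (S : Subalgebra K B) (h : ∀ a ∈ S, d a ∈ S) : Derivation K S S :=
  Derivation.mk'
    { toFun := fun a => ⟨d a, h a a.2⟩
      map_add' := fun a b => Subtype.ext (by simp)
      map_smul' := fun c a => Subtype.ext (by simp) }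
    (fun a b => Subtype.ext (by simp))

theorem coe_derivationRestrict {K B : Type*} [CommRing K] [CommRing B] [Algebra K B]
    (d : Derivation K B B) (S : Subalgebra K B) (h : ∀ a ∈ S, d a ∈ S) (a : S) :
    (derivationRestrict d S h a : B) = d a := rfl

namespace Polyannulus

open Laurent

section Rings

variable (K : Type*) [NormedField K] [IsUltrametricDist K] [CompleteSpace K] (n m : ℕ)

/-- The ring `𝒜 = K⟨T_1^±, …, T_n^±, T_{n+1}, …, T_{n+m}⟩`. The variable `T_i`, `i ≤ n`, has index
`Sum.inl i`, and `T_{n+j}` has index `Sum.inr j`. -/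
def ringA : Subalgebra K (Laurent K (Fin n ⊕ Fin m)) where
  carrier := {a | ∀ u : Fin n ⊕ Fin m → ℤ, (∃ j : Fin m, u (Sum.inr j) < 0) → a.coeff u = 0}
  add_mem' := fun {a b} ha hb u hu => by rw [coeff_add, ha u hu, hb u hu, add_zero]
  mul_mem' := fun {a b} ha hb w hw => by
    obtain ⟨j, hj⟩ := hw
    rw [coeff_mul]
    refine (tsum_congr fun u => ?_).trans tsum_zero
    by_cases hu : u (Sum.inr j) < 0
    · rw [ha u ⟨j, hu⟩, zero_mul]
    · rw [hb (w - u) ⟨j, by simp only [Pi.sub_apply]; omega⟩, mul_zero]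
  algebraMap_mem' := fun c u hu => by
    obtain ⟨j, hj⟩ := hu
    rw [coeff_algebraMap, if_neg]
    rintro rfl
    simp at hj

theorem deriv_mem_ringA (s : Fin n ⊕ Fin m) (a : Laurent K (Fin n ⊕ Fin m))
    (ha : a ∈ ringA K n m) : deriv s a ∈ ringA K n m := by
  rintro u ⟨j, hj⟩
  rw [coeff_deriv]
  by_cases hs : s = Sum.inr j ∧ u (Sum.inr j) = -1
  · obtain ⟨rfl, h2⟩ := hs
    simp [h2]
  · rw [ha _ ⟨j, ?_⟩, mul_zero]
    rw [Pi.add_apply]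
    by_cases h1 : s = Sum.inr j
    · subst h1
      have : u (Sum.inr j) ≠ -1 := fun h => hs ⟨rfl, h⟩
      simp only [Pi.single_eq_same]
      omega
    · rw [Pi.single_eq_of_ne (Ne.symm h1)]
      omega

/-- The derivation `∂/∂T_s` of `𝒜`. -/
noncomputable def derivA (s : Fin n ⊕ Fin m) : Derivation K (ringA K n m) (ringA K n m) :=
  derivationRestrict (deriv s) (ringA K n m) (deriv_mem_ringA K n m s)

/-- The subring `K⟨T_1, …, T_{n+m}⟩` of `𝒜`. -/
def ringTate : Subalgebra K (ringA K n m) where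
  carrier := {a | ∀ u : Fin n ⊕ Fin m → ℤ, (∃ s, u s < 0) → a.1.coeff u = 0}
  add_mem' := fun {a b} ha hb u hu => by
    change (a.1 + b.1).coeff u = 0
    rw [coeff_add, ha u hu, hb u hu, add_zero]
  mul_mem' := fun {a b} ha hb w hw => by
    change (a.1 * b.1).coeff w = 0
    obtain ⟨j, hj⟩ := hw
    rw [coeff_mul]
    refine (tsum_congr fun u => ?_).trans tsum_zero
    by_cases hu : u j < 0
    · rw [ha u ⟨j, hu⟩, zero_mul]
    · rw [hb (w - u) ⟨j, by simp only [Pi.sub_apply]; omega⟩, mul_zero]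
  algebraMap_mem' := fun c u hu => by
    change (algebraMap K (Laurent K (Fin n ⊕ Fin m)) c).coeff u = 0
    obtain ⟨j, hj⟩ := hu
    rw [coeff_algebraMap, if_neg]
    rintro rfl
    simp at hj

/-- The element `T_i⁻¹` of `𝒜`, for `i ≤ n`. -/
noncomputable def invT (i : Fin n) : ringA K n m :=
  ⟨monomial (Pi.single (Sum.inl i) (-1)) 1, by
    rintro u ⟨j, hj⟩
    rw [coeff_monomial, if_neg]
    rintro rfl
    simp at hj⟩

variable (p : ℕ) [hp : Fact p.Prime] (r : ℝ)

/-- The ring `𝒜^r` of series with `r`-log-decay. For `x = ∑ x_u T^u` with `T_i`-adic expansion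
`x = ∑_d a_d T_i^d`, the valuation of `a_d` is the minimum of the `v(x_u)` with `u_i = d`, and
`v(x_u) ≤ j` reads `p ^ (-j) ≤ |x_u|`. So the condition below says that there is a `c > 0` with
`w_j^{(i)}(x) = min {d | v(a_d) ≤ j} ≥ -c p^{rj}` for all `i = 1, …, n` and all large `j`. -/
def ringAr : Subalgebra K (ringA K n m) where
  carrier := {x | ∃ c : ℝ, 0 < c ∧ ∃ J : ℕ, ∀ j : ℕ, J ≤ j → ∀ (i : Fin n) (u : Fin n ⊕ Fin m → ℤ),
    (p : ℝ) ^ (-(j : ℤ)) ≤ ‖x.1.coeff u‖ → -c * (p : ℝ) ^ (r * j) ≤ (u (Sum.inl i) : ℝ)}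
  add_mem' := by
    rintro a b ⟨c, hc, J, h⟩ ⟨c', hc', J', h'⟩
    refine ⟨c + c', by positivity, max J J', fun j hj i u hu => ?_⟩
    have hpos : (0 : ℝ) ≤ (p : ℝ) ^ (r * j) := by positivity
    change _ ≤ ‖(a.1 + b.1).coeff u‖ at hu
    rw [coeff_add] at hu
    have hmax := hu.trans (IsUltrametricDist.norm_add_le_max _ _)
    rcases le_max_iff.1 hmax with h1 | h1
    · have := h j (le_of_max_le_left hj) i u h1
      nlinarith [mul_nonneg hc'.le hpos]
    · have := h' j (le_of_max_le_right hj) i u h1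
      nlinarith [mul_nonneg hc.le hpos]
  mul_mem' := by
    rintro a b ⟨c, hc, J, h⟩ ⟨c', hc', J', h'⟩
    have hp1 : (1 : ℝ) < p := by exact_mod_cast hp.out.one_lt
    have hp0 : (0 : ℝ) < p := by linarith
    obtain ⟨N, hN⟩ := a.1.exists_bound p hp1
    obtain ⟨N', hN'⟩ := b.1.exists_bound p hp1
    set L : ℕ := 1 + N + N' with hL
    refine ⟨(c + c') * (p : ℝ) ^ (r * L), by positivity, max J J', fun j hj i w hw => ?_⟩
    change _ ≤ ‖(a.1 * b.1).coeff w‖ at hw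
    obtain ⟨u, hu⟩ := exists_of_le_coeff_mul a.1 b.1 w (ε := (p : ℝ) ^ (-((j + 1 : ℕ) : ℤ)))
      (by positivity) (zpow_lt_zpow_right₀ hp1 (by push_cast; omega)) hw
    have key : ∀ x y : ℝ, 0 ≤ x → ∀ M : ℕ, M ≤ N + N' → y ≤ (p : ℝ) ^ M →
        (p : ℝ) ^ (-((j + 1 : ℕ) : ℤ)) < x * y → (p : ℝ) ^ (-((j + L : ℕ) : ℤ)) ≤ x := by
      intro x y hx M hM hy hxy
      have h1 : (p : ℝ) ^ (-((j + 1 : ℕ) : ℤ)) ≤ x * (p : ℝ) ^ (N + N') :=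
        hxy.le.trans (mul_le_mul_of_nonneg_left
          (hy.trans (pow_le_pow_right₀ hp1.le hM)) hx)
      have h2 : (p : ℝ) ^ (-((j + L : ℕ) : ℤ)) * (p : ℝ) ^ (N + N') =
          (p : ℝ) ^ (-((j + 1 : ℕ) : ℤ)) := by
        rw [← zpow_natCast, ← zpow_add₀ hp0.ne']
        congr 1
        push_cast [hL]
        ring
      rw [← h2] at h1
      exact le_of_mul_le_mul_right h1 (by positivity)
    have ha := h (j + L) (by have := le_of_max_le_left hj; omega) i u
      (key _ _ (norm_nonneg _) N' (by omega) (hN' (w - u)) hu)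
    have hb := h' (j + L) (by have := le_of_max_le_right hj; omega) i (w - u)
      (key _ _ (norm_nonneg _) N (by omega) (hN u) (by rwa [mul_comm] at hu))
    have hexp : (p : ℝ) ^ (r * ((j + L : ℕ) : ℝ)) = (p : ℝ) ^ (r * L) * (p : ℝ) ^ (r * j) := by
      rw [← Real.rpow_add hp0]
      congr 1
      push_cast
      ring
    rw [hexp] at ha hb
    rw [Pi.sub_apply] at hb
    push_cast at hb
    nlinarith
  algebraMap_mem' := fun c => by
    refine ⟨1, one_pos, 0, fun j _ i u hu => ?_⟩
    change _ ≤ ‖(algebraMap K (Laurent K (Fin n ⊕ Fin m)) c).coeff u‖ at hu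
    rw [coeff_algebraMap] at hu
    have hp0 : (0 : ℝ) < p := by exact_mod_cast hp.out.pos
    split_ifs at hu with h0
    · subst h0
      simp
      positivity
    · rw [norm_zero] at hu
      exact absurd hu (not_le.2 (by positivity))

theorem derivA_mem_ringAr (s : Fin n ⊕ Fin m) (a : ringA K n m) (ha : a ∈ ringAr K n m p r) :
    derivA K n m s a ∈ ringAr K n m p r := by
  obtain ⟨c, hc, J, h⟩ := ha
  refine ⟨2 * c, by positivity, J, fun j hj i u hu => ?_⟩
  have hp0 : (0 : ℝ) < p := by exact_mod_cast hp.out.pos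
  have hpos : (0 : ℝ) ≤ c * (p : ℝ) ^ (r * j) := by positivity
  change _ ≤ ‖(deriv s a.1).coeff u‖ at hu
  rw [coeff_deriv, norm_mul] at hu
  have h1 := h j hj i _ (hu.trans (mul_le_of_le_one_left (norm_nonneg _)
    (IsUltrametricDist.norm_intCast_le_one K _)))
  rw [Pi.add_apply] at h1
  by_cases hs : s = Sum.inl i
  · subst hs
    rw [Pi.single_eq_same] at h1
    have h2 : u (Sum.inl i) ≠ -1 := by
      intro h2
      rw [h2] at hu
      simp only [neg_add_cancel, Int.cast_zero, norm_zero, zero_mul] at hu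
      exact absurd hu (not_le.2 (by positivity))
    rcases lt_or_gt_of_ne h2 with h3 | h3
    · have h4 : (u (Sum.inl i) : ℝ) ≤ -2 := by exact_mod_cast (by omega : u (Sum.inl i) ≤ -2)
      push_cast at h1
      linarith
    · have h4 : (0 : ℝ) ≤ (u (Sum.inl i) : ℝ) := by exact_mod_cast (by omega : 0 ≤ u (Sum.inl i))
      linarith
  · rw [Pi.single_eq_of_ne (Ne.symm hs), add_zero] at h1
    linarith

/-- The derivation `∂/∂T_s` of `𝒜^r`. -/
noncomputable def derivAr (s : Fin n ⊕ Fin m) :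
    Derivation K (ringAr K n m p r) (ringAr K n m p r) :=
  derivationRestrict (derivA K n m s) (ringAr K n m p r) (derivA_mem_ringAr K n m p r s)

end Rings

end Polyannulus

/-- A connection on the module `M` over the `K`-algebra `R` whose module of differentials is free
with basis `(dT_s)`, `d a = ∑ ∂_s(a) dT_s`. The map `∇ : M → M ⊗ Ω_R` is given by its components,
`∇(x) = ∑ ∇_s(x) ⊗ dT_s`. The Leibniz rule `∇(a x) = x ⊗ d a + a ∇(x)` implies `K`-linearity. -/
structure Connection {K R ι : Type*} [CommRing K] [CommRing R] [Algebra K R]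
    (partials : ι → Derivation K R R) (M : Type*) [AddCommGroup M] [Module R M] where
  nabla : ι → M →+ M
  leibniz : ∀ (s : ι) (a : R) (x : M), nabla s (a • x) = partials s a • x + a • nabla s x

namespace Connection

section General

variable {K R ι : Type*} [CommRing K] [CommRing R] [Algebra K R]
  {partials : ι → Derivation K R R} {M : Type*} [AddCommGroup M] [Module R M]

/-- Integrability: the curvature vanishes, that is, the `∇_s` commute (as the `∂_s` do). -/
def Integrable (D : Connection partials M) : Prop :=
  ∀ (s t : ι) (x : M), D.nabla s (D.nabla t x) = D.nabla t (D.nabla s x)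

section TensorPower

variable (D : Connection partials M) (N : ℕ)

/-- `∑_i x_1 ⊗ ⋯ ⊗ ∇_s(x_i) ⊗ ⋯ ⊗ x_N`. -/
noncomputable def tensorSum (s : ι) (x : Fin N → M) : ⨂[R]^N M :=
  ∑ i, PiTensorProduct.tprod R (Function.update x i (D.nabla s (x i)))

theorem tensorSum_smul (s : ι) (x : Fin N → M) (i : Fin N) (a : R) :
    D.tensorSum N s (Function.update x i (a • x i)) =
      partials s a • PiTensorProduct.tprod R x + a • D.tensorSum N s x := by
  unfold tensorSum
  rw [← Finset.add_sum_erase _ _ (Finset.mem_univ i), Finset.smul_sum,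
    ← Finset.add_sum_erase _ (fun i => a • _) (Finset.mem_univ i), ← add_assoc]
  congr 1
  · simp [D.leibniz]
  · refine Finset.sum_congr rfl fun j hj => ?_
    have hji : j ≠ i := (Finset.mem_erase.1 hj).1
    rw [Function.update_of_ne hji, Function.update_comm hji.symm, MultilinearMap.map_update_smul,
      Function.update_comm hji, Function.update_eq_self]

theorem tensorSum_add (s : ι) (x : Fin N → M) (i : Fin N) (y z : M) :
    D.tensorSum N s (Function.update x i (y + z)) =
      D.tensorSum N s (Function.update x i y) + D.tensorSum N s (Function.update x i z) := by
  unfold tensorSum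
  rw [← Finset.sum_add_distrib]
  refine Finset.sum_congr rfl fun j _ => ?_
  by_cases hji : j = i
  · subst hji
    simp
  · simp only [Function.update_of_ne hji, Function.update_comm (Ne.symm hji)]
    rw [MultilinearMap.map_update_add]

theorem tensorSum_zero (s : ι) (x : Fin N → M) (i : Fin N) (h : x i = 0) :
    D.tensorSum N s x = 0 := by
  have := D.tensorSum_add N s x i 0 0
  rw [← h, Function.update_eq_self, h, add_zero, ← h, Function.update_eq_self] at this
  simpa using this

/-- The additive map `∇_s` on `M^{⊗N}`, with
`a (x_1 ⊗ ⋯ ⊗ x_N) ↦ ∂_s(a) (x_1 ⊗ ⋯ ⊗ x_N) + a ∑_i x_1 ⊗ ⋯ ⊗ ∇_s(x_i) ⊗ ⋯ ⊗ x_N`. -/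
noncomputable def tensorNabla (s : ι) : ⨂[R]^N M →+ ⨂[R]^N M :=
  PiTensorProduct.liftAddHom
    (fun ax : R × (Fin N → M) =>
      partials s ax.1 • PiTensorProduct.tprod R ax.2 + ax.1 • D.tensorSum N s ax.2)
    (fun a x i h => by
      simp only
      rw [D.tensorSum_zero N s x i h, MultilinearMap.map_coord_zero _ i h]
      simp)
    (fun x => by simp)
    (by
      intro inst a x i y z
      obtain rfl : inst = instDecidableEqFin N := Subsingleton.elim _ _
      simp only [tensorSum_add, MultilinearMap.map_update_add, smul_add]
      abel)
    (fun a b x => by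
      simp only [map_add, add_smul]
      abel)
    (by
      intro inst a x i b
      obtain rfl : inst = instDecidableEqFin N := Subsingleton.elim _ _
      simp only [tensorSum_smul, MultilinearMap.map_update_smul, Function.update_eq_self,
        Derivation.leibniz, smul_add, add_smul, smul_smul, smul_eq_mul, mul_comm b]
      abel)

theorem tensorNabla_smul_tprod (s : ι) (a : R) (x : Fin N → M) :
    D.tensorNabla N s (a • PiTensorProduct.tprod R x) =
      partials s a • PiTensorProduct.tprod R x + a • D.tensorSum N s x := by
  rw [← PiTensorProduct.tprodCoeff_eq_smul_tprod]
  rfl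

/-- The tensor power `M^{⊗N}` of a module with connection. -/
noncomputable def tensorPower : Connection partials (⨂[R]^N M) where
  nabla := D.tensorNabla N
  leibniz s a z := by
    induction z using PiTensorProduct.induction_on with
    | smul_tprod b x =>
      rw [smul_smul, tensorNabla_smul_tprod, tensorNabla_smul_tprod, Derivation.leibniz]
      simp only [smul_add, add_smul, smul_smul, smul_eq_mul, mul_comm b]
      abel
    | add y z hy hz =>
      rw [smul_add, map_add, map_add, hy, hz, smul_add, smul_add]
      abel

theorem tensorPower_tprod (s : ι) (x : Fin N → M) :
    (D.tensorPower N).nabla s (PiTensorProduct.tprod R x) =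
      ∑ i, PiTensorProduct.tprod R (Function.update x i (D.nabla s (x i))) := by
  have := D.tensorNabla_smul_tprod N s 1 x
  rwa [one_smul, one_smul, Derivation.map_one_eq_zero, zero_smul, zero_add] at this

end TensorPower

section BaseChange

variable {S : Type*} [CommRing S] [Algebra K S] [Algebra R S] {partials' : ι → Derivation K S S}

/-- The additive map `b ⊗ x ↦ ∂_s(b) ⊗ x + b ⊗ ∇_s(x)` on `S ⊗ M`. -/
noncomputable def baseChangeNabla (D : Connection partials M)
    (h : ∀ s a, partials' s (algebraMap R S a) = algebraMap R S (partials s a)) (s : ι) :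
    S ⊗[R] M →+ S ⊗[R] M :=
  TensorProduct.liftAddHom
    (AddMonoidHom.mk' (fun b => AddMonoidHom.mk' (fun x => partials' s b ⊗ₜ x + b ⊗ₜ D.nabla s x)
        (fun x y => by simp only [map_add, TensorProduct.tmul_add]; abel))
      (fun b c => by ext x; simp [TensorProduct.add_tmul]; abel))
    (fun a b x => by
      have hab : partials' s (a • b) = partials s a • b + a • partials' s b := by
        rw [Algebra.smul_def, Derivation.leibniz, h]
        simp only [smul_eq_mul]
        simp only [Algebra.smul_def]
        ring
      simp only [AddMonoidHom.mk'_apply, D.leibniz, hab, TensorProduct.add_tmul,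
        TensorProduct.tmul_add, TensorProduct.tmul_smul, TensorProduct.smul_tmul']
      abel)

/-- The base change `S ⊗_R M` of a module with connection along `R → S`, where the derivations of
`S` extend those of `R`. -/
noncomputable def baseChange (D : Connection partials M)
    (h : ∀ s a, partials' s (algebraMap R S a) = algebraMap R S (partials s a)) :
    Connection partials' (S ⊗[R] M) where
  nabla := D.baseChangeNabla h
  leibniz s a z := by
    induction z using TensorProduct.induction_on with
    | zero => simp
    | tmul b x =>
      change partials' s (a * b) ⊗ₜ x + (a * b) ⊗ₜ D.nabla s x =
        partials' s a • (b ⊗ₜ x) + a • (partials' s b ⊗ₜ x + b ⊗ₜ D.nabla s x)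
      rw [Derivation.leibniz]
      simp only [smul_eq_mul, TensorProduct.add_tmul, smul_add, TensorProduct.smul_tmul',
        mul_comm b]
      abel
    | add y z hy hz =>
      rw [smul_add, map_add, map_add, hy, hz, smul_add, smul_add]
      abel

theorem baseChange_tmul (D : Connection partials M)
    (h : ∀ s a, partials' s (algebraMap R S a) = algebraMap R S (partials s a))
    (s : ι) (b : S) (x : M) :
    (D.baseChange h).nabla s (b ⊗ₜ x) = partials' s b ⊗ₜ x + b ⊗ₜ D.nabla s x := rfl

end BaseChange

end General

end Connection

namespace Polyannulus

variable {K : Type*} [NormedField K] [IsUltrametricDist K] [CompleteSpace K] {n m p : ℕ}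
  [Fact p.Prime] {r : ℝ} {M : Type*} [AddCommGroup M] [Module (ringAr K n m p r) M]

/-- A rank one `∇`-module `M` over `𝒜^r` has regular singularities (a logarithmic connection along
`T_1 ⋯ T_n = 0`) if `𝒜 ⊗ M` has a basis consisting of one element `e` with
`∇(e) = ∑_{i ≤ n} (c_i / T_i + g_i) dT_i ⊗ e + ∑_{i > n} g_i dT_i ⊗ e`, where `c_i ∈ K` and
`g_i ∈ K⟨T_1, …, T_{n+m}⟩`. -/
def HasRegularSingularities (D : Connection (derivAr K n m p r) M) : Prop :=
  ∃ (b : Module.Basis Unit (ringA K n m) (ringA K n m ⊗[ringAr K n m p r] M))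
    (c : Fin n → K) (g : Fin n ⊕ Fin m → ringA K n m),
    (∀ s, g s ∈ ringTate K n m) ∧
    (∀ i : Fin n, (D.baseChange (partials' := derivA K n m) fun _ _ => rfl).nabla (Sum.inl i)
      (b ()) = (c i • invT K n m i + g (Sum.inl i)) • b ()) ∧
    (∀ j : Fin m, (D.baseChange (partials' := derivA K n m) fun _ _ => rfl).nabla (Sum.inr j)
      (b ()) = g (Sum.inr j) • b ())

end Polyannulus

-- A series in `𝒜^r` whose coefficient at $T^u$ has size about $p^{-j}$ has poles of order
-- $O(p^{rj})$ along $T_1\cdots T_n=0$. Since $r<1$, some $\rho>1$ satisfies $r\rho\le 1$, and then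
-- coefficients are $O(P^{-\rho})$ in the total pole order $P$ (`exists_decayBound_of_mem_ringAr`).
-- Integrating $T^u$ divides by an exponent $u_i$, which costs at most $|1/u_i|\le |u_i|_\infty\le
-- P$ when $u_i<0$. As $\rho>1$, the formal primitive of the polar part of a closed form still has
-- coefficients tending to zero, so it lies in `𝒜`. What remains after subtracting its differential
-- is logarithmic, and closedness makes the residues constant (`exists_primitive`).
--
-- To apply this, $M$ needs a frame whose connection form decays. The module `𝒜 ⊗ M` is free: the
-- reduction of `𝒜` is a polynomial ring over a field with $T_1\cdots T_n$ inverted, so Hilbert's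
-- syzygy theorem gives finite free resolutions there. Lifting them shows that finite projective
-- `𝒜`-modules are stably free, and in rank one stably free means free
-- (`exists_linearEquiv_of_rankAtStalk_eq_one`). By density of Laurent polynomials a generator $e$
-- can be taken in $M$ itself, with coordinate function $z\psi$, where $\psi$ lies in the dual of
-- $M$ and $z\in$ `𝒜` decays like $P^{-\rho}$ (`exists_frame`). The inverse $z$ of `ψ e` decays
-- because the powers in its geometric series share one decay constant (`DecayBound.pow`).
--
-- The connection form $\omega$ of $e$ is therefore closed and decaying, so $\omega=df+$
-- (logarithmic). On $M^{\otimes p^N}$ the form is $p^N\omega$. For large $N$ the element $p^Nf$ is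
-- small enough for $\exp(-p^Nf)$ to converge to a unit of `𝒜`, and rescaling the frame by this unit
-- removes the exact part.

universe u

/-! ### Finite free resolutions and exact sequences -/

/-- `HasFreeResolution R n M`: the module `M` has a resolution of length at most `n` by finite free
modules, `0 → R^{b_{n-1}} → ⋯ → R^{b_0} → M → 0`. -/
def HasFreeResolution (R : Type u) [CommRing R] :
    ℕ → ∀ (M : Type u) [AddCommGroup M] [Module R M], Prop
  | 0, M, _, _ => Subsingleton M
  | n + 1, M, _, _ => ∃ (b : ℕ) (f : (Fin b → R) →ₗ[R] M), Function.Surjective f ∧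
      HasFreeResolution R n (LinearMap.ker f)

namespace HasFreeResolution

variable {R : Type u} [CommRing R]

theorem of_equiv {n : ℕ} {M N : Type u} [AddCommGroup M] [Module R M] [AddCommGroup N] [Module R N]
    (e : M ≃ₗ[R] N) (h : HasFreeResolution R n M) : HasFreeResolution R n N := by
  induction n generalizing M N with
  | zero =>
    have : Subsingleton M := h
    exact e.symm.injective.subsingleton
  | succ n ih =>
    obtain ⟨b, f, hf, hk⟩ := h
    refine ⟨b, e.toLinearMap ∘ₗ f, e.surjective.comp hf, ?_⟩
    have hker : LinearMap.ker (e.toLinearMap ∘ₗ f) = LinearMap.ker f := by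
      ext x
      simp
    exact ih (LinearEquiv.ofEq _ _ hker.symm) hk

theorem succ {n : ℕ} {M : Type u} [AddCommGroup M] [Module R M] (h : HasFreeResolution R n M) :
    HasFreeResolution R (n + 1) M := by
  induction n generalizing M with
  | zero =>
    have : Subsingleton M := h
    refine ⟨0, 0, fun x => ⟨0, Subsingleton.elim _ _⟩, ?_⟩
    change Subsingleton _
    infer_instance
  | succ n ih =>
    obtain ⟨b, f, hf, hk⟩ := h
    exact ⟨b, f, hf, ih hk⟩

theorem mono {n n' : ℕ} (hn : n ≤ n') {M : Type u} [AddCommGroup M] [Module R M]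
    (h : HasFreeResolution R n M) : HasFreeResolution R n' M := by
  induction hn with
  | refl => exact h
  | step _ ih => exact ih.succ

/-- The horseshoe lemma. -/
theorem of_exact {n : ℕ} {M' M M'' : Type u} [AddCommGroup M'] [Module R M'] [AddCommGroup M]
    [Module R M] [AddCommGroup M''] [Module R M''] (i : M' →ₗ[R] M) (q : M →ₗ[R] M'')
    (hi : Function.Injective i) (hq : Function.Surjective q)
    (hex : LinearMap.ker q = LinearMap.range i)
    (h' : HasFreeResolution R n M') (h'' : HasFreeResolution R n M'') :
    HasFreeResolution R n M := by
  induction n generalizing M' M M'' with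
  | zero =>
    have : Subsingleton M' := h'
    have : Subsingleton M'' := h''
    refine ⟨fun x y => ?_⟩
    have hxy : x - y ∈ LinearMap.ker q := Subsingleton.elim _ _
    rw [hex] at hxy
    obtain ⟨z, hz⟩ := hxy
    rw [Subsingleton.elim z 0, map_zero] at hz
    exact sub_eq_zero.1 hz.symm
  | succ n ih =>
    obtain ⟨b, f, hf, hk⟩ := h'
    obtain ⟨c, g, hg, hl⟩ := h''
    -- The free cover of `M''` lifts through `q`. Together with `i ∘ f` it covers `M`, and the
    -- kernel of this cover is an extension of `ker g` by `ker f`, to which the induction applies.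
    obtain ⟨g', hg'⟩ := Module.projective_lifting_property q g hq
    let F0 : ((Fin b → R) × (Fin c → R)) →ₗ[R] M := (i ∘ₗ f).coprod g'
    let e : (Fin (b + c) → R) ≃ₗ[R] (Fin b → R) × (Fin c → R) :=
      (LinearEquiv.funCongrLeft R R finSumFinEquiv).trans (LinearEquiv.sumArrowLequivProdArrow _ _ R R)
    have hqi : ∀ x, q (i x) = 0 := fun x => by
      have : i x ∈ LinearMap.ker q := hex ▸ ⟨x, rfl⟩
      exact this
    have hqg : ∀ x, q (g' x) = g x := fun x => LinearMap.congr_fun hg' x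
    have hF0 : Function.Surjective F0 := fun x => by
      obtain ⟨y, hy⟩ := hg (q x)
      have hxy : x - g' y ∈ LinearMap.ker q := by simp [hqg, hy]
      rw [hex] at hxy
      obtain ⟨z, hz⟩ := hxy
      obtain ⟨w, rfl⟩ := hf z
      exact ⟨(w, y), by simp [F0, hz]⟩
    refine ⟨b + c, F0 ∘ₗ e.toLinearMap, hF0.comp e.surjective, ?_⟩
    have hFk : HasFreeResolution R n (LinearMap.ker F0) := by
      let i1 : LinearMap.ker f →ₗ[R] LinearMap.ker F0 :=
        ((LinearMap.inl R (Fin b → R) (Fin c → R)).restrict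
          (p := LinearMap.ker f) (q := LinearMap.ker F0) fun x hx => by
            have hx' : f x = 0 := hx
            simp [F0, hx'])
      let q1 : LinearMap.ker F0 →ₗ[R] LinearMap.ker g :=
        ((LinearMap.snd R (Fin b → R) (Fin c → R)).restrict
          (p := LinearMap.ker F0) (q := LinearMap.ker g) fun x hx => by
            have hx' : i (f x.1) + g' x.2 = 0 := hx
            have := congrArg q hx'
            rw [map_add, hqi, hqg, zero_add, map_zero] at this
            exact this)
      refine ih i1 q1 ?_ ?_ ?_ hk hl
      · intro x y hxy
        have : (i1 x).1.1 = (i1 y).1.1 := by rw [hxy]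
        exact Subtype.ext this
      · rintro ⟨y, hy⟩
        have hy' : g' y ∈ LinearMap.ker q := by
          have : g y = 0 := hy
          simp [hqg, this]
        rw [hex] at hy'
        obtain ⟨z, hz⟩ := hy'
        obtain ⟨w, rfl⟩ := hf z
        exact ⟨⟨(-w, y), by simp [F0, hz]⟩, Subtype.ext rfl⟩
      · ext ⟨x, hx⟩
        constructor
        · intro h
          have h2 : x.2 = 0 := congrArg Subtype.val (show q1 ⟨x, hx⟩ = 0 from h)
          have hx' : i (f x.1) + g' x.2 = 0 := hx
          rw [h2, map_zero, add_zero] at hx'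
          refine ⟨⟨x.1, hi (hx'.trans (map_zero i).symm)⟩, Subtype.ext (Prod.ext rfl h2.symm)⟩
        · rintro ⟨y, hy⟩
          have : x.2 = 0 := congrArg (fun t => t.1.2) hy.symm
          exact Subtype.ext this
    refine of_equiv (LinearEquiv.symm ?_) hFk
    exact LinearEquiv.ofSubmodules e (LinearMap.ker (F0 ∘ₗ e.toLinearMap)) (LinearMap.ker F0) (by
      ext x
      simp only [Submodule.mem_map, LinearMap.mem_ker, LinearMap.comp_apply, LinearEquiv.coe_coe]
      constructor
      · rintro ⟨y, hy, rfl⟩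
        exact hy
      · intro hx
        exact ⟨e.symm x, by simpa using hx, by simp⟩)

/-- The cokernel of an injection of modules with finite free resolutions has one. -/
theorem of_exact_cokernel {n : ℕ} {M' M M'' : Type u} [AddCommGroup M'] [Module R M']
    [AddCommGroup M] [Module R M] [AddCommGroup M''] [Module R M''] (i : M' →ₗ[R] M)
    (q : M →ₗ[R] M'') (hi : Function.Injective i) (hq : Function.Surjective q)
    (hex : LinearMap.ker q = LinearMap.range i)
    (h' : HasFreeResolution R n M') (h : HasFreeResolution R n M) :
    HasFreeResolution R (n + 1) M'' := by
  cases n with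
  | zero =>
    have : Subsingleton M := h
    exact succ (n := 0) hq.subsingleton
  | succ n =>
    obtain ⟨b, f, hf, hk⟩ := h
    refine ⟨b, q ∘ₗ f, hq.comp hf, ?_⟩
    -- A free cover of `M` also covers `M''`, and the new kernel sits in $0\to\ker f\to\ker(q\circ
    -- f)\to M'\to 0$. The horseshoe lemma then applies, once the resolution of `ker f` is padded by
    -- one step.
    let i1 : LinearMap.ker f →ₗ[R] LinearMap.ker (q ∘ₗ f) :=
      Submodule.inclusion fun x hx => by
        have : f x = 0 := hx
        simp [this]
    have hmem : ∀ x : LinearMap.ker (q ∘ₗ f), f x ∈ LinearMap.range i := fun x => by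
      rw [← hex]
      exact x.2
    let e := LinearEquiv.ofInjective i hi
    let q1 : LinearMap.ker (q ∘ₗ f) →ₗ[R] M' :=
      e.symm.toLinearMap ∘ₗ (f.domRestrict _).codRestrict (LinearMap.range i) hmem
    have hq1 : ∀ x, i (q1 x) = f x := fun x => by
      have := LinearEquiv.apply_symm_apply e ⟨f x, hmem x⟩
      exact congrArg Subtype.val this
    refine of_exact i1 q1 (Submodule.inclusion_injective _) ?_ ?_ hk.succ h'
    · intro z
      obtain ⟨w, hw⟩ := hf (i z)
      have hz : q (i z) = 0 := by
        have : i z ∈ LinearMap.ker q := hex ▸ ⟨z, rfl⟩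
        exact this
      refine ⟨⟨w, by simp [hw, hz]⟩, hi ?_⟩
      rw [hq1, hw]
    · ext x
      rw [LinearMap.mem_ker]
      constructor
      · intro h0
        have : f x = 0 := by rw [← hq1, h0, map_zero]
        exact ⟨⟨x.1, this⟩, Subtype.ext rfl⟩
      · rintro ⟨y, rfl⟩
        apply hi
        rw [hq1, map_zero]
        exact y.2

/-- Flatness identifies $S\otimes\ker f$ with $\ker(S\otimes f)$, so the resolution can be tensored
step by step. -/
theorem baseChange (S : Type u) [CommRing S] [Algebra R S] [Module.Flat R S] {n : ℕ} {M : Type u}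
    [AddCommGroup M] [Module R M] (h : HasFreeResolution R n M) :
    HasFreeResolution S n (S ⊗[R] M) := by
  induction n generalizing M with
  | zero =>
    have : Subsingleton M := h
    change Subsingleton _
    infer_instance
  | succ n ih =>
    obtain ⟨b, f, hf, hk⟩ := h
    let g : S ⊗[R] (Fin b → R) →ₗ[S] S ⊗[R] M := TensorProduct.AlgebraTensorModule.lTensor S S f
    let e := TensorProduct.piScalarRight R S S (Fin b)
    have hg : Function.Surjective g := LinearMap.lTensor_surjective S hf
    refine ⟨b, g ∘ₗ (e.symm : (Fin b → S) →ₗ[S] S ⊗[R] (Fin b → R)),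
      hg.comp e.symm.surjective, ?_⟩
    have e1 : S ⊗[R] LinearMap.ker f ≃ₗ[S] LinearMap.ker g := LinearMap.tensorKerEquiv S S f
    suffices e2 : LinearMap.ker g ≃ₗ[S]
        LinearMap.ker (g ∘ₗ (e.symm : (Fin b → S) →ₗ[S] S ⊗[R] (Fin b → R))) from
      of_equiv (e1.trans e2) (ih hk)
    refine LinearEquiv.ofSubmodules e _ _ ?_
    ext x
    simp only [Submodule.mem_map, LinearMap.mem_ker, LinearMap.comp_apply, LinearEquiv.coe_coe]
    constructor
    · rintro ⟨y, hy, rfl⟩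
      simpa using hy
    · intro hx
      exact ⟨e.symm x, hx, by simp⟩

end HasFreeResolution

/-! ### Hilbert's syzygy theorem -/

/-- Every finite `R`-module has a finite resolution by finite free modules. -/
def FiniteFreeResolutions (R : Type u) [CommRing R] : Prop :=
  ∀ (M : Type u) [AddCommGroup M] [Module R M] [Module.Finite R M],
    ∃ n, HasFreeResolution R n M

namespace FiniteFreeResolutions

theorem of_field (F : Type u) [Field F] : FiniteFreeResolutions F := by
  intro M _ _ _
  refine ⟨1, Module.finrank F M, (Module.finBasis F M).equivFun.symm.toLinearMap,
    (Module.finBasis F M).equivFun.symm.surjective, ?_⟩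
  change Subsingleton _
  rw [LinearEquiv.ker]
  infer_instance

section Polynomial

open Polynomial

variable {R : Type u} [CommRing R] {N : Type u} [AddCommGroup N] [Module R N] [Module R[X] N]
  [IsScalarTower R R[X] N] (U V : Submodule R N) (hUV : U ≤ V)
  (hX : ∀ x ∈ U, (X : R[X]) • x ∈ V)

/-- The `i`-th coefficient of an element of `R[X] ⊗ V`. -/
noncomputable def tensorCoeff (V : Type u) [AddCommGroup V] [Module R V] (i : ℕ) :
    R[X] ⊗[R] V →ₗ[R] V :=
  (TensorProduct.lid R V).toLinearMap ∘ₗ (Polynomial.lcoeff R i).rTensor V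

theorem tensorCoeff_tmul (V : Type u) [AddCommGroup V] [Module R V] (i : ℕ) (f : R[X]) (v : V) :
    tensorCoeff V i (f ⊗ₜ[R] v) = f.coeff i • v := by
  simp [tensorCoeff]

theorem eq_sum_tensorCoeff {V : Type u} [AddCommGroup V] [Module R V] (z : R[X] ⊗[R] V) :
    ∃ n, ∀ n' ≥ n, z = ∑ i ∈ Finset.range n', (X ^ i : R[X]) ⊗ₜ[R] tensorCoeff V i z := by
  induction z using TensorProduct.induction_on with
  | zero => exact ⟨0, fun n' _ => by simp⟩
  | tmul f v =>
    refine ⟨f.natDegree + 1, fun n' hn' => ?_⟩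
    simp only [tensorCoeff_tmul]
    conv_lhs => rw [f.as_sum_range' n' (by omega), TensorProduct.sum_tmul]
    refine Finset.sum_congr rfl fun i _ => ?_
    rw [← TensorProduct.smul_tmul, Polynomial.smul_X_eq_monomial]
  | add x y hx hy =>
    obtain ⟨n1, h1⟩ := hx
    obtain ⟨n2, h2⟩ := hy
    refine ⟨max n1 n2, fun n' hn' => ?_⟩
    simp only [map_add, TensorProduct.tmul_add, Finset.sum_add_distrib]
    rw [← h1 n' (le_of_max_le_left hn'), ← h2 n' (le_of_max_le_right hn')]

theorem tensor_eq_zero {V : Type u} [AddCommGroup V] [Module R V] {z : R[X] ⊗[R] V}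
    (h : ∀ i, tensorCoeff V i z = 0) : z = 0 := by
  obtain ⟨n, hn⟩ := eq_sum_tensorCoeff z
  rw [hn n le_rfl]
  simp [h]

/-- Multiplication by `X` from `U` to `V`. -/
noncomputable def mulXRestrict : U →ₗ[R] V where
  toFun x := ⟨(X : R[X]) • (x : N), hX x x.2⟩
  map_add' _ _ := Subtype.ext (smul_add _ _ _)
  map_smul' _ _ := Subtype.ext (smul_comm _ _ _)

/-- The map `X ⊗ 1 - 1 ⊗ X` from `R[X] ⊗ U` to `R[X] ⊗ V`. -/
noncomputable def tensorDiff : R[X] ⊗[R] U →ₗ[R[X]] R[X] ⊗[R] V :=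
  (X : R[X]) • (Submodule.inclusion hUV).baseChange R[X] -
    (mulXRestrict U V hX).baseChange R[X]

theorem tensorDiff_tmul (f : R[X]) (x : U) :
    tensorDiff U V hUV hX (f ⊗ₜ[R] x) =
      (X * f) ⊗ₜ[R] (Submodule.inclusion hUV x) - f ⊗ₜ[R] (mulXRestrict U V hX x) := by
  simp [tensorDiff, TensorProduct.smul_tmul']

theorem tensorCoeff_zero_tensorDiff (z : R[X] ⊗[R] U) :
    (tensorCoeff V 0 (tensorDiff U V hUV hX z) : N) = -((X : R[X]) • (tensorCoeff U 0 z : N)) := by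
  induction z using TensorProduct.induction_on with
  | zero => simp
  | tmul f x =>
    simp [tensorDiff_tmul, tensorCoeff_tmul, mulXRestrict, smul_comm (X : R[X])]
  | add x y hx hy => simp [hx, hy]; abel

theorem tensorCoeff_succ_tensorDiff (z : R[X] ⊗[R] U) (i : ℕ) :
    (tensorCoeff V (i + 1) (tensorDiff U V hUV hX z) : N) =
      tensorCoeff U i z - (X : R[X]) • (tensorCoeff U (i + 1) z : N) := by
  induction z using TensorProduct.induction_on with
  | zero => simp
  | tmul f x =>
    simp [tensorDiff_tmul, tensorCoeff_tmul, mulXRestrict, smul_comm (X : R[X])]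
  | add x y hx hy => simp [hx, hy]; abel

/-- The coefficients of the image of $z$ are $-Xz_0$ and $z_i-Xz_{i+1}$. If all vanish, injectivity
of $X$ on $N$ kills $z_0$, then $z_1$, and so on. -/
theorem tensorDiff_injective (hinj : ∀ x : N, (X : R[X]) • x = 0 → x = 0) :
    Function.Injective (tensorDiff U V hUV hX) := by
  rw [injective_iff_map_eq_zero]
  intro z hz
  have key : ∀ i, tensorCoeff U i z = 0 := by
    intro i
    induction i with
    | zero =>
      have := tensorCoeff_zero_tensorDiff U V hUV hX z
      rw [hz, map_zero] at this
      exact Subtype.ext (hinj _ (by simpa using this.symm))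
    | succ i ih =>
      have := tensorCoeff_succ_tensorDiff U V hUV hX z i
      rw [hz, map_zero, ih] at this
      exact Subtype.ext (hinj _ (by simpa using this.symm))
  exact tensor_eq_zero key

/-- The action map `R[X] ⊗ V → N`. -/
noncomputable def tensorAct : R[X] ⊗[R] V →ₗ[R[X]] N :=
  TensorProduct.AlgebraTensorModule.lift
    ((LinearMap.toSpanSingleton R[X] (V →ₗ[R] N) V.subtype))

theorem tensorAct_tmul (f : R[X]) (v : V) : tensorAct V (f ⊗ₜ[R] v) = f • (v : N) := by
  simp [tensorAct]

/-- Exactness in the middle of $R[X]\otimes U\to R[X]\otimes V\to N$. The hypothesis `htop` puts the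
top coefficient of any relation in $U$, so that term can be lowered by one degree modulo the image;
induction on the degree finishes. -/
theorem ker_tensorAct (htop : ∀ (k : ℕ) (w : ℕ → V),
      ∑ i ∈ Finset.range (k + 2), (X ^ i : R[X]) • (w i : N) = 0 → (w (k + 1) : N) ∈ U) :
    LinearMap.ker (tensorAct V) = LinearMap.range (tensorDiff U V hUV hX) := by
  have key : ∀ (n : ℕ) (w : ℕ → V), ∑ i ∈ Finset.range n, (X ^ i : R[X]) • (w i : N) = 0 →
      ∑ i ∈ Finset.range n, (X ^ i : R[X]) ⊗ₜ[R] w i ∈ LinearMap.range (tensorDiff U V hUV hX) := by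
    intro n
    induction n with
    | zero => intro w _; simp
    | succ n ih =>
      intro w hw
      cases n with
      | zero =>
        have : w 0 = 0 := Subtype.ext (by simpa using hw)
        simp [this]
      | succ k =>
        let x : U := ⟨w (k + 1), htop k w hw⟩
        -- Modulo the image, $X^{k+1}\otimes x$ equals $X^k\otimes Xx$, so the top term is absorbed
        -- into the coefficient of index $k$.
        let w' : ℕ → V := Function.update w k (w k + mulXRestrict U V hX x)
        have hw' : ∀ i ∈ Finset.range k, w' i = w i := fun i hi => by
          simp [w', Function.update_of_ne (Finset.mem_range.1 hi).ne]
        have h1 := ih w' (by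
          rw [Finset.sum_range_succ, Finset.sum_congr rfl fun i hi => by rw [hw' i hi]]
          rw [Finset.sum_range_succ, Finset.sum_range_succ] at hw
          simp only [w', Function.update_self, Submodule.coe_add, mulXRestrict, smul_add,
            LinearMap.coe_mk, AddHom.coe_mk, smul_smul, x]
          rw [← pow_succ, ← add_assoc]
          exact hw)
        rw [Finset.sum_range_succ, Finset.sum_congr rfl fun i hi => by rw [hw' i hi]] at h1
        have h2 : tensorDiff U V hUV hX ((X ^ k : R[X]) ⊗ₜ[R] x) ∈
          LinearMap.range (tensorDiff U V hUV hX) := ⟨_, rfl⟩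
        have h3 := add_mem h1 h2
        rw [tensorDiff_tmul] at h3
        rw [Finset.sum_range_succ, Finset.sum_range_succ]
        convert h3 using 1
        have : Submodule.inclusion hUV x = w (k + 1) := rfl
        simp only [w', Function.update_self, TensorProduct.tmul_add, this]
        rw [← pow_succ']
        abel
  ext z
  constructor
  · intro hz
    obtain ⟨n, hn⟩ := eq_sum_tensorCoeff z
    have hz' : tensorAct V z = 0 := hz
    rw [hn n le_rfl] at hz' ⊢
    refine key n _ ?_
    rw [map_sum] at hz'
    simpa [tensorAct_tmul] using hz'
  · rintro ⟨y, rfl⟩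
    rw [LinearMap.mem_ker]
    induction y using TensorProduct.induction_on with
    | zero => simp
    | tmul f x =>
      rw [tensorDiff_tmul, map_sub, tensorAct_tmul, tensorAct_tmul]
      simp [mulXRestrict, smul_smul, mul_comm]
    | add x y hx hy => rw [map_add, map_add, hx, hy, add_zero]

end Polynomial

section PolynomialRing

open Polynomial

variable {R : Type u} [CommRing R]

/-- The elements of the submodule `N` of `R[X]^a` whose components have degree less than `d`. -/
noncomputable def degreeLTPart {a : ℕ} (N : Submodule R[X] (Fin a → R[X])) (d : ℕ) : Submodule R N :=
  (Submodule.pi Set.univ fun _ : Fin a => degreeLT R d).comap (N.subtype.restrictScalars R)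

theorem mem_degreeLTPart {a : ℕ} {N : Submodule R[X] (Fin a → R[X])} {d : ℕ} {x : N} :
    x ∈ degreeLTPart N d ↔ ∀ i, (x.1 i).degree < d := by
  simp [degreeLTPart, mem_degreeLT]

theorem finite_degreeLTPart [IsNoetherianRing R] {a : ℕ} (N : Submodule R[X] (Fin a → R[X]))
    (d : ℕ) : Module.Finite R (degreeLTPart N d) := by
  have : Module.Finite R (degreeLT R d) := Module.Finite.equiv (degreeLTEquiv R d).symm
  let f : degreeLTPart N d →ₗ[R] (Fin a → degreeLT R d) :=
    LinearMap.pi fun i => ((LinearMap.proj i).comp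
      ((N.subtype.restrictScalars R).comp (degreeLTPart N d).subtype)).codRestrict _ fun x =>
        mem_degreeLT.2 (mem_degreeLTPart.1 x.2 i)
  refine Module.Finite.of_injective f fun x y hxy => ?_
  refine Subtype.ext (Subtype.ext (funext fun i => ?_))
  exact congrArg Subtype.val (congrFun hxy i)

/-- Filter $N\subseteq R[X]^a$ by degree. Once degrees at most $d$ contain generators, $0\to
R[X]\otimes N_{<d}\to R[X]\otimes N_{<d+1}\to N\to 0$ is exact, the first map being $X\otimes
1-1\otimes X$. The pieces $N_{<d}$ and $N_{<d+1}$ are finite over the noetherian ring $R$, so their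
resolutions over $R$ extend to $R[X]$ and the cokernel lemma gives one for $N$. -/
theorem submodule_polynomial [IsNoetherianRing R] (h : FiniteFreeResolutions R) {a : ℕ}
    (N : Submodule R[X] (Fin a → R[X])) : ∃ n, HasFreeResolution R[X] n N := by
  have hfg : Module.Finite R[X] N := inferInstance
  obtain ⟨s, hs⟩ := hfg.fg_top
  obtain ⟨d, hd⟩ : ∃ d : ℕ, ∀ x ∈ s, x ∈ degreeLTPart N (d + 1) := by
    refine ⟨∑ x ∈ s, ∑ i, (x.1 i).natDegree, fun x hx => mem_degreeLTPart.2 fun i => ?_⟩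
    refine lt_of_le_of_lt degree_le_natDegree ?_
    norm_cast
    refine Nat.lt_succ_of_le ?_
    refine le_trans ?_ (Finset.single_le_sum
      (f := fun x : N => ∑ i, (x.1 i).natDegree) (fun _ _ => Nat.zero_le _) hx)
    exact Finset.single_le_sum (f := fun i => (x.1 i).natDegree) (fun _ _ => Nat.zero_le _)
      (Finset.mem_univ i)
  have hUV : degreeLTPart N d ≤ degreeLTPart N (d + 1) := fun x hx => by
    rw [mem_degreeLTPart] at hx ⊢
    exact fun i => (hx i).trans (by norm_cast; omega)
  have hX : ∀ x ∈ degreeLTPart N d, (X : R[X]) • x ∈ degreeLTPart N (d + 1) := fun x hx => by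
    rw [mem_degreeLTPart] at hx ⊢
    intro i
    rw [← mem_degreeLT, mem_degreeLT, degree_lt_iff_coeff_zero]
    intro m hm
    obtain ⟨m, rfl⟩ : ∃ k, m = k + 1 := ⟨m - 1, by omega⟩
    simp only [Submodule.coe_smul, Pi.smul_apply, smul_eq_mul, coeff_X_mul]
    exact (degree_lt_iff_coeff_zero _ _).1 (hx i) m (by omega)
  obtain ⟨n1, h1⟩ := @h (degreeLTPart N d) _ _ (finite_degreeLTPart N d)
  obtain ⟨n2, h2⟩ := @h (degreeLTPart N (d + 1)) _ _ (finite_degreeLTPart N (d + 1))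
  refine ⟨max n1 n2 + 1, HasFreeResolution.of_exact_cokernel (tensorDiff _ _ hUV hX)
    (tensorAct (degreeLTPart N (d + 1))) (tensorDiff_injective _ _ hUV hX ?_) ?_
    (ker_tensorAct _ _ hUV hX ?_) ((h1.mono (le_max_left _ _)).baseChange R[X])
    ((h2.mono (le_max_right _ _)).baseChange R[X])⟩
  · intro x hx
    refine Subtype.ext (funext fun i => ?_)
    have hxi : X * x.1 i = 0 := congrFun (congrArg Subtype.val hx) i
    ext m
    have := congrArg (fun f => f.coeff (m + 1)) hxi
    simpa using this
  · rw [← LinearMap.range_eq_top, eq_top_iff, ← hs, Submodule.span_le]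
    intro x hx
    exact ⟨1 ⊗ₜ ⟨x, hd x hx⟩, by rw [tensorAct_tmul, one_smul]⟩
  · intro k w hw
    rw [mem_degreeLTPart]
    intro i
    rw [degree_lt_iff_coeff_zero]
    intro m hm
    have hdeg : ∀ j, ((w j).1.1 i).degree < (d + 1 : ℕ) := fun j => mem_degreeLTPart.1 (w j).2 i
    rcases hm.eq_or_lt with rfl | hm
    -- In degree $k+1+d$ only $X^{k+1}w_{k+1}$ contributes, because $X^jw_j$ has degree at most
    -- $k+d$ for $j\le k$. Hence the coefficient of degree $d$ in `w (k + 1)` vanishes.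
    · have hwi := congrArg (fun z : N => (z.1 i).coeff (k + 1 + d)) hw
      simp only [Submodule.coe_sum, Finset.sum_apply, finsetSum_coeff, Submodule.coe_smul,
        Pi.smul_apply, smul_eq_mul, coeff_X_pow_mul'] at hwi
      rw [Finset.sum_range_succ, Finset.sum_eq_zero, zero_add] at hwi
      · simpa using hwi
      · intro j hj
        rw [Finset.mem_range] at hj
        rw [if_pos (by omega)]
        exact (degree_lt_iff_coeff_zero _ _).1 (hdeg j) _ (by omega)
    · exact (degree_lt_iff_coeff_zero _ _).1 (hdeg (k + 1)) _ (by omega)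

theorem polynomial [IsNoetherianRing R] (h : FiniteFreeResolutions R) :
    FiniteFreeResolutions R[X] := by
  intro M _ _ _
  obtain ⟨b, f, hf⟩ := Module.Finite.exists_fin' R[X] M
  obtain ⟨n, hn⟩ := submodule_polynomial h (LinearMap.ker f)
  exact ⟨n + 1, b, f, hf, hn⟩

/-- Finite free resolutions pass to localizations. -/
theorem isLocalization (T : Submonoid R) (S : Type u) [CommRing S] [Algebra R S]
    [IsLocalization T S] (h : FiniteFreeResolutions R) : FiniteFreeResolutions S := by
  intro M _ _ _
  have : Module.Flat R S := IsLocalization.flat S T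
  let : Module R M := Module.compHom M (algebraMap R S)
  have : IsScalarTower R S M := ⟨fun r s x => by
    rw [Algebra.smul_def, mul_smul]; rfl⟩
  obtain ⟨s, hs⟩ := (inferInstance : Module.Finite S M).fg_top
  -- The $R$-span of finitely many $S$-generators is a finite $R$-module whose localization is $M$;
  -- its resolution over $R$ is then extended to $S$ by flatness.
  let M0 : Submodule R M := Submodule.span R s
  have : Module.Finite R M0 := Module.Finite.span_finset R s
  have hloc : IsLocalizedModule T M0.subtype :=
    { map_units := fun t => by
        rw [Module.End.isUnit_iff]
        have hu : IsUnit (algebraMap R S t) := IsLocalization.map_units S t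
        obtain ⟨v, hv⟩ := hu
        constructor
        · intro x y hxy
          have hxy' : algebraMap R S t • x = algebraMap R S t • y := hxy
          rw [← hv] at hxy'
          exact (Units.isUnit v).smul_left_cancel.1 hxy'
        · intro x
          refine ⟨((v⁻¹ : Sˣ) : S) • (x : M), ?_⟩
          change algebraMap R S t • (((v⁻¹ : Sˣ) : S) • (x : M)) = x
          rw [← hv, smul_smul, Units.mul_inv, one_smul]
      surj := fun y => by
        have hy : y ∈ Submodule.span S (s : Set M) := hs ▸ Submodule.mem_top
        induction hy using Submodule.span_induction with
        | mem x hx => exact ⟨(⟨x, Submodule.subset_span hx⟩, 1), by simp⟩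
        | zero => exact ⟨(0, 1), by simp⟩
        | add x y _ _ hx hy =>
          obtain ⟨⟨x', t⟩, hx⟩ := hx
          obtain ⟨⟨y', t'⟩, hy⟩ := hy
          refine ⟨(t' • x' + t • y', t * t'), ?_⟩
          simp only [Submodule.subtype_apply, Submodule.coe_add, Submonoid.smul_def,
            Submodule.coe_smul] at hx hy ⊢
          rw [← hx, ← hy, smul_add, smul_smul, smul_smul, Submonoid.coe_mul, mul_comm (t : R)]
        | smul c x _ hx =>
          obtain ⟨⟨x', t⟩, hx⟩ := hx
          obtain ⟨⟨r, t'⟩, hc⟩ := IsLocalization.surj T c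
          refine ⟨(r • x', t' * t), ?_⟩
          simp only [Submodule.subtype_apply, Submonoid.smul_def, Submodule.coe_smul] at hx hc ⊢
          rw [← hx, ← algebraMap_smul S r, ← hc, Submonoid.coe_mul, mul_smul,
            ← algebraMap_smul S (t' : R), ← algebraMap_smul S (t : R), mul_comm c, mul_smul,
            smul_comm c, algebraMap_smul S (t : R)]
      exists_of_eq := fun {x y} hxy => ⟨1, by rw [Subtype.ext hxy]⟩ }
  obtain ⟨n, hn⟩ := h M0
  exact ⟨n, HasFreeResolution.of_equiv ((isLocalizedModule_iff_isBaseChange T S _).1 hloc).equiv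
    (hn.baseChange S)⟩

/-- An isomorphism is a localization at the trivial submonoid. -/
theorem of_ringEquiv {S : Type u} [CommRing S] (e : R ≃+* S) (h : FiniteFreeResolutions R) :
    FiniteFreeResolutions S := by
  let : Algebra R S := e.toRingHom.toAlgebra
  have : IsLocalization (⊥ : Submonoid R) S := by
    have : IsLocalization (⊥ : Submonoid R) R := IsLocalization.self bot_le
    refine IsLocalization.isLocalization_of_algEquiv (S := R) ⊥ (AlgEquiv.ofRingEquiv (f := e) fun _ => rfl)
  exact h.isLocalization ⊥ S

/-- Hilbert's syzygy theorem. -/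
theorem mvPolynomial (F : Type u) [Field F] (σ : Type) [Finite σ] :
    FiniteFreeResolutions (MvPolynomial σ F) := by
  induction σ using Finite.induction_empty_option with
  | of_equiv e ih => exact ih.of_ringEquiv (MvPolynomial.renameEquiv F e).toRingEquiv
  | h_empty => exact (of_field F).of_ringEquiv (MvPolynomial.isEmptyRingEquiv F PEmpty).symm
  | h_option ih =>
    exact (ih.polynomial).of_ringEquiv (MvPolynomial.optionEquivLeft F _).symm.toRingEquiv

end PolynomialRing

end FiniteFreeResolutions

/-! ### Lifting from the reduction of a complete ultrametric ring -/

section UnitBall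

variable (A : Type u) [NormedCommRing A] [NormOneClass A] [IsUltrametricDist A]

/-- The closed unit ball of an ultrametric normed ring. -/
def unitBall : Subring A where
  carrier := {x | ‖x‖ ≤ 1}
  mul_mem' {x y} hx hy := (norm_mul_le x y).trans (mul_le_one₀ hx (norm_nonneg _) hy)
  one_mem' := norm_one.le
  add_mem' {x y} hx hy := (IsUltrametricDist.norm_add_le_max x y).trans (max_le hx hy)
  zero_mem' := by simp
  neg_mem' {x} hx := by simpa using hx

variable {A} in
theorem mem_unitBall {x : A} : x ∈ unitBall A ↔ ‖x‖ ≤ 1 := Iff.rfl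

/-- The open unit ball, as an ideal of the closed unit ball. -/
def openUnitBall : Ideal (unitBall A) where
  carrier := {x | ‖(x : A)‖ < 1}
  add_mem' {x y} hx hy := (IsUltrametricDist.norm_add_le_max (x : A) y).trans_lt (max_lt hx hy)
  zero_mem' := by simp
  smul_mem' c x hx := (norm_mul_le (c : A) x).trans_lt
    (mul_lt_one_of_nonneg_of_lt_one_right c.2 (norm_nonneg _) hx)

variable {A} in
theorem mem_openUnitBall {x : unitBall A} : x ∈ openUnitBall A ↔ ‖(x : A)‖ < 1 := Iff.rfl

/-- The reduction of an ultrametric normed ring: the closed unit ball modulo the open one. -/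
abbrev Reduction : Type u := unitBall A ⧸ openUnitBall A

variable {A}

/-- The reduction of a submodule of `A^a`: the image of its unit ball. -/
def reduceSubmodule {a : ℕ} (P : Submodule A (Fin a → A)) :
    Submodule (Reduction A) (Fin a → Reduction A) where
  carrier := {c | ∃ x : Fin a → unitBall A, (fun i => (x i : A)) ∈ P ∧
    ∀ i, Ideal.Quotient.mk (openUnitBall A) (x i) = c i}
  add_mem' := by
    rintro c d ⟨x, hx, hc⟩ ⟨y, hy, hd⟩
    refine ⟨x + y, P.add_mem hx hy, fun i => ?_⟩
    simp [hc, hd]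
  zero_mem' := ⟨0, P.zero_mem, fun i => by simp⟩
  smul_mem' := by
    rintro r c ⟨x, hx, hc⟩
    obtain ⟨r, rfl⟩ := Ideal.Quotient.mk_surjective r
    refine ⟨fun i => r * x i, P.smul_mem (r : A) hx, fun i => ?_⟩
    simp [hc]

/-- The vectors of the unit ball of a submodule of `A^a`. -/
def ballVectors {a : ℕ} (P : Submodule A (Fin a → A)) : Type u :=
  {x : Fin a → unitBall A // (fun i => (x i : A)) ∈ P}

variable {ϖ : A}

/-- No norm lies strictly between $\|\varpi\|$ and $1$, so $\varpi$ behaves like a uniformiser: the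
open unit ball is $\varpi$ times the closed one. -/
theorem exists_eq_mul_of_norm_lt_one (hu : IsUnit ϖ)
    (hmul : ∀ x : A, ‖ϖ * x‖ = ‖ϖ‖ * ‖x‖) (hdisc : ∀ x : A, ‖x‖ < 1 → ‖x‖ ≤ ‖ϖ‖)
    {x : A} (hx : ‖x‖ < 1) : ∃ y : A, ‖y‖ ≤ 1 ∧ x = ϖ * y := by
  have : Nontrivial A := NormOneClass.nontrivial
  obtain ⟨v, rfl⟩ := hu
  refine ⟨(v⁻¹ : Aˣ) * x, ?_, by simp⟩
  have h := hmul ((v⁻¹ : Aˣ) * x)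
  rw [Units.mul_inv_cancel_left] at h
  have h2 := hdisc x hx
  have h3 : 0 < ‖(v : A)‖ := norm_pos_iff.2 v.ne_zero
  rw [h] at h2
  nlinarith

/-- Lifts of generators of the reduction of `P` generate `P`, with control of the coefficients. -/
theorem exists_coeff_of_span_reduction [CompleteSpace A] (hu : IsUnit ϖ) (hϖ : ‖ϖ‖ < 1)
    (hmul : ∀ x : A, ‖ϖ * x‖ = ‖ϖ‖ * ‖x‖) (hdisc : ∀ x : A, ‖x‖ < 1 → ‖x‖ ≤ ‖ϖ‖)
    {a b : ℕ} (P : Submodule A (Fin a → A)) (x : Fin b → Fin a → unitBall A)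
    (hx : ∀ j, (fun i => (x j i : A)) ∈ P)
    (hspan : ∀ c ∈ reduceSubmodule P, ∃ d : Fin b → Reduction A,
      ∀ i, c i = ∑ j, d j * Ideal.Quotient.mk (openUnitBall A) (x j i))
    (y : Fin a → unitBall A) (hy : (fun i => (y i : A)) ∈ P) :
    ∃ c : Fin b → unitBall A, ∀ i, (y i : A) = ∑ j, (c j : A) * x j i := by
  -- One approximation step: lifting the coefficients from the reduction leaves an error of norm
  -- less than one, hence $\varpi z$ with $z$ in the unit ball. Since $\varpi$ is invertible in $A$,
  -- the vector $z$ is again in $P$.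
  have step : ∀ y : ballVectors P, ∃ (c : Fin b → unitBall A) (z : ballVectors P),
      ∀ i, (y.1 i : A) = ∑ j, (c j : A) * x j i + ϖ * z.1 i := by
    intro y
    obtain ⟨d, hd⟩ := hspan (fun i => Ideal.Quotient.mk _ (y.1 i)) ⟨y.1, y.2, fun _ => rfl⟩
    choose c hc using fun j => Ideal.Quotient.mk_surjective (d j)
    have hlt : ∀ i, ‖(y.1 i : A) - ∑ j, (c j : A) * x j i‖ < 1 := fun i => by
      have h : Ideal.Quotient.mk (openUnitBall A) (y.1 i) =
          Ideal.Quotient.mk (openUnitBall A) (∑ j, c j * x j i) := by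
        rw [hd i, map_sum]
        simp [hc]
      rw [Ideal.Quotient.eq, mem_openUnitBall] at h
      simpa using h
    choose z hz hyz using fun i => exists_eq_mul_of_norm_lt_one hu hmul hdisc (hlt i)
    refine ⟨c, ⟨fun i => ⟨z i, hz i⟩, ?_⟩, fun i => ?_⟩
    · obtain ⟨v, rfl⟩ := hu
      have h1 : (fun i => (y.1 i : A)) - ∑ j, (c j : A) • (fun i => (x j i : A)) ∈ P :=
        P.sub_mem y.2 (P.sum_mem fun j _ => P.smul_mem _ (hx j))
      have h2 : (fun i => z i) = ((v⁻¹ : Aˣ) : A) •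
          ((fun i => (y.1 i : A)) - ∑ j, (c j : A) • (fun i => (x j i : A))) := by
        funext i
        have := hyz i
        simp only [Pi.smul_apply, Pi.sub_apply, Finset.sum_apply, smul_eq_mul]
        rw [this]
        simp
      change (fun i => z i) ∈ P
      rw [h2]
      exact P.smul_mem _ h1
    · rw [← hyz i]
      ring
  choose cf nx hnx using step
  -- Iterating on the remainders gives the coefficients as convergent series
  -- $\sum_k\varpi^kc_{k,j}$.
  let Y : ℕ → ballVectors P := fun k => nx^[k] ⟨y, hy⟩
  have hY : ∀ k i, ((Y k).1 i : A) = ∑ j, (cf (Y k) j : A) * x j i + ϖ * (Y (k + 1)).1 i := by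
    intro k i
    have : Y (k + 1) = nx (Y k) := Function.iterate_succ_apply' nx k _
    rw [this]
    exact hnx (Y k) i
  have hpart : ∀ N i, (y i : A) =
      ∑ j, (∑ k ∈ Finset.range N, ϖ ^ k * (cf (Y k) j : A)) * x j i + ϖ ^ N * (Y N).1 i := by
    intro N i
    induction N with
    | zero => simp [Y]; rfl
    | succ N ih =>
      rw [ih, hY N i]
      simp only [Finset.sum_range_succ, add_mul, Finset.sum_add_distrib, mul_add, Finset.mul_sum]
      rw [pow_succ]
      simp only [mul_assoc]
      abel
  have hpow : ∀ (k : ℕ) (z : unitBall A), ‖ϖ ^ k * (z : A)‖ ≤ ‖ϖ‖ ^ k := fun k z => by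
    refine (norm_mul_le _ _).trans ?_
    exact (mul_le_of_le_one_right (norm_nonneg _) z.2).trans (norm_pow_le ϖ k)
  have hgeo := tendsto_pow_atTop_nhds_zero_of_lt_one (norm_nonneg ϖ) hϖ
  have hsum : ∀ j, Summable fun k => ϖ ^ k * (cf (Y k) j : A) := fun j =>
    Summable.of_norm_bounded (summable_geometric_of_lt_one (norm_nonneg ϖ) hϖ)
      fun k => hpow k _
  refine ⟨fun j => ⟨∑' k, ϖ ^ k * (cf (Y k) j : A), ?_⟩, fun i => ?_⟩
  · exact IsUltrametricDist.norm_tsum_le_of_forall_le_of_nonneg zero_le_one fun k =>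
      (hpow k _).trans (pow_le_one₀ (norm_nonneg _) hϖ.le)
  · have h1 : Tendsto (fun N => ∑ j, (∑ k ∈ Finset.range N, ϖ ^ k * (cf (Y k) j : A)) * x j i +
        ϖ ^ N * (Y N).1 i) atTop (𝓝 (∑ j, (∑' k, ϖ ^ k * (cf (Y k) j : A)) * x j i + 0)) := by
      refine Tendsto.add (tendsto_finsetSum _ fun j _ => ?_) ?_
      · exact ((hsum j).hasSum.tendsto_sum_nat).mul_const _
      · exact squeeze_zero_norm (fun N => hpow N _) hgeo
    rw [add_zero] at h1
    refine tendsto_nhds_unique ?_ h1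
    simp only [← hpart]
    exact tendsto_const_nhds

/-- If $N\oplus L$ is free with $L$ free, then $M\oplus(N\oplus L)\cong F\oplus L$ is free as well.
-/
theorem IsStablyFree.of_equiv_prod {R : Type u} [CommRing R] {M N F : Type u}
    [AddCommGroup M] [Module R M] [AddCommGroup N] [Module R N] [AddCommGroup F] [Module R F] [Module.Finite R F]
    [Module.Free R F] (e : F ≃ₗ[R] M × N) [Module.IsStablyFree R N] : Module.IsStablyFree R M := by
  obtain ⟨L, _, _, _, _, _⟩ := Module.IsStablyFree.exist_free_prod R N
  have : Module.Finite R N := Module.Finite.of_surjective (LinearMap.snd R M N ∘ₗ e.toLinearMap)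
    ((LinearMap.snd_surjective (R := R) (M := M) (M₂ := N)).comp e.surjective)
  have : Module.Finite R (N × L) := inferInstance
  have : Module.Free R (M × N × L) := Module.Free.of_equiv
    ((e.prodCongr (LinearEquiv.refl R L)).trans (LinearEquiv.prodAssoc R M N L))
  exact Module.IsStablyFree.of_free_prod R M (N × L)

/-- A projective submodule of `A^a` is stably free if its reduction has a finite free resolution. -/
theorem isStablyFree_of_reduceSubmodule [CompleteSpace A] (hu : IsUnit ϖ) (hϖ : ‖ϖ‖ < 1)
    (hmul : ∀ x : A, ‖ϖ * x‖ = ‖ϖ‖ * ‖x‖) (hdisc : ∀ x : A, ‖x‖ < 1 → ‖x‖ ≤ ‖ϖ‖)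
    (hscale : ∀ x : A, ∃ N : ℕ, ‖ϖ ^ N * x‖ ≤ 1)
    (n a : ℕ) (P : Submodule A (Fin a → A)) (hP : Module.Projective A P)
    (h : HasFreeResolution (Reduction A) n (reduceSubmodule P)) : Module.IsStablyFree A P := by
  have hscale' : ∀ (a : ℕ) (y : Fin a → A), ∃ N : ℕ, ∀ i, ‖ϖ ^ N * y i‖ ≤ 1 := fun a y => by
    choose N hN using fun i => hscale (y i)
    refine ⟨∑ i, N i, fun i => ?_⟩
    rw [← Finset.add_sum_erase _ _ (Finset.mem_univ i), add_comm, pow_add, mul_assoc]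
    refine (norm_mul_le _ _).trans (mul_le_one₀ ?_ (norm_nonneg _) (hN i))
    exact (norm_pow_le _ _).trans (pow_le_one₀ (norm_nonneg _) hϖ.le)
  induction n generalizing a with
  | zero =>
    have hs : Subsingleton (reduceSubmodule P) := h
    -- If the reduction of $P$ is zero, the empty family generates it, so the lifting result makes
    -- every vector of $P$ in the unit ball zero; scaling by $\varpi^N$ covers the rest.
    have hzero : ∀ y ∈ P, y = 0 := by
      intro y hy
      obtain ⟨N, hN⟩ := hscale' a y
      obtain ⟨c, hc⟩ := exists_coeff_of_span_reduction (b := 0) hu hϖ hmul hdisc P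
        (fun j => j.elim0) (fun j => j.elim0)
        (fun c hc => ⟨fun j => j.elim0, fun i => by
          have : (⟨c, hc⟩ : reduceSubmodule P) = 0 := Subsingleton.elim _ _
          have := congrFun (congrArg Subtype.val this) i
          simpa using this⟩)
        (fun i => ⟨ϖ ^ N * y i, hN i⟩) (P.smul_mem (ϖ ^ N) hy)
      funext i
      have := hc i
      simp only [Finset.univ_eq_empty, Finset.sum_empty] at this
      exact ((hu.pow N).mul_right_eq_zero).1 this
    have : Subsingleton P := ⟨fun x y => Subtype.ext (by rw [hzero _ x.2, hzero _ y.2])⟩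
    infer_instance
  | succ n ih =>
    obtain ⟨b, f, hf, hk⟩ := h
    choose x hx hxf using fun j => (f (Pi.single j 1)).2
    have hfsum : ∀ (d : Fin b → Reduction A) (i), (f d).1 i =
        ∑ j, d j * Ideal.Quotient.mk (openUnitBall A) (x j i) := by
      intro d i
      conv_lhs => rw [pi_eq_sum_univ' d, map_sum]
      simp only [map_smul, Submodule.coe_sum, Submodule.coe_smul, Finset.sum_apply, Pi.smul_apply,
        smul_eq_mul]
      refine Finset.sum_congr rfl fun j _ => ?_
      rw [hxf]
    have hgen := exists_coeff_of_span_reduction hu hϖ hmul hdisc P x hx (fun c hc => by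
      obtain ⟨d, hd⟩ := hf ⟨c, hc⟩
      exact ⟨d, fun i => by rw [← hfsum, hd]⟩)
    -- The free cover of the reduction lifts to $\varphi:A^b\to P$, which is onto by successive
    -- approximation and splits because $P$ is projective. Its kernel is a projective submodule of
    -- $A^b$ whose reduction is `ker f`, which has a shorter resolution.
    let φ : (Fin b → A) →ₗ[A] P :=
      Fintype.linearCombination A fun j => (⟨fun i => (x j i : A), hx j⟩ : P)
    have hφ : ∀ (c : Fin b → A) (i), (φ c).1 i = ∑ j, c j * x j i := fun c i => by
      simp [φ, Fintype.linearCombination_apply]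
    have hsurj : Function.Surjective φ := by
      rintro ⟨y, hy⟩
      obtain ⟨N, hN⟩ := hscale' a y
      obtain ⟨c, hc⟩ := hgen (fun i => ⟨ϖ ^ N * y i, hN i⟩) (P.smul_mem (ϖ ^ N) hy)
      obtain ⟨v, hv⟩ := hu.pow N
      refine ⟨fun j => ((v⁻¹ : Aˣ) : A) * c j, Subtype.ext (funext fun i => ?_)⟩
      rw [hφ]
      simp only [mul_assoc, ← Finset.mul_sum]
      rw [← hc i]
      simp only [← hv]
      simp
    obtain ⟨s, hs⟩ := Module.projective_lifting_property φ LinearMap.id hsurj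
    have hexact : Function.Exact (LinearMap.ker φ).subtype φ := LinearMap.exact_subtype_ker_map φ
    let e : (Fin b → A) ≃ₗ[A] LinearMap.ker φ × P :=
      (hexact.splitSurjectiveEquiv (Submodule.injective_subtype _) ⟨s, hs⟩).1
    have hKproj : Module.Projective A (LinearMap.ker φ) := Module.Projective.of_split
      (e.symm.toLinearMap ∘ₗ LinearMap.inl A _ P) (LinearMap.fst A _ P ∘ₗ e.toLinearMap)
      (LinearMap.ext fun z => by simp)
    have hred : reduceSubmodule (LinearMap.ker φ) = LinearMap.ker f := by
      ext c
      rw [LinearMap.mem_ker]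
      constructor
      · rintro ⟨y, hy, hc⟩
        refine Subtype.ext (funext fun i => ?_)
        rw [hfsum]
        have h0 := hφ (fun i => (y i : A)) i
        rw [LinearMap.mem_ker.1 hy] at h0
        have h1 : ∑ j, y j * x j i = 0 := Subtype.ext (by simpa using h0.symm)
        have := congrArg (Ideal.Quotient.mk (openUnitBall A)) h1
        simpa [hc] using this
      -- Let $y$ lift $c\in\ker f$. Then $\varphi(y)=\varpi z$ with $z\in P$ in the unit ball, and
      -- $z=\varphi(c')$ with $c'$ in the unit ball. The corrected lift $y-\varpi c'$ lies in
      -- $\ker\varphi$ and still reduces to $c$.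
      · intro hc
        choose y hy using fun j => Ideal.Quotient.mk_surjective (c j)
        have hlt : ∀ i, ‖∑ j, (y j : A) * x j i‖ < 1 := fun i => by
          have h0 := hfsum c i
          rw [hc] at h0
          have h1 : Ideal.Quotient.mk (openUnitBall A) (∑ j, y j * x j i) = 0 := by
            rw [map_sum]
            simpa [hy] using h0.symm
          rw [Ideal.Quotient.eq_zero_iff_mem, mem_openUnitBall] at h1
          simpa using h1
        choose z hz hyz using fun i => exists_eq_mul_of_norm_lt_one hu hmul hdisc (hlt i)
        have hzP : (fun i => z i) ∈ P := by
          obtain ⟨v, rfl⟩ := hu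
          have : (fun i => z i) = ((v⁻¹ : Aˣ) : A) • (φ fun j => (y j : A)).1 := by
            funext i
            rw [Pi.smul_apply, hφ, hyz i]
            simp
          rw [this]
          exact P.smul_mem _ (φ _).2
        obtain ⟨c', hc'⟩ := hgen (fun i => ⟨z i, hz i⟩) hzP
        have hϖB : ϖ ∈ unitBall A := hϖ.le
        refine ⟨fun j => y j - ⟨ϖ, hϖB⟩ * c' j, ?_, fun j => ?_⟩
        · rw [LinearMap.mem_ker]
          refine Subtype.ext (funext fun i => ?_)
          rw [hφ]
          have h1 : ∀ j, ((y j - ⟨ϖ, hϖB⟩ * c' j : unitBall A) : A) * x j i =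
              y j * x j i - ϖ * (c' j * x j i) := fun j => by
            push_cast
            ring
          rw [Finset.sum_congr rfl fun j _ => h1 j, Finset.sum_sub_distrib, ← Finset.mul_sum,
            ← hc' i, hyz i]
          simp
        · rw [map_sub, hy, map_mul, Ideal.Quotient.eq_zero_iff_mem.2 (show
            (⟨ϖ, hϖB⟩ : unitBall A) ∈ openUnitBall A from hϖ), zero_mul, sub_zero]
    have := ih b (LinearMap.ker φ) hKproj
      (HasFreeResolution.of_equiv (LinearEquiv.ofEq _ _ hred.symm) hk)
    exact IsStablyFree.of_equiv_prod (e.trans (LinearEquiv.prodComm A _ _))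

/-- A finite projective module over a complete ultrametric ring is stably free if the
finite modules over the reduction have finite free resolutions. -/
theorem isStablyFree_of_finiteFreeResolutions [CompleteSpace A] [IsNoetherianRing (Reduction A)]
    (hC : FiniteFreeResolutions (Reduction A)) (hu : IsUnit ϖ) (hϖ : ‖ϖ‖ < 1)
    (hmul : ∀ x : A, ‖ϖ * x‖ = ‖ϖ‖ * ‖x‖) (hdisc : ∀ x : A, ‖x‖ < 1 → ‖x‖ ≤ ‖ϖ‖)
    (hscale : ∀ x : A, ∃ N : ℕ, ‖ϖ ^ N * x‖ ≤ 1)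
    (M : Type*) [AddCommGroup M] [Module A M] [Module.Finite A M] [Module.Projective A M] :
    Module.IsStablyFree A M := by
  obtain ⟨a, f, hf⟩ := Module.Finite.exists_fin' A M
  obtain ⟨s, hs⟩ := Module.projective_lifting_property f LinearMap.id hf
  have hinj : Function.Injective s := fun x y hxy => by
    have := congrArg f hxy
    rwa [← LinearMap.comp_apply, ← LinearMap.comp_apply, hs] at this
  let e := LinearEquiv.ofInjective s hinj
  have : Module.Projective A (LinearMap.range s) := Module.Projective.of_equiv e
  obtain ⟨n, hn⟩ := hC (reduceSubmodule (LinearMap.range s))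
  have := isStablyFree_of_reduceSubmodule hu hϖ hmul hdisc hscale n a _ this hn
  exact Module.IsStablyFree.equiv e.symm

end UnitBall

/-! ### Stably free modules of rank one are free -/

/-- The map `M × N → Alt^n(M × N, M)`, `(x, _) ↦ det(pr_N ·) x`, that underlies the cofactor
expansion along the summand `M` of `M × N`. -/
noncomputable def cofactorAlternating {R M N : Type*} [CommRing R] [AddCommGroup M] [Module R M]
    [AddCommGroup N] [Module R N] {n : ℕ} (bN : Module.Basis (Fin n) R N) :
    M × N →ₗ[R] (M × N) [⋀^Fin n]→ₗ[R] M where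
  toFun x := (bN.det.compLinearMap (LinearMap.snd R M N)).smulRight x.1
  map_add' x y := AlternatingMap.ext fun _ ↦ by simp
  map_smul' c x := AlternatingMap.ext fun _ ↦ by simp [smul_smul, mul_comm]

/-- The map `⋀^{n+1}(M × N) → M` given by the cofactor expansion along `M`. -/
noncomputable def cofactorMap {R M N : Type*} [CommRing R] [AddCommGroup M] [Module R M]
    [AddCommGroup N] [Module R N] {n : ℕ} (bN : Module.Basis (Fin n) R N) :
    ⋀[R]^(n + 1) (M × N) →ₗ[R] M :=
  exteriorPower.alternatingMapLinearEquiv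
    (AlternatingMap.alternatizeUncurryFin (cofactorAlternating bN))

/-- This makes the cofactor map surjective. In the expansion the vectors $(0,b_i)$ have no component
in $M$, so only the first term survives, with determinant $1$. -/
theorem cofactorMap_cons {R M N : Type*} [CommRing R] [AddCommGroup M] [Module R M]
    [AddCommGroup N] [Module R N] {n : ℕ} (bN : Module.Basis (Fin n) R N) (m : M) :
    cofactorMap bN (exteriorPower.ιMulti R (n + 1) (Fin.cons (m, 0) fun i ↦ (0, bN i))) = m := by
  simp [cofactorMap, cofactorAlternating, AlternatingMap.alternatizeUncurryFin_apply,
    Fin.sum_univ_succ, Module.Basis.det_self]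

open Module in
/-- A finite stably free module of constant rank one is free. -/
theorem free_of_isStablyFree_of_rankAtStalk_eq_one {R M : Type*} [CommRing R] [AddCommGroup M]
    [Module R M] [Module.Finite R M] [IsStablyFree R M]
    (h : ∀ P : PrimeSpectrum R, rankAtStalk M P = 1) : Nonempty (R ≃ₗ[R] M) := by
  rcases subsingleton_or_nontrivial R with _ | _
  · have := Module.subsingleton R M
    exact ⟨0⟩
  obtain ⟨N, _, _, _, _, _⟩ := IsStablyFree.exist_free_prod R M
  let n := Module.finrank R N
  have hp : Module.finrank R (M × N) = n + 1 := by
    let P : PrimeSpectrum R := Nonempty.some inferInstance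
    have heq := congrFun (rankAtStalk_prod M N) P
    simp only [rankAtStalk_eq_finrank_of_free, Pi.natCast_apply, Pi.add_apply, h] at heq
    simp only [n]
    simp at heq
    omega
  -- The top exterior power of the free module $M\times N$ is free of rank one, so the cofactor map
  -- becomes a surjection $R\to M$. Between projective modules of the same rank it is bijective.
  let e : R ≃ₗ[R] ⋀[R]^(n + 1) (M × N) :=
    (Module.nonempty_linearEquiv_of_finrank_eq_one <| by simp [exteriorPower.finrank_eq, hp]).some
  let bN : Module.Basis (Fin n) R N := Module.finBasis R N
  let f : R →ₗ[R] M := cofactorMap bN ∘ₗ e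
  have hf : Function.Surjective f := fun x =>
    ⟨e.symm (exteriorPower.ιMulti R (n + 1) (Fin.cons (x, 0) fun i ↦ (0, bN i))), by
      simp [f, cofactorMap_cons]⟩
  exact ⟨LinearEquiv.ofBijective f (bijective_of_surjective_of_rankAtStalk_eq hf fun m _ => by
    rw [rankAtStalk_self, h]; rfl)⟩

/-! ### The Gauss norm and completeness -/

namespace Laurent

variable {K σ : Type*} [NormedField K]

theorem bddAbove_norm_coeff (a : Laurent K σ) : BddAbove (Set.range fun u => ‖a.coeff u‖) := by
  obtain ⟨N, hN⟩ := a.exists_bound 2 one_lt_two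
  exact ⟨2 ^ N, by rintro _ ⟨u, rfl⟩; exact hN u⟩

/-- The Gauss norm. -/
noncomputable instance instNorm : Norm (Laurent K σ) := ⟨fun a => ⨆ u, ‖a.coeff u‖⟩

theorem norm_coeff_le (a : Laurent K σ) (u : σ → ℤ) : ‖a.coeff u‖ ≤ ‖a‖ :=
  le_ciSup a.bddAbove_norm_coeff u

theorem norm_le_iff {a : Laurent K σ} {C : ℝ} : ‖a‖ ≤ C ↔ ∀ u, ‖a.coeff u‖ ≤ C :=
  ⟨fun h u => (norm_coeff_le a u).trans h, ciSup_le⟩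

/-- Only finitely many coefficients exceed a given nonzero one in size, so the supremum is attained.
Hence the Gauss norm takes its values in those of $K$ and inherits discreteness. -/
theorem exists_norm_eq (a : Laurent K σ) : ∃ u, ‖a‖ = ‖a.coeff u‖ := by
  by_cases h : ∃ v, a.coeff v ≠ 0
  · obtain ⟨v, hv⟩ := h
    have h1 : ∀ᶠ u in cofinite, ‖a.coeff u‖ < ‖a.coeff v‖ := by
      have h2 := a.coeff_null.norm
      rw [norm_zero] at h2
      exact h2.eventually_lt_const (norm_pos_iff.2 hv)
    rw [eventually_cofinite] at h1
    obtain ⟨u, hu, hmax⟩ := h1.exists_maximalFor (fun u => ‖a.coeff u‖) _ ⟨v, lt_irrefl _⟩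
    refine ⟨u, le_antisymm (norm_le_iff.2 fun w => ?_) (norm_coeff_le a u)⟩
    by_cases hw : ‖a.coeff w‖ < ‖a.coeff v‖
    · exact hw.le.trans (not_lt.1 hu)
    · rcases le_total ‖a.coeff w‖ ‖a.coeff u‖ with h3 | h3
      · exact h3
      · exact hmax hw h3
  · push Not at h
    exact ⟨0, le_antisymm (norm_le_iff.2 fun w => by rw [h w, h 0]) (norm_coeff_le a 0)⟩

variable [IsUltrametricDist K]

theorem norm_add_le_max' (a b : Laurent K σ) : ‖a + b‖ ≤ max ‖a‖ ‖b‖ :=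
  norm_le_iff.2 fun u => (IsUltrametricDist.norm_add_le_max _ _).trans
    (max_le_max (norm_coeff_le a u) (norm_coeff_le b u))

variable [CompleteSpace K]

@[simp] theorem coeff_neg (a : Laurent K σ) (u : σ → ℤ) : (-a).coeff u = -a.coeff u := rfl
@[simp] theorem coeff_sub (a b : Laurent K σ) (u : σ → ℤ) :
    (a - b).coeff u = a.coeff u - b.coeff u := rfl

theorem norm_mul_le' (a b : Laurent K σ) : ‖a * b‖ ≤ ‖a‖ * ‖b‖ := by
  have h : ∀ c : Laurent K σ, 0 ≤ ‖c‖ := fun c => (norm_nonneg _).trans (norm_coeff_le c 0)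
  refine norm_le_iff.2 fun w => ?_
  rw [coeff_mul]
  refine IsUltrametricDist.norm_tsum_le_of_forall_le_of_nonneg (mul_nonneg (h a) (h b)) fun u => ?_
  rw [norm_mul]
  exact mul_le_mul (norm_coeff_le a u) (norm_coeff_le b _) (norm_nonneg _) (h a)

/-- The Gauss norm, as a ring norm. -/
noncomputable def ringNorm : RingNorm (Laurent K σ) where
  toFun a := ‖a‖
  map_zero' := le_antisymm (norm_le_iff.2 fun u => by simp)
    ((norm_nonneg _).trans (norm_coeff_le (0 : Laurent K σ) 0))
  add_le' a b := (norm_add_le_max' a b).trans (max_le_add_of_nonneg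
    ((norm_nonneg _).trans (norm_coeff_le a 0)) ((norm_nonneg _).trans (norm_coeff_le b 0)))
  neg' a := by
    change (⨆ u, ‖(-a).coeff u‖) = ⨆ u, ‖a.coeff u‖
    simp
  mul_le' := norm_mul_le'
  eq_zero_of_map_eq_zero' a ha := by
    ext u
    have := norm_coeff_le a u
    rw [show ‖a‖ = 0 from ha] at this
    simpa using this

noncomputable instance : NormedCommRing (Laurent K σ) :=
  { (instNorm : Norm (Laurent K σ)), (inferInstance : CommRing (Laurent K σ)),
    (ringNorm (K := K) (σ := σ)).toNormedRing with }

instance : IsUltrametricDist (Laurent K σ) :=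
  IsUltrametricDist.isUltrametricDist_of_forall_norm_add_le_max_norm norm_add_le_max'

theorem norm_smul_eq (c : K) (a : Laurent K σ) : ‖c • a‖ = ‖c‖ * ‖a‖ := by
  refine le_antisymm (norm_le_iff.2 fun u => ?_) ?_
  · rw [coeff_smul, norm_mul]
    exact mul_le_mul_of_nonneg_left (norm_coeff_le a u) (norm_nonneg _)
  · obtain ⟨u, hu⟩ := exists_norm_eq a
    rw [hu, ← norm_mul, ← coeff_smul]
    exact norm_coeff_le _ u

noncomputable instance : NormedAlgebra K (Laurent K σ) where
  norm_smul_le c a := (norm_smul_eq c a).le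

theorem norm_monomial (u : σ → ℤ) (c : K) : ‖(monomial u c : Laurent K σ)‖ = ‖c‖ := by
  classical
  refine le_antisymm (norm_le_iff.2 fun v => ?_) ?_
  · rw [coeff_monomial]
    split_ifs <;> simp
  · have := norm_coeff_le (monomial u c) u
    rwa [coeff_monomial, if_pos rfl] at this

instance : NormOneClass (Laurent K σ) := ⟨(norm_monomial 0 1).trans norm_one⟩

theorem continuous_coeff (u : σ → ℤ) : Continuous fun a : Laurent K σ => a.coeff u :=
  (LipschitzWith.of_dist_le_mul (K := 1) fun a b => by
    rw [dist_eq_norm, dist_eq_norm, NNReal.coe_one, one_mul]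
    exact norm_coeff_le (a - b) u).continuous

instance : CompleteSpace (Laurent K σ) := by
  refine Metric.complete_of_cauchySeq_tendsto fun f hf => ?_
  have hc : ∀ u, CauchySeq fun n => (f n).coeff u := fun u => by
    rw [Metric.cauchySeq_iff] at hf ⊢
    intro ε hε
    obtain ⟨N, hN⟩ := hf ε hε
    refine ⟨N, fun m hm n hn => lt_of_le_of_lt ?_ (hN m hm n hn)⟩
    rw [dist_eq_norm, dist_eq_norm]
    exact norm_coeff_le (f m - f n) u
  choose l hl using fun u => cauchySeq_tendsto_of_complete (hc u)
  -- The coefficientwise limit is uniform in the exponent; this makes the limit family null and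
  -- gives convergence in the Gauss norm.
  have key : ∀ ε > 0, ∃ N, ∀ n ≥ N, ∀ u, ‖(f n).coeff u - l u‖ ≤ ε := by
    intro ε hε
    rw [Metric.cauchySeq_iff] at hf
    obtain ⟨N, hN⟩ := hf ε hε
    refine ⟨N, fun n hn u => ?_⟩
    refine le_of_tendsto ((tendsto_const_nhds.sub (hl u)).norm) ?_
    filter_upwards [eventually_ge_atTop N] with m hm
    refine (norm_coeff_le (f n - f m) u).trans ?_
    rw [← dist_eq_norm]
    exact (hN n hn m hm).le
  have hnull : Tendsto l cofinite (𝓝 0) := by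
    rw [NormedAddGroup.tendsto_nhds_zero]
    intro ε hε
    obtain ⟨N, hN⟩ := key (ε / 2) (half_pos hε)
    have h := NormedAddGroup.tendsto_nhds_zero.1 (f N).coeff_null (ε / 2) (half_pos hε)
    filter_upwards [h] with u hu
    have := norm_sub_le ((f N).coeff u) ((f N).coeff u - l u)
    rw [sub_sub_cancel] at this
    linarith [hN N le_rfl u]
  let L : Laurent K σ := ⟨l, hnull⟩
  refine ⟨L, ?_⟩
  rw [tendsto_iff_norm_sub_tendsto_zero, Metric.tendsto_atTop]
  intro ε hε
  obtain ⟨N, hN⟩ := key (ε / 2) (half_pos hε)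
  refine ⟨N, fun n hn => ?_⟩
  rw [dist_zero_right, norm_norm]
  exact lt_of_le_of_lt (norm_le_iff.2 fun u => hN n hn u) (half_lt_self hε)

theorem monomial_mul_monomial (u v : σ → ℤ) (c d : K) :
    (monomial u c * monomial v d : Laurent K σ) = monomial (u + v) (c * d) := by
  classical
  ext w
  rw [coeff_mul, tsum_eq_single u]
  · simp only [coeff_monomial, if_true]
    by_cases h : w = u + v
    · simp [h]
    · rw [if_neg h, if_neg, mul_zero]
      rintro rfl
      exact h (by abel)
  · intro u' hu'
    rw [coeff_monomial, if_neg hu', zero_mul]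

theorem coeff_monomial_mul (u w : σ → ℤ) (c : K) (a : Laurent K σ) :
    (monomial u c * a).coeff w = c * a.coeff (w - u) := by
  classical
  rw [coeff_mul, tsum_eq_single u]
  · rw [coeff_monomial, if_pos rfl]
  · intro u' hu'
    rw [coeff_monomial, if_neg hu', zero_mul]

theorem norm_deriv_le [DecidableEq σ] (s : σ) (a : Laurent K σ) : ‖deriv s a‖ ≤ ‖a‖ :=
  norm_le_iff.2 fun u => by
    rw [coeff_deriv, norm_mul]
    exact (mul_le_of_le_one_left (norm_nonneg _)
      (IsUltrametricDist.norm_intCast_le_one K _)).trans (norm_coeff_le a _)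

end Laurent

namespace Polyannulus

open Laurent

variable (K : Type u) [NormedField K] [IsUltrametricDist K] [CompleteSpace K] (n m : ℕ)

theorem isClosed_ringA : IsClosed (ringA K n m : Set (Laurent K (Fin n ⊕ Fin m))) := by
  have : (ringA K n m : Set (Laurent K (Fin n ⊕ Fin m))) =
      ⋂ (u : Fin n ⊕ Fin m → ℤ) (_ : ∃ j : Fin m, u (Sum.inr j) < 0), {a | a.coeff u = 0} := by
    ext a
    simp [ringA]
  rw [this]
  exact isClosed_iInter fun u => isClosed_iInter fun _ =>
    isClosed_eq (continuous_coeff u) continuous_const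

instance : CompleteSpace (ringA K n m) := (isClosed_ringA K n m).completeSpace_coe

instance : NormOneClass (ringA K n m) := ⟨norm_one (α := Laurent K (Fin n ⊕ Fin m))⟩

instance : IsUltrametricDist (ringA K n m) := IsUltrametricDist.subtype _

variable {K n m}

theorem norm_algebraMap_mul (c : K) (a : ringA K n m) :
    ‖algebraMap K (ringA K n m) c * a‖ = ‖c‖ * ‖a‖ := by
  rw [← Algebra.smul_def]
  exact norm_smul_eq c a.1

theorem norm_algebraMap_eq (c : K) : ‖algebraMap K (ringA K n m) c‖ = ‖c‖ := by
  have := norm_algebraMap_mul (n := n) (m := m) c 1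
  rwa [mul_one, norm_one, mul_one] at this

theorem norm_eq_iff_coeff (a : ringA K n m) : ∃ u, ‖a‖ = ‖a.1.coeff u‖ := exists_norm_eq a.1

end Polyannulus

/-! ### The reduction of `𝒜` and its projective modules of rank one -/

namespace Polyannulus

open Laurent

section Reduction

variable {K : Type u} [NormedField K] [IsUltrametricDist K] [CompleteSpace K] {n m : ℕ}

theorem isMaximal_openUnitBall : (openUnitBall K).IsMaximal := by
  rw [Ideal.isMaximal_iff]
  refine ⟨fun h => (lt_irrefl (1 : ℝ)) (by simpa using mem_openUnitBall.1 h), ?_⟩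
  intro J x _ hx hxJ
  have h1 : ‖(x : K)‖ = 1 := le_antisymm x.2 (not_lt.1 hx)
  have h0 : (x : K) ≠ 0 := by
    rw [← norm_pos_iff, h1]
    exact one_pos
  have : (1 : unitBall K) = ⟨(x : K)⁻¹, by rw [mem_unitBall, norm_inv, h1, inv_one]⟩ * x :=
    Subtype.ext (by simp [h0])
  rw [this]
  exact J.mul_mem_left _ hxJ

/-- The integral exponent of a monomial of a polynomial ring. -/
def intExponent {σ : Type*} (v : σ →₀ ℕ) : σ → ℤ := fun s => v s

theorem intExponent_injective {σ : Type*} : Function.Injective (intExponent (σ := σ)) :=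
  fun v w h => Finsupp.ext fun s => by
    have := congrFun h s
    simpa [intExponent] using this

theorem intExponent_add {σ : Type*} (v w : σ →₀ ℕ) :
    intExponent (v + w) = intExponent v + intExponent w := by
  funext s
  simp [intExponent]

variable (K n m) in
/-- The variable `T_s`, as an element of the unit ball of `𝒜`. -/
noncomputable def varBall (s : Fin n ⊕ Fin m) : unitBall (ringA K n m) :=
  ⟨⟨monomial (Pi.single s 1) 1, by
    rintro u ⟨j, hj⟩
    rw [coeff_monomial, if_neg]
    rintro rfl
    have : (0 : ℤ) ≤ (Pi.single s 1 : Fin n ⊕ Fin m → ℤ) (Sum.inr j) := by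
      rw [Pi.single_apply]
      split_ifs <;> simp
    omega⟩, ((norm_monomial _ _).trans norm_one).le⟩

variable (K n m) in
/-- The constants of the unit ball of `𝒜`. -/
noncomputable def constBall : unitBall K →+* unitBall (ringA K n m) :=
  ((algebraMap K (ringA K n m)).comp (unitBall K).subtype).codRestrict _ fun x => by
    rw [mem_unitBall]
    exact (norm_algebraMap_eq (x : K)).le.trans x.2

variable (K n m) in
/-- The polynomials with integral coefficients in the unit ball of `𝒜`. -/
noncomputable def polyBall : MvPolynomial (Fin n ⊕ Fin m) (unitBall K) →+*
    unitBall (ringA K n m) :=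
  MvPolynomial.eval₂Hom (constBall K n m) (varBall K n m)

theorem algebraMap_eq_monomial {σ : Type*} (c : K) :
    algebraMap K (Laurent K σ) c = monomial 0 c := by
  classical
  ext u
  rw [coeff_algebraMap, coeff_monomial]

theorem polyBall_monomial (v : Fin n ⊕ Fin m →₀ ℕ) (c : unitBall K) :
    (polyBall K n m (MvPolynomial.monomial v c)).1.1 = monomial (intExponent v) (c : K) := by
  induction v using Finsupp.induction_linear generalizing c with
  | zero =>
    rw [polyBall, MvPolynomial.eval₂Hom_monomial]
    simp only [Finsupp.prod_zero_index, mul_one]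
    exact algebraMap_eq_monomial (c : K)
  | add v w hv hw =>
    have : MvPolynomial.monomial (v + w) c =
        MvPolynomial.monomial v c * MvPolynomial.monomial w 1 := by
      rw [MvPolynomial.monomial_mul, mul_one]
    rw [this, map_mul]
    change (polyBall K n m (MvPolynomial.monomial v c)).1.1 *
      (polyBall K n m (MvPolynomial.monomial w 1)).1.1 = _
    rw [hv, hw, monomial_mul_monomial, intExponent_add]
    simp
  | single s k =>
    induction k generalizing c with
    | zero =>
      rw [polyBall, MvPolynomial.eval₂Hom_monomial]
      simp only [Finsupp.single_zero, Finsupp.prod_zero_index, mul_one]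
      exact algebraMap_eq_monomial (c : K)
    | succ k ih =>
      have : MvPolynomial.monomial (Finsupp.single s (k + 1)) c =
          MvPolynomial.monomial (Finsupp.single s k) c * MvPolynomial.X s := by
        rw [MvPolynomial.X, MvPolynomial.monomial_mul, mul_one, Finsupp.single_add]
      rw [this, map_mul]
      change (polyBall K n m (MvPolynomial.monomial _ c)).1.1 *
        (polyBall K n m (MvPolynomial.X s)).1.1 = _
      rw [ih]
      have h2 : (polyBall K n m (MvPolynomial.X s)).1.1 = monomial (Pi.single s 1) 1 := by
        rw [polyBall, MvPolynomial.eval₂Hom_X']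
        rfl
      rw [h2, monomial_mul_monomial, mul_one, Finsupp.single_add, intExponent_add]
      congr 2
      funext t
      simp [intExponent, Finsupp.single_apply, Pi.single_apply, eq_comm]

theorem coeff_polyBall (f : MvPolynomial (Fin n ⊕ Fin m) (unitBall K)) (v : Fin n ⊕ Fin m →₀ ℕ) :
    (polyBall K n m f).1.1.coeff (intExponent v) = ((f.coeff v : unitBall K) : K) := by
  classical
  induction f using MvPolynomial.induction_on' with
  | monomial w c =>
    rw [polyBall_monomial, coeff_monomial, MvPolynomial.coeff_monomial]
    by_cases h : w = v
    · simp [h]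
    · rw [if_neg fun h' => h (intExponent_injective h').symm, if_neg h]
      rfl
  | add f g hf hg =>
    rw [map_add, MvPolynomial.coeff_add]
    change (polyBall K n m f).1.1.coeff _ + (polyBall K n m g).1.1.coeff _ = _
    rw [hf, hg]
    rfl

variable (K n m) in
/-- The map from the polynomial ring over the residue field of `K` to the reduction of `𝒜`. -/
noncomputable def polyReduction : MvPolynomial (Fin n ⊕ Fin m) (Reduction K) →+*
    Reduction (ringA K n m) :=
  MvPolynomial.eval₂Hom
    (Ideal.quotientMap (openUnitBall (ringA K n m)) (constBall K n m) fun x hx => by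
      rw [Ideal.mem_comap, mem_openUnitBall]
      exact (norm_algebraMap_eq (x : K)).trans_lt hx)
    fun s => Ideal.Quotient.mk _ (varBall K n m s)

theorem polyReduction_map (f : MvPolynomial (Fin n ⊕ Fin m) (unitBall K)) :
    polyReduction K n m (MvPolynomial.map (Ideal.Quotient.mk (openUnitBall K)) f) =
      Ideal.Quotient.mk _ (polyBall K n m f) := by
  induction f using MvPolynomial.induction_on with
  | C c => simp [polyReduction, polyBall]
  | add f g hf hg => simp only [map_add, hf, hg]
  | mul_X f s hf =>
    simp only [map_mul, hf, MvPolynomial.map_X]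
    simp [polyReduction, polyBall]

theorem polyReduction_injective : Function.Injective (polyReduction K n m) := by
  rw [injective_iff_map_eq_zero]
  intro g hg
  obtain ⟨f, rfl⟩ := MvPolynomial.map_surjective _ Ideal.Quotient.mk_surjective g
  rw [polyReduction_map, Ideal.Quotient.eq_zero_iff_mem, mem_openUnitBall] at hg
  ext v
  rw [MvPolynomial.coeff_map, MvPolynomial.coeff_zero, Ideal.Quotient.eq_zero_iff_mem,
    mem_openUnitBall, ← coeff_polyBall (n := n) (m := m)]
  exact (norm_coeff_le _ _).trans_lt hg

theorem coe_finsetSum_ringA {ι : Type*} (s : Finset ι) (f : ι → ringA K n m) :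
    ((∑ i ∈ s, f i : ringA K n m) : Laurent K (Fin n ⊕ Fin m)) = ∑ i ∈ s, (f i).1 :=
  map_sum (ringA K n m).val f s

theorem coeff_finsetSum {σ ι : Type*} (s : Finset ι) (f : ι → Laurent K σ) (u : σ → ℤ) :
    (∑ i ∈ s, f i).coeff u = ∑ i ∈ s, (f i).coeff u :=
  map_sum (AddMonoidHom.mk' (fun a : Laurent K σ => a.coeff u) fun _ _ => rfl) f s

/-- The exponent of `(T_1 ⋯ T_n)^N`. -/
noncomputable def logExponent (n m N : ℕ) : Fin n ⊕ Fin m →₀ ℕ :=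
  Finsupp.equivFunOnFinite.symm (Sum.elim (fun _ => N) fun _ => 0)

theorem logExponent_smul (N : ℕ) : logExponent n m N = N • logExponent n m 1 := by
  ext s
  rcases s with i | j <;> simp [logExponent]

/-- Modulo the open unit ball only finitely many coefficients survive, and a power of $T_1\cdots
T_n$ clears their negative exponents. -/
theorem exists_polyReduction_eq (z : Reduction (ringA K n m)) :
    ∃ (N : ℕ) (f : MvPolynomial (Fin n ⊕ Fin m) (Reduction K)),
      z * polyReduction K n m (MvPolynomial.monomial (logExponent n m N) 1) =
        polyReduction K n m f := by
  classical
  obtain ⟨a, rfl⟩ := Ideal.Quotient.mk_surjective z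
  have hfin : {u | ¬ ‖a.1.1.coeff u‖ < 1}.Finite := by
    have h := a.1.1.coeff_null.norm
    rw [norm_zero] at h
    exact eventually_cofinite.1 (h.eventually_lt_const one_pos)
  set S := hfin.toFinset with hS
  obtain ⟨N, hN⟩ : ∃ N : ℕ, ∀ u ∈ S, ∀ s, -(N : ℤ) ≤ u s := by
    refine ⟨∑ u ∈ S, ∑ s, (u s).natAbs, fun u hu s => ?_⟩
    have h1 : (u s).natAbs ≤ ∑ s, (u s).natAbs :=
      Finset.single_le_sum (f := fun s => (u s).natAbs) (fun _ _ => Nat.zero_le _)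
        (Finset.mem_univ s)
    have h2 : ∑ s, (u s).natAbs ≤ ∑ u ∈ S, ∑ s, (u s).natAbs :=
      Finset.single_le_sum (f := fun u : Fin n ⊕ Fin m → ℤ => ∑ s, (u s).natAbs)
        (fun _ _ => Nat.zero_le _) hu
    omega
  have hS0 : ∀ u ∈ S, ∀ j, 0 ≤ u (Sum.inr j) := by
    intro u hu j
    by_contra hj
    have h0 := a.1.2 u ⟨j, not_le.1 hj⟩
    rw [hS, Set.Finite.mem_toFinset] at hu
    refine hu ?_
    rw [h0]
    simp
  let e : (Fin n ⊕ Fin m → ℤ) → (Fin n ⊕ Fin m →₀ ℕ) := fun u =>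
    Finsupp.equivFunOnFinite.symm fun s => (u s + logExponent n m N s).toNat
  have he : ∀ u ∈ S, intExponent (e u) = u + intExponent (logExponent n m N) := by
    intro u hu
    funext s
    have h1 := hN u hu s
    rcases s with i | j
    · simp only [intExponent, e, logExponent, Finsupp.equivFunOnFinite_symm_apply_apply,
        Sum.elim_inl, Pi.add_apply]
      omega
    · have h2 := hS0 u hu j
      simp only [intExponent, e, logExponent, Finsupp.equivFunOnFinite_symm_apply_apply,
        Sum.elim_inr, Pi.add_apply]
      omega
  have hcoeff : ∀ u, a.1.1.coeff u ∈ unitBall K := fun u => (norm_coeff_le _ u).trans a.2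
  let f : MvPolynomial (Fin n ⊕ Fin m) (unitBall K) :=
    ∑ u ∈ S, MvPolynomial.monomial (e u) ⟨a.1.1.coeff u, hcoeff u⟩
  refine ⟨N, MvPolynomial.map (Ideal.Quotient.mk _) f, ?_⟩
  have h1 : (MvPolynomial.monomial (logExponent n m N) (1 : Reduction K)) =
      MvPolynomial.map (Ideal.Quotient.mk _) (MvPolynomial.monomial (logExponent n m N) 1) := by
    rw [MvPolynomial.map_monomial, RingHom.map_one]
  rw [h1, polyReduction_map, polyReduction_map, ← map_mul, Ideal.Quotient.eq, mem_openUnitBall]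
  set b : Laurent K (Fin n ⊕ Fin m) := a.1.1 - ∑ u ∈ S, monomial u (a.1.1.coeff u) with hb
  have hb1 : ‖b‖ < 1 := by
    obtain ⟨w, hw⟩ := exists_norm_eq b
    rw [hw, hb, coeff_sub, coeff_finsetSum]
    by_cases hwS : w ∈ S
    · rw [Finset.sum_eq_single_of_mem w hwS fun i _ hi => by rw [coeff_monomial, if_neg hi.symm],
        coeff_monomial, if_pos rfl, sub_self, norm_zero]
      exact one_pos
    · rw [Finset.sum_eq_zero fun i hi => by
        rw [coeff_monomial, if_neg (by rintro rfl; exact hwS hi)], sub_zero]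
      simpa [hS] using hwS
  have hfp : (polyBall K n m f).1.1 =
      ∑ u ∈ S, monomial (u + intExponent (logExponent n m N)) (a.1.1.coeff u) := by
    have : (polyBall K n m f).1.1 = ∑ u ∈ S,
        (polyBall K n m (MvPolynomial.monomial (e u) ⟨a.1.1.coeff u, hcoeff u⟩)).1.1 := by
      simp only [f, map_sum]
      exact (congrArg Subtype.val (map_sum (unitBall (ringA K n m)).subtype _ _)).trans
        (coe_finsetSum_ringA _ _)
    rw [this]
    refine Finset.sum_congr rfl fun u hu => ?_
    rw [polyBall_monomial, he u hu]
  have key : (a * polyBall K n m (MvPolynomial.monomial (logExponent n m N) 1) -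
      polyBall K n m f).1.1 = b * monomial (intExponent (logExponent n m N)) 1 := by
    change a.1.1 * (polyBall K n m (MvPolynomial.monomial (logExponent n m N) 1)).1.1 -
      (polyBall K n m f).1.1 = _
    rw [polyBall_monomial, hfp, hb, sub_mul, Finset.sum_mul]
    simp only [monomial_mul_monomial, Subring.coe_one, mul_one]
  change ‖(a * polyBall K n m (MvPolynomial.monomial (logExponent n m N) 1) -
      polyBall K n m f).1.1‖ < 1
  rw [key]
  refine (norm_mul_le _ _).trans_lt ?_
  rw [norm_monomial, norm_one, mul_one]
  exact hb1

theorem isUnit_varBall (i : Fin n) : IsUnit (varBall K n m (Sum.inl i)) := by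
  have hinv : invT K n m i ∈ unitBall (ringA K n m) := ((norm_monomial _ _).trans norm_one).le
  refine IsUnit.of_mul_eq_one ⟨invT K n m i, hinv⟩ (Subtype.ext (Subtype.ext ?_))
  change monomial (Pi.single (Sum.inl i) 1) 1 * monomial (Pi.single (Sum.inl i) (-1)) 1 = _
  rw [monomial_mul_monomial, ← Pi.single_add]
  simp only [add_neg_cancel, Pi.single_zero, mul_one]
  rfl

theorem isUnit_polyReduction_logExponent :
    IsUnit (polyReduction K n m (MvPolynomial.monomial (logExponent n m 1) 1)) := by
  have h : MvPolynomial.monomial (logExponent n m 1) (1 : Reduction K) =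
      ∏ i : Fin n, MvPolynomial.X (Sum.inl i) := by
    rw [MvPolynomial.monomial_eq, Finsupp.prod_fintype _ _ (by simp)]
    simp [logExponent, Fintype.prod_sum_type]
  rw [h, map_prod]
  refine IsUnit.prod_univ_iff.2 fun i => ?_
  simp only [polyReduction, MvPolynomial.eval₂Hom_X']
  exact (isUnit_varBall i).map _

/-- The reduction is the Laurent polynomial ring in $T_1,\dots,T_n$ and polynomial ring in the other
variables over the residue field, so Hilbert's theorem reaches it. -/
theorem isLocalization_polyReduction :
    letI := (polyReduction K n m).toAlgebra
    IsLocalization (Submonoid.powers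
      (MvPolynomial.monomial (logExponent n m 1) (1 : Reduction K)))
      (Reduction (ringA K n m)) := by
  let := (polyReduction K n m).toAlgebra
  have hpow : ∀ N, (MvPolynomial.monomial (logExponent n m 1) (1 : Reduction K)) ^ N =
      MvPolynomial.monomial (logExponent n m N) 1 := fun N => by
    rw [MvPolynomial.monomial_pow, one_pow, ← logExponent_smul]
  exact
    { map_units := by
        rintro ⟨_, N, rfl⟩
        change IsUnit (polyReduction K n m _)
        rw [map_pow]
        exact isUnit_polyReduction_logExponent.pow N
      surj := fun z => by
        obtain ⟨N, f, h⟩ := exists_polyReduction_eq z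
        exact ⟨(f, ⟨_, N, rfl⟩), by
          change z * polyReduction K n m
            ((MvPolynomial.monomial (logExponent n m 1) (1 : Reduction K)) ^ N) =
              polyReduction K n m f
          rw [hpow, h]⟩
      exists_of_eq := fun {x y} h => ⟨1, by rw [polyReduction_injective h]⟩ }

theorem finiteFreeResolutions_reduction : FiniteFreeResolutions (Reduction (ringA K n m)) ∧
    IsNoetherianRing (Reduction (ringA K n m)) := by
  have := isMaximal_openUnitBall (K := K)
  let : Field (Reduction K) := Ideal.Quotient.field (openUnitBall K)
  let := (polyReduction K n m).toAlgebra
  have hloc := isLocalization_polyReduction (K := K) (n := n) (m := m)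
  exact ⟨(FiniteFreeResolutions.mvPolynomial (Reduction K) (Fin n ⊕ Fin m)).isLocalization
    (Submonoid.powers (MvPolynomial.monomial (logExponent n m 1) (1 : Reduction K))) _,
    IsLocalization.isNoetherianRing
    (Submonoid.powers (MvPolynomial.monomial (logExponent n m 1) (1 : Reduction K))) _
    inferInstance⟩

/-- Finite projective modules of rank one over `𝒜` are free, if `K` is discretely valued. -/
theorem exists_linearEquiv_of_rankAtStalk_eq_one {ϖ : K} (h0 : ϖ ≠ 0) (h1 : ‖ϖ‖ < 1)
    (hdisc : ∀ x : K, ‖x‖ < 1 → ‖x‖ ≤ ‖ϖ‖) (M : Type*) [AddCommGroup M]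
    [Module (ringA K n m) M] [Module.Finite (ringA K n m) M] [Module.Projective (ringA K n m) M]
    (h : ∀ P : PrimeSpectrum (ringA K n m), Module.rankAtStalk M P = 1) :
    Nonempty (ringA K n m ≃ₗ[ringA K n m] M) := by
  have hred := finiteFreeResolutions_reduction (K := K) (n := n) (m := m)
  have := hred.2
  have hst : Module.IsStablyFree (ringA K n m) M := by
    refine isStablyFree_of_finiteFreeResolutions (ϖ := algebraMap K (ringA K n m) ϖ) hred.1
      ((IsUnit.mk0 ϖ h0).map _) (by rwa [norm_algebraMap_eq]) (fun x => ?_) (fun x hx => ?_)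
      (fun x => ?_) M
    · rw [norm_algebraMap_mul, norm_algebraMap_eq]
    · obtain ⟨u, hu⟩ := norm_eq_iff_coeff x
      rw [norm_algebraMap_eq, hu]
      exact hdisc _ (hu ▸ hx)
    · simp only [← map_pow, norm_algebraMap_mul, norm_pow]
      have := (tendsto_pow_atTop_nhds_zero_of_lt_one (norm_nonneg ϖ) h1).mul_const ‖x‖
      rw [zero_mul] at this
      obtain ⟨N, hN⟩ := (this.eventually_le_const one_pos).exists
      exact ⟨N, hN⟩
  exact free_of_isStablyFree_of_rankAtStalk_eq_one h

end Reduction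

end Polyannulus

/-! ### Absolute values of integers and factorials in $K$ -/

namespace WittField

variable (p : ℕ) [hp : Fact p.Prime] (k : Type u) [Field k] [CharP k p] [PerfectRing k p]

/-- In a Bézout relation $aw+bp=1$ both terms would have norm below one if $|w|<1$. -/
theorem norm_natCast_eq_one {w : ℕ} (hw : ¬ p ∣ w) : ‖(w : WittField p k)‖ = 1 := by
  refine le_antisymm (IsUltrametricDist.norm_natCast_le_one _ w) (not_lt.1 fun hlt => ?_)
  have hcop : IsCoprime (w : ℤ) (p : ℤ) := by
    rw [Nat.isCoprime_iff_coprime]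
    exact ((Nat.Prime.coprime_iff_not_dvd hp.out).2 hw).symm
  obtain ⟨a, b, hab⟩ := hcop
  have h1 : (a : WittField p k) * w + b * p = 1 := by
    have := congrArg (Int.cast (R := WittField p k)) hab
    push_cast at this
    exact this
  have hlt1 : ∀ (c : ℤ) (x : WittField p k), ‖x‖ < 1 → ‖(c : WittField p k) * x‖ < 1 := by
    intro c x hx
    rw [norm_mul]
    exact (mul_le_of_le_one_left (norm_nonneg _)
      (IsUltrametricDist.norm_intCast_le_one _ c)).trans_lt hx
  have hp1 : ‖(p : WittField p k)‖ < 1 := by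
    rw [norm_p]
    exact inv_lt_one_of_one_lt₀ (by exact_mod_cast hp.out.one_lt)
  have h2 := (IsUltrametricDist.norm_add_le_max ((a : WittField p k) * w) (b * p)).trans_lt
    (max_lt (hlt1 a _ hlt) (hlt1 b _ hp1))
  rw [h1, norm_one] at h2
  exact lt_irrefl _ h2

theorem norm_natCast {z : ℕ} (hz : z ≠ 0) :
    ‖(z : WittField p k)‖ = ((p : ℝ) ^ padicValNat p z)⁻¹ := by
  obtain ⟨v, w, hw, rfl⟩ := Nat.exists_eq_pow_mul_and_not_dvd hz p hp.out.ne_one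
  have hw0 : w ≠ 0 := by
    rintro rfl
    exact hw (dvd_zero p)
  rw [padicValNat.mul (pow_ne_zero _ hp.out.ne_zero) hw0, padicValNat.prime_pow,
    padicValNat.eq_zero_of_not_dvd hw, add_zero]
  push_cast
  rw [norm_mul, norm_pow, norm_p, norm_natCast_eq_one p k hw, mul_one, inv_pow]

instance : CharZero (WittField p k) := charZero_of_inj_zero fun z hz => by
  by_contra h
  have := norm_natCast p k h
  rw [hz, norm_zero] at this
  have hp0 : (0 : ℝ) < p := by exact_mod_cast hp.out.pos
  have : (0 : ℝ) < ((p : ℝ) ^ padicValNat p z)⁻¹ := by positivity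
  linarith

/-- $|1/z|=p^{v(z)}$ is a divisor of $z$. This bounds the loss of decay under integration by one
power of the exponent. -/
theorem norm_inv_natCast_le (z : ℕ) : ‖(z : WittField p k)⁻¹‖ ≤ z := by
  rcases eq_or_ne z 0 with rfl | hz
  · simp
  · rw [norm_inv, norm_natCast p k hz, inv_inv]
    exact_mod_cast Nat.le_of_dvd (Nat.pos_of_ne_zero hz) pow_padicValNat_dvd

theorem norm_inv_intCast_le (z : ℤ) : ‖(z : WittField p k)⁻¹‖ ≤ z.natAbs := by
  rcases Int.natAbs_eq z with h | h <;> rw [h]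
  · simpa using norm_inv_natCast_le p k z.natAbs
  · simpa [inv_neg] using norm_inv_natCast_le p k z.natAbs

/-- By Legendre's formula $(p-1)v(l!)$ is $l$ minus the digit sum of $l$. The crude bound $v(l!)\le
l$ suffices for the exponential on $\|g\|\le p^{-2}$. -/
theorem norm_inv_factorial_le (l : ℕ) :
    ‖((Nat.factorial l : ℕ) : WittField p k)⁻¹‖ ≤ (p : ℝ) ^ l := by
  rw [norm_inv, norm_natCast p k (Nat.factorial_ne_zero l), inv_inv]
  refine pow_le_pow_right₀ (by exact_mod_cast hp.out.one_lt.le) ?_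
  have h := sub_one_mul_padicValNat_factorial (p := p) l
  have h2 : 1 ≤ p - 1 := by have := hp.out.two_le; omega
  calc padicValNat p l.factorial ≤ (p - 1) * padicValNat p l.factorial :=
        Nat.le_mul_of_pos_left _ h2
    _ ≤ l := by rw [h]; exact Nat.sub_le _ _

/-- An element of $W(k)$ of norm below one is not a unit, hence lies in the maximal ideal $(p)$. -/
theorem norm_le_inv_of_norm_lt_one (x : WittField p k) (hx : ‖x‖ < 1) : ‖x‖ ≤ ‖(p : WittField p k)‖ := by
  obtain ⟨a, rfl⟩ := exists_of_norm_le_one p k x hx.le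
  have ha : ¬ IsUnit a := by
    rintro ⟨b, rfl⟩
    have hb : ‖algebraMap (WittVector p k) (WittField p k) ((b⁻¹ : (WittVector p k)ˣ) :
        WittVector p k)‖ ≤ 1 := by
      have := (norm_algebraMap_le_iff p k ((b⁻¹ : (WittVector p k)ˣ) : WittVector p k) 0).2 (by simp)
      simpa using this
    have h1 := norm_mul (algebraMap (WittVector p k) (WittField p k) b)
      (algebraMap (WittVector p k) (WittField p k) ((b⁻¹ : (WittVector p k)ˣ) : WittVector p k))
    rw [← map_mul, Units.mul_inv, map_one, norm_one] at h1
    nlinarith [norm_nonneg (algebraMap (WittVector p k) (WittField p k) b)]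
  have hmem : a ∈ Ideal.span {(p : WittVector p k)} := by
    have h1 : a ∈ IsLocalRing.maximalIdeal (WittVector p k) := (IsLocalRing.mem_maximalIdeal a).2 ha
    have h2 : (primeP p k).asIdeal = IsLocalRing.maximalIdeal (WittVector p k) :=
      IsLocalRing.eq_maximalIdeal (primeP p k).isMaximal
    rw [← h2] at h1
    exact h1
  have := (norm_algebraMap_le_iff p k a 1).2 (by simpa using hmem)
  rw [norm_p]
  simpa using this

end WittField

/-! ### The exponential -/

/-- The exponential of a small element. -/
theorem exists_isUnit_exp {p : ℕ} [hp : Fact p.Prime] {K A : Type*} [NormedField K] [CharZero K]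
    [NormedCommRing A] [NormOneClass A] [CompleteSpace A] [IsUltrametricDist A] [NormedAlgebra K A]
    (hK : ∀ l : ℕ, ‖((Nat.factorial l : ℕ) : K)⁻¹‖ ≤ (p : ℝ) ^ l) (g : A)
    (hg : ‖g‖ ≤ ((p : ℝ)⁻¹) ^ 2) :
    ∃ x : A, IsUnit x ∧ ∀ d : Derivation K A A, Continuous d → d x = x * d g := by
  have hp1 : (1 : ℝ) < p := by exact_mod_cast hp.out.one_lt
  have hp0 : (0 : ℝ) < p := by linarith
  have hpi : (p : ℝ)⁻¹ < 1 := inv_lt_one_of_one_lt₀ hp1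
  let t : ℕ → A := fun l => ((Nat.factorial l : ℕ) : K)⁻¹ • g ^ l
  -- $\|g^l/l!\|\le p^l\cdot p^{-2l}=p^{-l}$.
  have ht : ∀ l, ‖t l‖ ≤ ((p : ℝ)⁻¹) ^ l := fun l => by
    refine (norm_smul_le _ _).trans ?_
    calc _ ≤ (p : ℝ) ^ l * (((p : ℝ)⁻¹) ^ 2) ^ l := by
          refine mul_le_mul (hK l) ((norm_pow_le g l).trans ?_) (norm_nonneg _) (by positivity)
          exact pow_le_pow_left₀ (norm_nonneg _) hg l
      _ = ((p : ℝ)⁻¹) ^ l := by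
          rw [← mul_pow]
          congr 1
          field_simp
  have hs : Summable t := Summable.of_norm_bounded
    (summable_geometric_of_lt_one (by positivity) hpi) ht
  refine ⟨∑' l, t l, ?_, fun d hd => ?_⟩
  · have h1 : ∑' l, t l = 1 - (-∑' l, t (l + 1)) := by
      rw [hs.tsum_eq_zero_add]
      simp [t]
    have h2 : ‖-∑' l, t (l + 1)‖ < 1 := by
      rw [norm_neg]
      refine (IsUltrametricDist.norm_tsum_le_of_forall_le_of_nonneg (by positivity)
        fun l => ?_).trans_lt hpi
      refine (ht (l + 1)).trans ?_
      rw [pow_succ]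
      exact mul_le_of_le_one_left (by positivity) (pow_le_one₀ (by positivity) hpi.le)
    rw [h1]
    exact isUnit_one_sub_of_norm_lt_one h2
  · have h1 : HasSum (fun l => d (t l)) (d (∑' l, t l)) := hs.hasSum.map d hd
    -- The derivative of each term is the previous term times `d g`; continuity lets `d` pass
    -- through the sum.
    have h2 : ∀ l, d (t (l + 1)) = t l * d g := fun l => by
      simp only [t, Derivation.map_smul, Derivation.leibniz_pow, Nat.add_sub_cancel]
      rw [← Nat.cast_smul_eq_nsmul K, smul_smul, smul_mul_assoc, smul_eq_mul]
      congr 1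
      rw [Nat.factorial_succ]
      push_cast
      have : ((l : K) + 1) ≠ 0 := by exact_mod_cast Nat.succ_ne_zero l
      have h3 : ((l.factorial : ℕ) : K) ≠ 0 := by exact_mod_cast Nat.factorial_ne_zero l
      field_simp
    have h3 : HasSum (fun l => d (t (l + 1))) ((∑' l, t l) * d g) := by
      simp only [h2]
      exact hs.hasSum.mul_right _
    rw [hasSum_nat_add_iff (f := fun l => d (t l)) 1] at h3
    simp only [Finset.sum_range_one] at h3
    have h4 : d (t 0) = 0 := by simp [t]
    rw [h4, add_zero] at h3
    exact h1.unique h3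

/-! ### Polynomial decay in the pole order -/

namespace Polyannulus

open Laurent

section Decay

variable {K : Type u} [NormedField K] [IsUltrametricDist K] [CompleteSpace K] {n m : ℕ}

/-- The total order of the poles of `T^u` along `T_1 ⋯ T_n = 0`. -/
def poleOrder (u : Fin n ⊕ Fin m → ℤ) : ℕ := ∑ i : Fin n, (-u (Sum.inl i)).toNat

theorem poleOrder_add_le (u v : Fin n ⊕ Fin m → ℤ) :
    poleOrder (u + v) ≤ poleOrder u + poleOrder v := by
  unfold poleOrder
  rw [← Finset.sum_add_distrib]
  refine Finset.sum_le_sum fun i _ => ?_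
  rw [Pi.add_apply]
  omega

theorem le_poleOrder (u : Fin n ⊕ Fin m → ℤ) (i : Fin n) :
    -u (Sum.inl i) ≤ poleOrder u := by
  have : (-u (Sum.inl i)).toNat ≤ poleOrder u :=
    Finset.single_le_sum (f := fun i => (-u (Sum.inl i)).toNat) (fun _ _ => Nat.zero_le _)
      (Finset.mem_univ i)
  omega

/-- The coefficients of `x` decay like the `-ρ`-th power of the pole order, with constant `C`. -/
def DecayBound (ρ C : ℝ) (x : ringA K n m) : Prop :=
  ∀ u, ‖x.1.coeff u‖ * (1 + poleOrder u : ℝ) ^ ρ ≤ C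

theorem DecayBound.nonneg {ρ C : ℝ} {x : ringA K n m} (h : DecayBound ρ C x) : 0 ≤ C :=
  le_trans (by positivity) (h 0)

theorem DecayBound.mono {ρ C C' : ℝ} {x : ringA K n m} (h : DecayBound ρ C x) (hC : C ≤ C') :
    DecayBound ρ C' x := fun u => (h u).trans hC

theorem DecayBound.add {ρ C C' : ℝ} {x y : ringA K n m} (h : DecayBound ρ C x)
    (h' : DecayBound ρ C' y) : DecayBound ρ (max C C') (x + y) := fun u => by
  have h1 : ‖(x + y).1.coeff u‖ ≤ max ‖x.1.coeff u‖ ‖y.1.coeff u‖ :=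
    IsUltrametricDist.norm_add_le_max _ _
  have h2 : (0 : ℝ) ≤ (1 + poleOrder u : ℝ) ^ ρ := by positivity
  refine (mul_le_mul_of_nonneg_right h1 h2).trans ?_
  rw [max_mul_of_nonneg _ _ h2]
  exact max_le_max (h u) (h' u)

theorem DecayBound.neg {ρ C : ℝ} {x : ringA K n m} (h : DecayBound ρ C x) :
    DecayBound ρ C (-x) := fun u => by
  have : ‖(-x).1.coeff u‖ = ‖x.1.coeff u‖ := norm_neg (x.1.coeff u)
  rw [this]
  exact h u

theorem decay_mul_aux {x y : ringA K n m} (w : Fin n ⊕ Fin m → ℤ) {s C : ℝ} (hs : 0 < s)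
    (hC : 0 ≤ C) (h : ∀ u, ‖x.1.coeff u‖ * ‖y.1.coeff (w - u)‖ * s ≤ C) :
    ‖(x * y).1.coeff w‖ * s ≤ C := by
  rw [← le_div_iff₀ hs]
  change ‖(x.1 * y.1).coeff w‖ ≤ _
  rw [coeff_mul]
  refine IsUltrametricDist.norm_tsum_le_of_forall_le_of_nonneg (by positivity) fun u => ?_
  rw [norm_mul, le_div_iff₀ hs]
  exact h u

/-- The pole order is subadditive, so $1+P$ is submultiplicative. -/
theorem DecayBound.mul {ρ C C' : ℝ} (hρ : 0 ≤ ρ) {x y : ringA K n m} (h : DecayBound ρ C x)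
    (h' : DecayBound ρ C' y) : DecayBound ρ (C * C') (x * y) := fun w => by
  refine decay_mul_aux w (by positivity) (mul_nonneg h.nonneg h'.nonneg) fun u => ?_
  have h1 : (1 + poleOrder w : ℝ) ≤ (1 + poleOrder u) * (1 + poleOrder (w - u)) := by
    have := poleOrder_add_le u (w - u)
    rw [add_sub_cancel] at this
    have h2 : (poleOrder w : ℝ) ≤ poleOrder u + poleOrder (w - u) := by exact_mod_cast this
    nlinarith [mul_nonneg (Nat.cast_nonneg (α := ℝ) (poleOrder u))
      (Nat.cast_nonneg (α := ℝ) (poleOrder (w - u)))]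
  calc _ ≤ ‖x.1.coeff u‖ * ‖y.1.coeff (w - u)‖ *
        ((1 + poleOrder u : ℝ) ^ ρ * (1 + poleOrder (w - u) : ℝ) ^ ρ) := by
        rw [← Real.mul_rpow (by positivity) (by positivity)]
        gcongr
    _ = (‖x.1.coeff u‖ * (1 + poleOrder u : ℝ) ^ ρ) *
        (‖y.1.coeff (w - u)‖ * (1 + poleOrder (w - u) : ℝ) ^ ρ) := by ring
    _ ≤ C * C' := mul_le_mul (h u) (h' _) (by positivity) h.nonneg

/-- The constant must not grow with the exponent, whereas `DecayBound.mul` alone would give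
$C^{l+1}$. Here $1+P(w)\le 2\max(a,b)$, where $a$ and $b$ are $1+P$ at the two exponents. The factor
with the larger value supplies the decay with constant $C$, while the other is bounded by $\|y\|$,
which absorbs $2^\rho$. -/
theorem DecayBound.pow {ρ C : ℝ} (hρ : 0 ≤ ρ) {y : ringA K n m} (h : DecayBound ρ C y)
    (hy : (2 : ℝ) ^ ρ * ‖y‖ ≤ 1) (l : ℕ) : DecayBound ρ C (y ^ (l + 1)) := by
  have h2 : (1 : ℝ) ≤ 2 ^ ρ := Real.one_le_rpow (by norm_num) hρ
  have hy1 : ‖y‖ ≤ 1 := by nlinarith [norm_nonneg y]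
  induction l with
  | zero => simpa using h
  | succ l ih =>
    rw [pow_succ]
    intro w
    refine decay_mul_aux w (by positivity) h.nonneg fun u => ?_
    set a : ℝ := 1 + poleOrder u with ha
    set b : ℝ := 1 + poleOrder (w - u) with hb
    have ha0 : 0 ≤ a := by positivity
    have hb0 : 0 ≤ b := by positivity
    have h1 : (1 + poleOrder w : ℝ) ≤ 2 * max a b := by
      have := poleOrder_add_le u (w - u)
      rw [add_sub_cancel] at this
      have h2 : (poleOrder w : ℝ) ≤ poleOrder u + poleOrder (w - u) := by exact_mod_cast this
      have h3 := le_max_left a b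
      have h4 := le_max_right a b
      linarith
    have h3 : (1 + poleOrder w : ℝ) ^ ρ ≤ 2 ^ ρ * max (a ^ ρ) (b ^ ρ) := by
      have h4 : (max a b) ^ ρ ≤ max (a ^ ρ) (b ^ ρ) := by
        rcases le_total a b with hab | hab
        · rw [max_eq_right hab]
          exact le_max_right _ _
        · rw [max_eq_left hab]
          exact le_max_left _ _
      calc (1 + poleOrder w : ℝ) ^ ρ ≤ (2 * max a b) ^ ρ := by gcongr
        _ = 2 ^ ρ * (max a b) ^ ρ := Real.mul_rpow (by norm_num) (le_max_of_le_left ha0)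
        _ ≤ _ := by gcongr
    have hxl : ‖(y ^ (l + 1)).1.coeff u‖ ≤ ‖y‖ := by
      refine (norm_coeff_le _ u).trans ((norm_pow_le y (l + 1)).trans ?_)
      rw [pow_succ]
      exact mul_le_of_le_one_left (norm_nonneg _) (pow_le_one₀ (norm_nonneg _) hy1)
    have hyv : ‖y.1.coeff (w - u)‖ ≤ ‖y‖ := norm_coeff_le _ _
    have key : ∀ s t c : ℝ, 0 ≤ s → s * c ≤ C → 0 ≤ t → t ≤ ‖y‖ → s * t * (2 ^ ρ * c) ≤ C := by
      intro s t c hs hsc ht hty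
      have h5 : t * 2 ^ ρ ≤ 1 := by nlinarith
      calc s * t * (2 ^ ρ * c) = (t * 2 ^ ρ) * (s * c) := by ring
        _ ≤ (t * 2 ^ ρ) * C := mul_le_mul_of_nonneg_left hsc (by positivity)
        _ ≤ C := mul_le_of_le_one_left h.nonneg h5
    refine (mul_le_mul_of_nonneg_left h3 (by positivity)).trans ?_
    rcases max_choice (a ^ ρ) (b ^ ρ) with hm | hm <;> rw [hm]
    · exact key _ _ _ (norm_nonneg _) (ih u) (norm_nonneg _) hyv
    · rw [mul_comm ‖(y ^ (l + 1)).1.coeff u‖]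
      exact key _ _ _ (norm_nonneg _) (h _) (norm_nonneg _) hxl

theorem DecayBound.one (ρ : ℝ) : DecayBound ρ 1 (1 : ringA K n m) := fun u => by
  classical
  change ‖(1 : Laurent K (Fin n ⊕ Fin m)).coeff u‖ * _ ≤ 1
  rw [coeff_one]
  split_ifs with h
  · subst h
    simp [poleOrder]
  · simp

/-- All positive powers of $y$ share the constant $C$, so by the ultrametric inequality their sum,
the geometric series, satisfies it too; the term $1$ accounts for the maximum. -/
theorem exists_inverse_decayBound {ρ C : ℝ} (hρ : 0 ≤ ρ) {y : ringA K n m}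
    (h : DecayBound ρ C y) (hy : (2 : ℝ) ^ ρ * ‖y‖ ≤ 1) (hy1 : ‖y‖ < 1) :
    ∃ z : ringA K n m, (1 - y) * z = 1 ∧ DecayBound ρ (max 1 C) z := by
  have hs : Summable fun l => y ^ l := summable_geometric_of_norm_lt_one hy1
  refine ⟨∑' l, y ^ l, mul_neg_geom_series y hy1, fun w => ?_⟩
  have hc : HasSum (fun l => (y ^ l).1.coeff w) ((∑' l, y ^ l).1.coeff w) :=
    hs.hasSum.map (AddMonoidHom.mk' (fun a : ringA K n m => a.1.coeff w) fun _ _ => rfl)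
      ((continuous_coeff w).comp continuous_subtype_val)
  have hpos : (0 : ℝ) < (1 + poleOrder w : ℝ) ^ ρ := by positivity
  rw [← hc.tsum_eq, ← le_div_iff₀ hpos]
  refine IsUltrametricDist.norm_tsum_le_of_forall_le_of_nonneg (by positivity) fun l => ?_
  rw [le_div_iff₀ hpos]
  cases l with
  | zero =>
    rw [pow_zero]
    exact (DecayBound.one ρ w).trans (le_max_left _ _)
  | succ l => exact (h.pow hρ hy l w).trans (le_max_right _ _)

variable {p : ℕ} [hp : Fact p.Prime]

/-- The coefficients of the elements of `𝒜^r` decay faster than any power `-ρ` with `rρ ≤ 1`. -/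
theorem exists_decayBound_of_mem_ringAr {r ρ : ℝ} (hρ : 0 ≤ ρ) (hr : r * ρ ≤ 1)
    {x : ringA K n m} (hx : x ∈ ringAr K n m p r) : ∃ C, DecayBound ρ C x := by
  obtain ⟨c, hc, J, h⟩ := hx
  have hp1 : (1 : ℝ) < p := by exact_mod_cast hp.out.one_lt
  have hp0 : (0 : ℝ) < p := by linarith
  -- The factor $n$ comes from adding the poles along $n$ divisors, the factor $2$ from $1+P\le 2P$
  -- for $P\ge1$. The three entries of the maximum below serve $P=0$ or a zero coefficient, then
  -- $j=J$, then $j>J$.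
  set B : ℝ := (2 * (n * c)) ^ ρ with hB
  have hB0 : 0 ≤ B := by positivity
  refine ⟨max ‖x‖ (max (‖x‖ * (B * ((p : ℝ) ^ (r * J)) ^ ρ)) (B * p)), fun u => ?_⟩
  have hxu : ‖x.1.coeff u‖ ≤ ‖x‖ := norm_coeff_le _ u
  rcases Nat.eq_zero_or_pos (poleOrder u) with hP | hP
  · rw [hP]
    simp only [Nat.cast_zero, add_zero, Real.one_rpow, mul_one]
    exact hxu.trans (le_max_left _ _)
  rcases eq_or_ne (x.1.coeff u) 0 with hu0 | hu0
  · rw [hu0, norm_zero, zero_mul]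
    exact (norm_nonneg x).trans (le_max_left _ _)
  have hpole : ∀ j : ℕ, J ≤ j → (p : ℝ) ^ (-(j : ℤ)) ≤ ‖x.1.coeff u‖ →
      (1 + poleOrder u : ℝ) ^ ρ ≤ B * ((p : ℝ) ^ (r * j)) ^ ρ := by
    intro j hj hju
    have h1 : (poleOrder u : ℝ) ≤ n * (c * (p : ℝ) ^ (r * j)) := by
      unfold poleOrder
      rw [Nat.cast_sum]
      refine (Finset.sum_le_card_nsmul _ _ (c * (p : ℝ) ^ (r * j)) fun i _ => ?_).trans
        (by simp)
      have h2 := h j hj i u hju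
      have h3 : (0 : ℝ) ≤ c * (p : ℝ) ^ (r * j) := by positivity
      rcases le_total 0 (-u (Sum.inl i)) with h4 | h4
      · have h5 : (((-u (Sum.inl i)).toNat : ℤ) : ℝ) = ((-u (Sum.inl i) : ℤ) : ℝ) := by
          rw [Int.toNat_of_nonneg h4]
        rw [Int.cast_natCast] at h5
        rw [h5]
        push_cast
        linarith
      · rw [Int.toNat_of_nonpos h4]
        simpa using h3
    rw [hB, ← Real.mul_rpow (by positivity) (by positivity)]
    refine Real.rpow_le_rpow (by positivity) ?_ hρ
    have h2 : (1 : ℝ) ≤ poleOrder u := by exact_mod_cast hP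
    calc (1 + poleOrder u : ℝ) ≤ 2 * poleOrder u := by linarith
      _ ≤ 2 * (n * (c * (p : ℝ) ^ (r * j))) := by linarith
      _ = _ := by ring
  have hex : ∃ j : ℕ, J ≤ j ∧ (p : ℝ) ^ (-(j : ℤ)) ≤ ‖x.1.coeff u‖ := by
    have h1 := tendsto_pow_atTop_nhds_zero_of_lt_one (r := (p : ℝ)⁻¹) (by positivity)
      (inv_lt_one_of_one_lt₀ hp1)
    obtain ⟨j, hj1, hj2⟩ := ((h1.eventually_le_const (norm_pos_iff.2 hu0)).and
      (eventually_ge_atTop J)).exists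
    exact ⟨j, hj2, by simpa using hj1⟩
  classical
  obtain ⟨hj1, hj2⟩ := Nat.find_spec hex
  -- For the least admissible $j$, if $j>J$ then $|x_u|<p^{-(j-1)}$ by minimality, while
  -- $(1+P)^\rho\le Bp^{r\rho j}\le Bp^j$. The product is at most $Bp$.
  set j := Nat.find hex with hj
  rcases hj1.eq_or_lt with hJ | hJ
  · refine le_max_of_le_right (le_max_of_le_left ?_)
    have := hpole j hj1 hj2
    rw [← hJ] at this
    exact mul_le_mul hxu this (by positivity) (norm_nonneg _)
  · refine le_max_of_le_right (le_max_of_le_right ?_)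
    have hlt : ‖x.1.coeff u‖ < (p : ℝ) ^ (-((j - 1 : ℕ) : ℤ)) := by
      by_contra hcon
      exact Nat.find_min hex (m := j - 1) (by omega) ⟨by omega, not_lt.1 hcon⟩
    have h1 : ((p : ℝ) ^ (r * j)) ^ ρ ≤ (p : ℝ) ^ (j : ℝ) := by
      rw [← Real.rpow_mul hp0.le]
      refine Real.rpow_le_rpow_of_exponent_le hp1.le ?_
      have : (0 : ℝ) ≤ j := by positivity
      nlinarith
    have h2 : (p : ℝ) ^ (-((j - 1 : ℕ) : ℤ)) * (p : ℝ) ^ (j : ℝ) = p := by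
      rw [Real.rpow_natCast, ← zpow_natCast, ← zpow_add₀ hp0.ne']
      have : (-((j - 1 : ℕ) : ℤ) + j) = 1 := by omega
      rw [this, zpow_one]
    calc ‖x.1.coeff u‖ * (1 + poleOrder u : ℝ) ^ ρ
        ≤ (p : ℝ) ^ (-((j - 1 : ℕ) : ℤ)) * (B * (p : ℝ) ^ (j : ℝ)) := by
          refine mul_le_mul hlt.le ((hpole j hj1 hj2).trans ?_) (by positivity) (by positivity)
          exact mul_le_mul_of_nonneg_left h1 hB0
      _ = B * ((p : ℝ) ^ (-((j - 1 : ℕ) : ℤ)) * (p : ℝ) ^ (j : ℝ)) := by ring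
      _ = B * p := by rw [h2]

end Decay

end Polyannulus

/-! ### Integration of closed forms with decay -/

namespace Polyannulus

open Laurent

section Primitive

variable {K : Type u} [NormedField K] [IsUltrametricDist K] [CompleteSpace K] {n m : ℕ}

/-- The coefficient of `T^u` in `T_s ω`. -/
def logCoeff (s : Fin n ⊕ Fin m) (ω : ringA K n m) (u : Fin n ⊕ Fin m → ℤ) : K :=
  ω.1.coeff (u - Pi.single s 1)

theorem logCoeff_null (s : Fin n ⊕ Fin m) (ω : ringA K n m) :
    Tendsto (logCoeff s ω) cofinite (𝓝 0) := by
  have hinj : Function.Injective fun u : Fin n ⊕ Fin m → ℤ => u - Pi.single s 1 :=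
    sub_left_injective
  exact ω.1.coeff_null.comp hinj.tendsto_cofinite

/-- Closedness read coefficientwise: $T_s\partial_s$ multiplies $T^u$ by $u_s$. -/
theorem mul_logCoeff_comm {s t : Fin n ⊕ Fin m} {ω η : ringA K n m}
    (h : s ≠ t → derivA K n m s η = derivA K n m t ω) (hst : s = t → ω = η)
    (u : Fin n ⊕ Fin m → ℤ) : (u s : K) * logCoeff t η u = u t * logCoeff s ω u := by
  by_cases hs : s = t
  · subst hs
    rw [hst rfl]
  · have h1 := congrArg (fun a : ringA K n m => a.1.coeff (u - Pi.single s 1 - Pi.single t 1)) (h hs)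
    change (deriv s η.1).coeff _ = (deriv t ω.1).coeff _ at h1
    rw [coeff_deriv, coeff_deriv, sub_add_cancel, sub_right_comm, sub_add_cancel] at h1
    simpa [logCoeff, Pi.single_apply, hs, Ne.symm hs] using h1

open Classical in
/-- The coefficients of the primitive of the polar part of a closed form. -/
noncomputable def primitiveCoeff (ω : Fin n ⊕ Fin m → ringA K n m) (u : Fin n ⊕ Fin m → ℤ) : K :=
  if h : ∃ i : Fin n, u (Sum.inl i) < 0 then
    -- For a closed form the quotient is the same for every index with a negative exponent.
    logCoeff (Sum.inl h.choose) (ω (Sum.inl h.choose)) u / u (Sum.inl h.choose)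
  else 0

theorem poleOrder_le_sub_single (u : Fin n ⊕ Fin m → ℤ) (s : Fin n ⊕ Fin m) :
    poleOrder u ≤ poleOrder (u - Pi.single s 1) := by
  refine Finset.sum_le_sum fun i _ => ?_
  have : (0 : ℤ) ≤ (Pi.single s 1 : Fin n ⊕ Fin m → ℤ) (Sum.inl i) := by
    rw [Pi.single_apply]
    split_ifs <;> simp
  rw [Pi.sub_apply]
  omega

/-- The place where $\rho>1$ is needed. Dividing by $u_i$ costs at most $P$, so coefficients of
large pole order are at most $BP^{1-\rho}$. For $P<N$ the cost is at most $N$, and the coefficients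
of $\omega$ tend to zero anyway. -/
theorem primitiveCoeff_null {ρ : ℝ} (hρ : 1 < ρ) (hK : ∀ z : ℤ, ‖(z : K)⁻¹‖ ≤ z.natAbs)
    (ω : Fin n ⊕ Fin m → ringA K n m) (hω : ∀ s, ∃ C, DecayBound ρ C (ω s)) :
    Tendsto (primitiveCoeff ω) cofinite (𝓝 0) := by
  choose C hC using hω
  set B : ℝ := ∑ s, C s with hB
  have hCB : ∀ s, DecayBound ρ B (ω s) := fun s => (hC s).mono
    (Finset.single_le_sum (f := C) (fun s _ => (hC s).nonneg) (Finset.mem_univ s))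
  rw [NormedAddGroup.tendsto_nhds_zero]
  intro ε hε
  obtain ⟨N, hN⟩ : ∃ N : ℕ, ∀ l : ℕ, N ≤ l → B * (l : ℝ) ^ (-(ρ - 1)) < ε := by
    have h1 := ((tendsto_rpow_neg_atTop (y := ρ - 1) (by linarith)).const_mul B).comp
      tendsto_natCast_atTop_atTop
    rw [mul_zero] at h1
    exact eventually_atTop.1 (h1.eventually_lt_const hε)
  have hδ : 0 < ε / (N + 1) := by positivity
  have hev : ∀ᶠ u in cofinite, ∀ s, ‖logCoeff s (ω s) u‖ < ε / (N + 1) :=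
    eventually_all.2 fun s => NormedAddGroup.tendsto_nhds_zero.1 (logCoeff_null s (ω s)) _ hδ
  filter_upwards [hev] with u hu
  unfold primitiveCoeff
  split_ifs with h
  · set i := h.choose
    have hi : u (Sum.inl i) < 0 := h.choose_spec
    have hi2 := le_poleOrder u i
    have habs : ((u (Sum.inl i)).natAbs : ℝ) ≤ poleOrder u := by
      exact_mod_cast (by omega : (u (Sum.inl i)).natAbs ≤ poleOrder u)
    have hle : ‖logCoeff (Sum.inl i) (ω (Sum.inl i)) u / u (Sum.inl i)‖ ≤
        ‖logCoeff (Sum.inl i) (ω (Sum.inl i)) u‖ * poleOrder u := by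
      rw [div_eq_mul_inv, norm_mul]
      exact mul_le_mul_of_nonneg_left ((hK _).trans habs) (norm_nonneg _)
    refine hle.trans_lt ?_
    have hP : (1 : ℝ) ≤ poleOrder u := by
      exact_mod_cast (by omega : 1 ≤ poleOrder u)
    rcases le_or_gt N (poleOrder u) with hNP | hNP
    · refine lt_of_le_of_lt ?_ (hN _ hNP)
      have h1 := hCB (Sum.inl i) (u - Pi.single (Sum.inl i) 1)
      have h2 : (poleOrder u : ℝ) ^ ρ ≤
          (1 + poleOrder (u - Pi.single (Sum.inl i) 1) : ℝ) ^ ρ := by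
        refine Real.rpow_le_rpow (by positivity) ?_ (by linarith)
        have : (poleOrder u : ℝ) ≤ poleOrder (u - Pi.single (Sum.inl i) 1) := by
          exact_mod_cast poleOrder_le_sub_single u (Sum.inl i)
        linarith
      have h3 : (poleOrder u : ℝ) = (poleOrder u : ℝ) ^ ρ * (poleOrder u : ℝ) ^ (-(ρ - 1)) := by
        rw [← Real.rpow_add (by linarith)]
        simp
      calc _ = (‖logCoeff (Sum.inl i) (ω (Sum.inl i)) u‖ * (poleOrder u : ℝ) ^ ρ) *
            (poleOrder u : ℝ) ^ (-(ρ - 1)) := by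
            conv_lhs => rw [h3]
            ring
        _ ≤ B * (poleOrder u : ℝ) ^ (-(ρ - 1)) := by
            refine mul_le_mul_of_nonneg_right ?_ (by positivity)
            exact (mul_le_mul_of_nonneg_left h2 (norm_nonneg _)).trans h1
    · have h1 := hu (Sum.inl i)
      have h2 : (poleOrder u : ℝ) ≤ N := by exact_mod_cast hNP.le
      calc _ ≤ ε / (N + 1) * N := mul_le_mul h1.le h2 (by positivity) hδ.le
        _ < ε / (N + 1) * (N + 1) := mul_lt_mul_of_pos_left (by linarith) hδ
        _ = ε := by field_simp
  · rwa [norm_zero]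

/-- A closed form with sufficiently fast decay is, up to an exact form, logarithmic along
`T_1 ⋯ T_n = 0`. -/
theorem exists_primitive [CharZero K] {ρ : ℝ} (hρ : 1 < ρ)
    (hK : ∀ z : ℤ, ‖(z : K)⁻¹‖ ≤ z.natAbs) (ω : Fin n ⊕ Fin m → ringA K n m)
    (hω : ∀ s, ∃ C, DecayBound ρ C (ω s))
    (hcl : ∀ s t, derivA K n m s (ω t) = derivA K n m t (ω s)) :
    ∃ (f : ringA K n m) (c : Fin n → K) (g : Fin n ⊕ Fin m → ringA K n m),
      (∀ s, g s ∈ ringTate K n m) ∧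
      (∀ i, ω (Sum.inl i) = derivA K n m (Sum.inl i) f + (c i • invT K n m i + g (Sum.inl i))) ∧
      ∀ j, ω (Sum.inr j) = derivA K n m (Sum.inr j) f + g (Sum.inr j) := by
  classical
  have hsymm : ∀ s t (u : Fin n ⊕ Fin m → ℤ),
      (u s : K) * logCoeff t (ω t) u = u t * logCoeff s (ω s) u := fun s t u =>
    mul_logCoeff_comm (fun _ => hcl s t) (fun h => by rw [h]) u
  let f : ringA K n m := ⟨⟨primitiveCoeff ω, primitiveCoeff_null hρ hK ω hω⟩, by
    rintro u ⟨j, hj⟩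
    change primitiveCoeff ω u = 0
    unfold primitiveCoeff
    split_ifs with h
    · have : logCoeff (Sum.inl h.choose) (ω (Sum.inl h.choose)) u = 0 := by
        refine (ω _).2 _ ⟨j, ?_⟩
        simpa using hj
      rw [this, zero_div]
    · rfl⟩
  -- On polar exponents the primitive matches every component of the form, not just the one that was
  -- integrated, by `hsymm`.
  have hpolar : ∀ (s) (u : Fin n ⊕ Fin m → ℤ), (∃ i : Fin n, u (Sum.inl i) < 0) →
      (u s : K) * primitiveCoeff ω u = logCoeff s (ω s) u := by
    intro s u h
    unfold primitiveCoeff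
    rw [dif_pos h]
    have h0 : (u (Sum.inl h.choose) : K) ≠ 0 := by exact_mod_cast h.choose_spec.ne
    rw [mul_div_assoc', hsymm s _ u]
    field_simp
  have hregular : ∀ (u : Fin n ⊕ Fin m → ℤ), ¬ (∃ i : Fin n, u (Sum.inl i) < 0) →
      primitiveCoeff ω u = 0 := fun u h => by
    unfold primitiveCoeff
    rw [dif_neg h]
  have hdiff : ∀ s (v : Fin n ⊕ Fin m → ℤ), (ω s - derivA K n m s f).1.coeff v =
      logCoeff s (ω s) (v + Pi.single s 1) -
        ((v + Pi.single s 1 : Fin n ⊕ Fin m → ℤ) s : K) * primitiveCoeff ω (v + Pi.single s 1) := by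
    intro s v
    change (ω s).1.coeff v - (deriv s f.1).coeff v = _
    rw [coeff_deriv, logCoeff, add_sub_cancel_right]
    simp only [Pi.add_apply, Pi.single_eq_same]
    rfl
  -- The residue: the constant coefficient of $T_i\omega_i$.
  let c : Fin n → K := fun i => logCoeff (Sum.inl i) (ω (Sum.inl i)) 0
  let g : Fin n ⊕ Fin m → ringA K n m := Sum.elim
    (fun i => ω (Sum.inl i) - derivA K n m (Sum.inl i) f - c i • invT K n m i)
    (fun j => ω (Sum.inr j) - derivA K n m (Sum.inr j) f)
  refine ⟨f, c, g, fun s => ?_, fun i => ?_, fun j => ?_⟩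
  · rintro v ⟨t, ht⟩
    rcases t with i | j
    swap
    · exact (g s).2 v ⟨j, ht⟩
    rcases s with s | s
    · have hg : (g (Sum.inl s)).1.coeff v =
          (ω (Sum.inl s) - derivA K n m (Sum.inl s) f).1.coeff v -
            c s * (monomial (Pi.single (Sum.inl s) (-1)) 1 :
              Laurent K (Fin n ⊕ Fin m)).coeff v := rfl
      rw [hg, hdiff, coeff_monomial]
      by_cases h : ∃ i : Fin n, (v + Pi.single (Sum.inl s) 1 : Fin n ⊕ Fin m → ℤ) (Sum.inl i) < 0
      · rw [hpolar _ _ h, sub_self, if_neg, mul_zero, sub_zero]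
        rintro rfl
        obtain ⟨i', hi'⟩ := h
        rw [← Pi.single_add] at hi'
        simp at hi'
      · rw [hregular _ h, mul_zero, sub_zero]
        push Not at h
        -- Raising the exponent of $T_s$ by one removed all poles, so the pole was simple and along
        -- $T_s=0$.
        have his : i = s := by
          by_contra his
          have := h i
          rw [Pi.add_apply, Pi.single_eq_of_ne (by simpa using his)] at this
          omega
        subst his
        have h0 : (v + Pi.single (Sum.inl i) 1 : Fin n ⊕ Fin m → ℤ) (Sum.inl i) = 0 := by
          have := h i
          rw [Pi.add_apply, Pi.single_eq_same] at this ⊢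
          omega
        by_cases hv : v = Pi.single (Sum.inl i) (-1)
        · rw [if_pos hv, mul_one, hv, ← Pi.single_add]
          simp [c]
        · rw [if_neg hv, mul_zero, sub_zero]
          -- Away from the residue term some exponent $u_t$ is nonzero while $u_i=0$. The relation
          -- $u_t\cdot(T_i\omega_i)_u=u_i\cdot(T_t\omega_t)_u=0$ forces the coefficient to vanish,
          -- so the residue is a constant.
          obtain ⟨t, ht⟩ : ∃ t, (v + Pi.single (Sum.inl i) 1 : Fin n ⊕ Fin m → ℤ) t ≠ 0 := by
            by_contra! hcon
            refine hv (eq_of_sub_eq_zero (funext fun t => ?_))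
            have h2 := hcon t
            rw [Pi.add_apply] at h2
            rw [Pi.sub_apply, Pi.single_neg, Pi.neg_apply, sub_neg_eq_add]
            exact h2
          have h3 := hsymm t (Sum.inl i) (v + Pi.single (Sum.inl i) 1)
          rw [h0, Int.cast_zero, zero_mul] at h3
          exact (mul_eq_zero.1 h3).resolve_left (by exact_mod_cast ht)
    · have hg : (g (Sum.inr s)).1.coeff v =
          (ω (Sum.inr s) - derivA K n m (Sum.inr s) f).1.coeff v := rfl
      rw [hg, hdiff, hpolar _ _ ⟨i, by simpa using ht⟩, sub_self]
  · simp only [g, Sum.elim_inl]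
    abel
  · simp only [g, Sum.elim_inr]
    abel

end Primitive

end Polyannulus

/-! ### Approximation of coordinates by Tate series -/

namespace Polyannulus

open Laurent

section Frame

variable {K : Type u} [NormedField K] [IsUltrametricDist K] [CompleteSpace K] {n m : ℕ}

variable (K n m) in
/-- The element `(T_1 ⋯ T_n)^N` of `𝒜`, for `N ∈ ℤ`. -/
noncomputable def logVarPow (N : ℤ) : ringA K n m :=
  ⟨monomial (Sum.elim (fun _ => N) fun _ => 0) 1, by
    rintro u ⟨j, hj⟩
    rw [coeff_monomial, if_neg]
    rintro rfl
    simp at hj⟩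

theorem logVarPow_mul (N N' : ℤ) :
    logVarPow K n m N * logVarPow K n m N' = logVarPow K n m (N + N') := by
  refine Subtype.ext ?_
  change monomial _ 1 * monomial _ 1 = monomial _ 1
  rw [monomial_mul_monomial, mul_one]
  congr 1
  funext s
  rcases s with i | j <;> simp

theorem logVarPow_zero : logVarPow K n m 0 = 1 := by
  refine Subtype.ext ?_
  change monomial _ 1 = monomial 0 1
  congr 1
  funext s
  rcases s with i | j <;> simp

theorem norm_logVarPow (N : ℤ) : ‖logVarPow K n m N‖ = 1 := (norm_monomial _ _).trans norm_one

theorem exists_decayBound_logVarPow (ρ : ℝ) (N : ℤ) : ∃ C, DecayBound ρ C (logVarPow K n m N) := by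
  refine ⟨(1 + poleOrder (n := n) (m := m) (Sum.elim (fun _ => N) fun _ => 0) : ℝ) ^ ρ,
    fun u => ?_⟩
  change ‖(monomial _ 1 : Laurent K (Fin n ⊕ Fin m)).coeff u‖ * _ ≤ _
  rw [coeff_monomial]
  split_ifs with h
  · rw [h, norm_one, one_mul]
  · rw [norm_zero, zero_mul]
    positivity

open Classical in
/-- The part of a series with nonnegative exponents. -/
noncomputable def nonnegPart (a : ringA K n m) : ringA K n m :=
  ⟨⟨fun u => if ∀ s, 0 ≤ u s then a.1.coeff u else 0, by
    refine squeeze_zero_norm (a := fun u => ‖a.1.coeff u‖) (fun u => ?_) ?_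
    · split_ifs <;> simp
    · have := a.1.coeff_null.norm
      rwa [norm_zero] at this⟩, by
    rintro u ⟨j, hj⟩
    exact if_neg fun h => absurd (h (Sum.inr j)) (not_le.2 hj)⟩

theorem nonnegPart_mem_ringTate (a : ringA K n m) : nonnegPart a ∈ ringTate K n m := by
  rintro u ⟨s, hs⟩
  exact if_neg fun h => absurd (h s) (not_le.2 hs)

theorem ringTate_le_ringAr (p : ℕ) [hp : Fact p.Prime] (r : ℝ) {a : ringA K n m}
    (ha : a ∈ ringTate K n m) : a ∈ ringAr K n m p r := by
  have hp0 : (0 : ℝ) < p := by exact_mod_cast hp.out.pos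
  refine ⟨1, one_pos, 0, fun j _ i u hu => ?_⟩
  have h0 : 0 ≤ u (Sum.inl i) := by
    by_contra h
    rw [ha u ⟨_, not_le.1 h⟩, norm_zero] at hu
    exact absurd hu (not_le.2 (by positivity))
  have h1 : (0 : ℝ) ≤ u (Sum.inl i) := by exact_mod_cast h0
  have h2 : (0 : ℝ) ≤ (p : ℝ) ^ (r * j) := by positivity
  linarith

/-- The Laurent series with nonnegative exponents become dense when `T_1 ⋯ T_n` is inverted. -/
theorem exists_norm_sub_nonnegPart_le (a : ringA K n m) {δ : ℝ} (hδ : 0 < δ) :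
    ∃ N₀ : ℕ, ∀ N : ℕ, N₀ ≤ N →
      ‖logVarPow K n m N * a - nonnegPart (logVarPow K n m N * a)‖ ≤ δ := by
  have h := a.1.coeff_null.norm
  rw [norm_zero] at h
  have hfin := eventually_cofinite.1 (h.eventually_le_const hδ)
  -- Only finitely many coefficients exceed $\delta$. Shifting by at least the sum of their pole
  -- orders makes all their exponents nonnegative.
  refine ⟨∑ u ∈ hfin.toFinset, poleOrder u, fun N hN => ?_⟩
  refine norm_le_iff.2 fun v => ?_
  change ‖(logVarPow K n m N * a).1.coeff v - (nonnegPart (logVarPow K n m N * a)).1.coeff v‖ ≤ δ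
  by_cases hv : ∀ s, 0 ≤ v s
  · have : (nonnegPart (logVarPow K n m N * a)).1.coeff v = (logVarPow K n m N * a).1.coeff v :=
      if_pos hv
    rw [this, sub_self, norm_zero]
    exact hδ.le
  · have h0 : (nonnegPart (logVarPow K n m N * a)).1.coeff v = 0 := if_neg hv
    rw [h0, sub_zero]
    by_contra hcon
    push Not at hv
    obtain ⟨s, hs⟩ := hv
    rcases s with i | j
    · have h1 : (logVarPow K n m N * a).1.coeff v =
          a.1.coeff (v - Sum.elim (fun _ => (N : ℤ)) fun _ => 0) := by
        change (monomial _ 1 * a.1).coeff v = _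
        rw [coeff_monomial_mul, one_mul]
      rw [h1] at hcon
      have h2 : (v - Sum.elim (fun _ => (N : ℤ)) fun _ => 0) ∈ hfin.toFinset := by
        simpa using hcon
      have h3 := Finset.single_le_sum (f := fun u : Fin n ⊕ Fin m → ℤ => poleOrder u)
        (fun _ _ => Nat.zero_le _) h2
      have h4 := le_poleOrder (v - Sum.elim (fun _ => (N : ℤ)) fun _ => 0) i
      simp only [Pi.sub_apply, Sum.elim_inl] at h4 h3
      omega
    · rw [(logVarPow K n m N * a).2 v ⟨j, hs⟩, norm_zero] at hcon
      exact hcon hδ.le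

theorem norm_sum_le_of_forall_le {ι : Type*} (s : Finset ι) (f : ι → ringA K n m) {C : ℝ}
    (hC : 0 ≤ C) (h : ∀ i ∈ s, ‖f i‖ ≤ C) : ‖∑ i ∈ s, f i‖ ≤ C :=
  IsUltrametricDist.norm_sum_le_of_forall_le_of_nonneg hC h

theorem exists_sum_tmul_of_span {R A M : Type*} [CommRing R] [CommRing A] [Algebra R A]
    [AddCommGroup M] [Module R M] {a : ℕ} (f : (Fin a → R) →ₗ[R] M)
    (hf : Function.Surjective f) (w : A ⊗[R] M) :
    ∃ α : Fin a → A, w = ∑ j, α j ⊗ₜ[R] f (Pi.single j 1) := by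
  induction w using TensorProduct.induction_on with
  | zero => exact ⟨0, by simp⟩
  | tmul b x =>
    obtain ⟨d, rfl⟩ := hf x
    refine ⟨fun j => d j • b, ?_⟩
    conv_lhs => rw [pi_eq_sum_univ' d, map_sum, TensorProduct.tmul_sum]
    refine Finset.sum_congr rfl fun j _ => ?_
    rw [map_smul, TensorProduct.tmul_smul, TensorProduct.smul_tmul']
  | add x y hx hy =>
    obtain ⟨α, rfl⟩ := hx
    obtain ⟨β, rfl⟩ := hy
    exact ⟨α + β, by simp [TensorProduct.add_tmul, Finset.sum_add_distrib]⟩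

/-- Coordinates of a trivialisation of the base change of a finite projective module. -/
theorem exists_coordinates_of_baseChange_equiv {R A M : Type*} [CommRing R] [CommRing A]
    [Algebra R A] [AddCommGroup M] [Module R M] [Module.Finite R M] [Module.Projective R M]
    (E : A ≃ₗ[A] A ⊗[R] M) :
    ∃ (a : ℕ) (g : Fin a → M) (s : M →ₗ[R] (Fin a → R)) (α β : Fin a → A),
      ∑ j, α j * β j = 1 ∧ ∀ l, ∑ j, algebraMap R A (s (g l) j) * β j = β l := by
  obtain ⟨a, f, hf⟩ := Module.Finite.exists_fin' R M
  obtain ⟨s, hs⟩ := Module.projective_lifting_property f LinearMap.id hf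
  have hs' : ∀ x, f (s x) = x := fun x => LinearMap.congr_fun hs x
  let g : Fin a → M := fun j => f (Pi.single j 1)
  have hsg : ∀ x, x = ∑ j, s x j • g j := fun x => by
    conv_lhs => rw [← hs' x, pi_eq_sum_univ' (s x), map_sum]
    simp only [map_smul, g]
  obtain ⟨α, hα⟩ := exists_sum_tmul_of_span f hf (E 1)
  -- The $\alpha_j$ express the generator `E 1` through the $g_j$, and $\beta_j$ is the coordinate
  -- of $g_j$ in that generator.
  let β : Fin a → A := fun j => E.symm (1 ⊗ₜ g j)
  refine ⟨a, g, s, α, β, ?_, fun l => ?_⟩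
  · have h1 := congrArg E.symm hα
    rw [E.symm_apply_apply, map_sum] at h1
    rw [h1]
    refine Finset.sum_congr rfl fun j _ => ?_
    have : α j ⊗ₜ[R] g j = α j • ((1 : A) ⊗ₜ[R] g j) := by
      rw [TensorProduct.smul_tmul', smul_eq_mul, mul_one]
    change _ = E.symm (α j ⊗ₜ g j)
    rw [this, map_smul, smul_eq_mul]
  · have h1 : (1 : A) ⊗ₜ[R] g l = ∑ j, algebraMap R A (s (g l) j) • ((1 : A) ⊗ₜ[R] g j) := by
      conv_lhs => rw [hsg (g l), TensorProduct.tmul_sum]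
      refine Finset.sum_congr rfl fun j _ => ?_
      rw [TensorProduct.tmul_smul, algebraMap_smul]
    have h2 := congrArg E.symm h1
    rw [map_sum] at h2
    simp only [map_smul, smul_eq_mul] at h2
    exact h2.symm

theorem exists_forall_norm_le {ι : Type*} [Finite ι] (x : ι → ringA K n m) :
    ∃ B : ℝ, 1 ≤ B ∧ ∀ i, ‖x i‖ ≤ B := by
  obtain ⟨B, hB⟩ := (Set.finite_range fun i => ‖x i‖).bddAbove
  exact ⟨max 1 B, le_max_left _ _, fun i => (hB ⟨i, rfl⟩).trans (le_max_right _ _)⟩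

theorem norm_logVarPow_mul_le (N : ℤ) (x : ringA K n m) : ‖logVarPow K n m N * x‖ ≤ ‖x‖ := by
  refine (norm_mul_le _ _).trans ?_
  rw [norm_logVarPow, one_mul]

/-- Coordinates with values in `𝒜` are approximated, after multiplication by a power of
`T_1 ⋯ T_n`, by elements of the Tate algebra. -/
theorem exists_ringTate_approximation {a : ℕ} (α β : Fin a → ringA K n m)
    (c : Fin a → Fin a → ringA K n m) (hαβ : ∑ j, α j * β j = 1)
    (hβ : ∀ l, ∑ j, c l j * β j = β l) {η : ℝ} (hη0 : 0 < η) (hη1 : η < 1) :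
    ∃ (N : ℕ) (b d : Fin a → ringA K n m), (∀ j, b j ∈ ringTate K n m) ∧
      (∀ j, d j ∈ ringTate K n m) ∧ ‖1 - logVarPow K n m (-N) * logVarPow K n m (-N) *
        ∑ l, ∑ j, b l * (d j * c l j)‖ ≤ η := by
  obtain ⟨B₁, hB₁, hα⟩ := exists_forall_norm_le α
  obtain ⟨B₂, hB₂, hβB⟩ := exists_forall_norm_le β
  obtain ⟨B₃, hB₃, hc⟩ := exists_forall_norm_le fun x : Fin a × Fin a => c x.1 x.2
  set B : ℝ := max B₁ (max B₂ B₃) with hB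
  have hB1 : 1 ≤ B := hB₁.trans (le_max_left _ _)
  have hB0 : 0 < B := by linarith
  have hBα : ∀ j, ‖α j‖ ≤ B := fun j => (hα j).trans (le_max_left _ _)
  have hBβ : ∀ j, ‖β j‖ ≤ B := fun j =>
    (hβB j).trans ((le_max_left _ _).trans (le_max_right _ _))
  have hBc : ∀ l j, ‖c l j‖ ≤ B := fun l j =>
    (hc (l, j)).trans ((le_max_right _ _).trans (le_max_right _ _))
  clear_value B
  -- The error in one coordinate gets multiplied by two further factors of size at most $B$.
  set δ : ℝ := η / B ^ 2 with hδ
  have hδ0 : 0 < δ := by positivity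
  have hδ1 : δ ≤ 1 := by
    rw [hδ, div_le_one (by positivity)]
    exact hη1.le.trans (one_le_pow₀ hB1)
  have hδB : δ * B * B = η := by
    rw [hδ]
    field_simp
  clear_value δ
  choose Nα hNα using fun j => exists_norm_sub_nonnegPart_le (α j) hδ0
  choose Nβ hNβ using fun j => exists_norm_sub_nonnegPart_le (β j) hδ0
  obtain ⟨N, hN1, hN2⟩ : ∃ N : ℕ, (∀ j, Nα j ≤ N) ∧ ∀ j, Nβ j ≤ N :=
    ⟨∑ j, Nα j + ∑ j, Nβ j, fun j =>
      (Finset.single_le_sum (f := Nα) (fun _ _ => Nat.zero_le _) (Finset.mem_univ j)).trans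
        (Nat.le_add_right _ _), fun j =>
      (Finset.single_le_sum (f := Nβ) (fun _ _ => Nat.zero_le _) (Finset.mem_univ j)).trans
        (Nat.le_add_left _ _)⟩
  have hXn : ∀ x : ringA K n m, ‖logVarPow K n m N * x‖ ≤ ‖x‖ := norm_logVarPow_mul_le N
  have hXY : logVarPow K n m N * logVarPow K n m (-N) = 1 := by
    rw [logVarPow_mul, add_neg_cancel, logVarPow_zero]
  have hYn : ∀ x : ringA K n m, ‖logVarPow K n m (-N) * x‖ ≤ ‖x‖ := norm_logVarPow_mul_le _
  have hb : ∀ j, ‖logVarPow K n m N * α j - nonnegPart (logVarPow K n m N * α j)‖ ≤ δ :=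
    fun j => hNα j N (hN1 j)
  have hd : ∀ j, ‖logVarPow K n m N * β j - nonnegPart (logVarPow K n m N * β j)‖ ≤ δ :=
    fun j => hNβ j N (hN2 j)
  refine ⟨N, fun j => nonnegPart (logVarPow K n m N * α j),
    fun j => nonnegPart (logVarPow K n m N * β j), fun j => nonnegPart_mem_ringTate _,
    fun j => nonnegPart_mem_ringTate _, ?_⟩
  generalize logVarPow K n m N = X at *
  generalize logVarPow K n m (-N) = Y at *
  have hbB : ∀ j, ‖nonnegPart (X * α j)‖ ≤ B := fun j => by
    have h1 : nonnegPart (X * α j) = X * α j + (nonnegPart (X * α j) - X * α j) := by ring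
    rw [h1]
    refine (IsUltrametricDist.norm_add_le_max _ _).trans (max_le ((hXn _).trans (hBα j)) ?_)
    rw [norm_sub_rev]
    exact (hb j).trans (hδ1.trans hB1)
  generalize hbe : (fun j => nonnegPart (X * α j)) = b
  generalize hde : (fun j => nonnegPart (X * β j)) = d
  simp only [funext_iff] at hbe hde
  simp only [hbe, hde] at hb hd hbB ⊢
  -- With the exact values $X\alpha$ and $X\beta$ the double sum is $X^2$. Replacing them by $b$ and
  -- $d$ moves it by at most $\eta$, and multiplying by $Y^2=X^{-2}$ does not increase norms.
  have hXX : ∑ l, ∑ j, (X * α l) * ((X * β j) * c l j) = X * X := by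
    have h1 : ∀ l, ∑ j, (X * α l) * ((X * β j) * c l j) = X * X * (α l * β l) := fun l => by
      conv_rhs => rw [← hβ l]
      rw [Finset.mul_sum, Finset.mul_sum]
      exact Finset.sum_congr rfl fun j _ => by ring
    simp only [h1]
    rw [← Finset.mul_sum, hαβ, mul_one]
  have hdiff : ‖X * X - ∑ l, ∑ j, b l * (d j * c l j)‖ ≤ η := by
    rw [← hXX]
    simp only [← Finset.sum_sub_distrib]
    refine norm_sum_le_of_forall_le _ _ hη0.le fun l _ =>
      norm_sum_le_of_forall_le _ _ hη0.le fun j _ => ?_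
    have h1 : X * α l * (X * β j * c l j) - b l * (d j * c l j) =
        ((X * α l - b l) * (X * β j) + b l * (X * β j - d j)) * c l j := by
      ring
    rw [h1]
    have h2 : ‖(X * α l - b l) * (X * β j) + b l * (X * β j - d j)‖ ≤ δ * B := by
      refine (IsUltrametricDist.norm_add_le_max _ _).trans (max_le ?_ ?_)
      · exact (norm_mul_le _ _).trans
          (mul_le_mul (hb l) ((hXn _).trans (hBβ j)) (norm_nonneg _) hδ0.le)
      · rw [mul_comm δ]
        exact (norm_mul_le _ _).trans (mul_le_mul (hbB l) (hd j) (norm_nonneg _) hB0.le)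
    exact (norm_mul_le _ _).trans
      ((mul_le_mul h2 (hBc l j) (norm_nonneg _) (by positivity)).trans hδB.le)
  have h1 : 1 - Y * Y * ∑ l, ∑ j, b l * (d j * c l j) =
      Y * (Y * (X * X - ∑ l, ∑ j, b l * (d j * c l j))) := by
    calc _ = (X * Y) * (X * Y) - Y * Y * ∑ l, ∑ j, b l * (d j * c l j) := by rw [hXY, one_mul]
      _ = _ := by ring
  rw [h1]
  exact (hYn _).trans ((hYn _).trans hdiff)

end Frame

end Polyannulus

/-! ### Frames of line bundles and connections on tensor powers -/

section LineBundle

variable {R A M : Type*} [CommRing R] [CommRing A] [Algebra R A] [AddCommGroup M] [Module R M]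

/-- The `A`-linear extension to `A ⊗ M` of a linear map `M → A`. -/
noncomputable def extendLinear (l : M →ₗ[R] A) : A ⊗[R] M →ₗ[A] A :=
  TensorProduct.AlgebraTensorModule.lift ((LinearMap.lsmul A (M →ₗ[R] A)).flip l)

theorem extendLinear_tmul (l : M →ₗ[R] A) (a : A) (x : M) : extendLinear l (a ⊗ₜ x) = a * l x := rfl

/-- If `A ⊗ M` is isomorphic to `A` and `l : M → A` takes the value `1` at `e`, then `e` is a
basis of `A ⊗ M` with coordinate `l`. -/
theorem tmul_eq_smul_of_apply_eq_one (E : A ≃ₗ[A] A ⊗[R] M) {l : M →ₗ[R] A} {e : M}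
    (he : l e = 1) (x : M) : (1 : A) ⊗ₜ[R] x = l x • ((1 : A) ⊗ₜ[R] e) := by
  -- A functional on a free module of rank one is a multiple of the coordinate `E.symm`; the value
  -- $1$ at $e$ makes that multiple a unit.
  have h1 : ∀ w, extendLinear l w = E.symm w * extendLinear l (E 1) := fun w => by
    conv_lhs => rw [← E.apply_symm_apply w]
    have : E (E.symm w) = E.symm w • E 1 := by rw [← map_smul, smul_eq_mul, mul_one]
    rw [this, map_smul, smul_eq_mul]
  have h2 : E.symm (1 ⊗ₜ e) * extendLinear l (E 1) = 1 := by
    rw [← h1, extendLinear_tmul, he, one_mul]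
  have h3 : ∀ y, l y = E.symm (1 ⊗ₜ y) * extendLinear l (E 1) := fun y => by
    rw [← h1, extendLinear_tmul, one_mul]
  apply E.symm.injective
  rw [map_smul, smul_eq_mul, h3 x]
  calc _ = E.symm (1 ⊗ₜ x) * (E.symm (1 ⊗ₜ e) * extendLinear l (E 1)) := by rw [h2, mul_one]
    _ = _ := by ring

/-- The product of `q` copies of a linear map, on the tensor power. -/
noncomputable def tensorPowerLinear (l : M →ₗ[R] A) (q : ℕ) : ⨂[R]^q M →ₗ[R] A :=
  PiTensorProduct.lift ((MultilinearMap.mkPiAlgebra R (Fin q) A).compLinearMap fun _ => l)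

theorem tensorPowerLinear_tprod (l : M →ₗ[R] A) (q : ℕ) (x : Fin q → M) :
    tensorPowerLinear l q (PiTensorProduct.tprod R x) = ∏ i, l (x i) := by
  simp [tensorPowerLinear]

-- Tensor slots are replaced by $e$ one at a time, each contributing its coordinate as a factor.
open Classical in
theorem one_tmul_tprod_eq (l : M →ₗ[R] A) (e : M)
    (h : ∀ x : M, (1 : A) ⊗ₜ[R] x = l x • ((1 : A) ⊗ₜ[R] e)) (q : ℕ) (x : Fin q → M) :
    (1 : A) ⊗ₜ[R] PiTensorProduct.tprod R x =
      (∏ i, l (x i)) • ((1 : A) ⊗ₜ[R] PiTensorProduct.tprod R fun _ : Fin q => e) := by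
  have hstep : ∀ (y : Fin q → M) (i : Fin q), (1 : A) ⊗ₜ[R] PiTensorProduct.tprod R y =
      l (y i) • ((1 : A) ⊗ₜ[R] PiTensorProduct.tprod R (Function.update y i e)) := fun y i => by
    let θ : M →ₗ[R] ⨂[R]^q M := (PiTensorProduct.tprod R).toLinearMap y i
    have h1 := congrArg (θ.baseChange A) (h (y i))
    rw [map_smul, LinearMap.baseChange_tmul, LinearMap.baseChange_tmul] at h1
    simpa [θ, MultilinearMap.toLinearMap] using h1
  have key : ∀ S : Finset (Fin q), (1 : A) ⊗ₜ[R] PiTensorProduct.tprod R x =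
      (∏ i ∈ S, l (x i)) •
        ((1 : A) ⊗ₜ[R] PiTensorProduct.tprod R fun i => if i ∈ S then e else x i) := fun S => by
    induction S using Finset.induction_on with
    | empty => simp
    | insert i S hi ih =>
      rw [ih, hstep _ i, smul_smul, Finset.prod_insert hi, if_neg hi, mul_comm]
      congr 3
      funext j
      by_cases hj : j = i
      · subst hj
        simp
      · simp [hj]
  simpa using key Finset.univ

theorem one_tmul_tensorPower_eq (l : M →ₗ[R] A) (e : M)
    (h : ∀ x : M, (1 : A) ⊗ₜ[R] x = l x • ((1 : A) ⊗ₜ[R] e)) (q : ℕ) (x : ⨂[R]^q M) :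
    (1 : A) ⊗ₜ[R] x = tensorPowerLinear l q x •
      ((1 : A) ⊗ₜ[R] PiTensorProduct.tprod R fun _ : Fin q => e) := by
  induction x using PiTensorProduct.induction_on with
  | smul_tprod a y =>
    rw [TensorProduct.tmul_smul, one_tmul_tprod_eq l e h, map_smul, tensorPowerLinear_tprod,
      smul_assoc]
  | add y z hy hz => rw [TensorProduct.tmul_add, hy, hz, map_add, add_smul]

theorem eq_extendLinear_smul {N : Type*} [AddCommGroup N] [Module R N] (l : N →ₗ[R] A) (e : N)
    (h : ∀ x : N, (1 : A) ⊗ₜ[R] x = l x • ((1 : A) ⊗ₜ[R] e)) (w : A ⊗[R] N) :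
    w = extendLinear l w • ((1 : A) ⊗ₜ[R] e) := by
  induction w using TensorProduct.induction_on with
  | zero => simp
  | tmul a x =>
    rw [extendLinear_tmul, mul_smul, ← h, TensorProduct.smul_tmul', smul_eq_mul, mul_one]
  | add y z hy hz => rw [map_add, add_smul, ← hy, ← hz]

/-- The basis `u e` of `A ⊗ N`, for a generator `e` and a unit `u`. -/
noncomputable def unitBasis {N : Type*} [AddCommGroup N] [Module R N] (l : N →ₗ[R] A) (e : N)
    (he : l e = 1) (h : ∀ x : N, (1 : A) ⊗ₜ[R] x = l x • ((1 : A) ⊗ₜ[R] e)) (v : Aˣ) :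
    Module.Basis Unit A (A ⊗[R] N) :=
  (Module.Basis.singleton Unit A).map
    { toFun := fun a => (a * v) • ((1 : A) ⊗ₜ[R] e)
      map_add' := fun a b => by rw [add_mul, add_smul]
      map_smul' := fun a b => by rw [smul_eq_mul, mul_assoc, mul_smul, RingHom.id_apply]
      invFun := fun w => extendLinear l w * ↑v⁻¹
      left_inv := fun a => by
        beta_reduce
        rw [map_smul, extendLinear_tmul, he, smul_eq_mul, mul_one, mul_one, mul_assoc,
          Units.mul_inv, mul_one]
      right_inv := fun w => by
        beta_reduce
        rw [mul_assoc, Units.inv_mul, mul_one]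
        exact (eq_extendLinear_smul l e h w).symm }

theorem unitBasis_apply {N : Type*} [AddCommGroup N] [Module R N] (l : N →ₗ[R] A) (e : N)
    (he : l e = 1) (h : ∀ x : N, (1 : A) ⊗ₜ[R] x = l x • ((1 : A) ⊗ₜ[R] e)) (v : Aˣ) :
    unitBasis l e he h v () = (v : A) • ((1 : A) ⊗ₜ[R] e) := by
  simp [unitBasis]

variable {K ι : Type*} [CommRing K] [Algebra K R] [Algebra K A] {partials : ι → Derivation K R R}
  {partials' : ι → Derivation K A A}

namespace Connection

variable (D : Connection partials M) {l : M →ₗ[R] A} {e : M}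

theorem coordinate_nabla
    (hd : ∀ s a, partials' s (algebraMap R A a) = algebraMap R A (partials s a)) (he : l e = 1)
    (h : ∀ x : M, (1 : A) ⊗ₜ[R] x = l x • ((1 : A) ⊗ₜ[R] e)) (s : ι) (x : M) :
    l (D.nabla s x) = partials' s (l x) + l x * l (D.nabla s e) := by
  have h1 := congrArg ((D.baseChange hd).nabla s) (h x)
  rw [(D.baseChange hd).leibniz, baseChange_tmul, baseChange_tmul] at h1
  have h2 := congrArg (extendLinear l) h1
  simpa [extendLinear_tmul, he] using h2

/-- In rank one the quadratic term $\omega_s\omega_t$ of the curvature is symmetric and cancels, so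
integrability is closedness of the connection form. -/
theorem coordinate_closed
    (hd : ∀ s a, partials' s (algebraMap R A a) = algebraMap R A (partials s a)) (he : l e = 1)
    (h : ∀ x : M, (1 : A) ⊗ₜ[R] x = l x • ((1 : A) ⊗ₜ[R] e)) (hD : D.Integrable) (s t : ι) :
    partials' s (l (D.nabla t e)) = partials' t (l (D.nabla s e)) := by
  have h1 := congrArg l (hD s t e)
  rw [D.coordinate_nabla hd he h s, D.coordinate_nabla hd he h t (D.nabla s e)] at h1
  linear_combination h1

/-- Each of the $q$ slots contributes the connection form once, so the frame $e^{\otimes q}$ has the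
form $q\omega$. -/
theorem baseChange_tensorPower_nabla
    (hd : ∀ s a, partials' s (algebraMap R A a) = algebraMap R A (partials s a)) (he : l e = 1)
    (h : ∀ x : M, (1 : A) ⊗ₜ[R] x = l x • ((1 : A) ⊗ₜ[R] e)) (q : ℕ) (s : ι)
    (v : A) :
    ((D.tensorPower q).baseChange hd).nabla s
        (v • ((1 : A) ⊗ₜ[R] PiTensorProduct.tprod R fun _ : Fin q => e)) =
      (partials' s v + v * (q * l (D.nabla s e))) •
        ((1 : A) ⊗ₜ[R] PiTensorProduct.tprod R fun _ : Fin q => e) := by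
  rw [((D.tensorPower q).baseChange hd).leibniz, baseChange_tmul, tensorPower_tprod,
    TensorProduct.tmul_sum, Derivation.map_one_eq_zero, TensorProduct.zero_tmul, zero_add, add_smul]
  congr 1
  rw [mul_smul]
  congr 1
  have h1 : ∀ i : Fin q, (1 : A) ⊗ₜ[R] PiTensorProduct.tprod R
      (Function.update (fun _ : Fin q => e) i (D.nabla s e)) = l (D.nabla s e) •
        ((1 : A) ⊗ₜ[R] PiTensorProduct.tprod R fun _ : Fin q => e) := fun i => by
    rw [one_tmul_tprod_eq l e h]
    congr 1
    rw [Finset.prod_eq_single i]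
    · simp
    · intro j _ hj
      rw [Function.update_of_ne hj, he]
    · simp
  simp only [h1, Finset.sum_const, Finset.card_univ, Fintype.card_fin]
  rw [mul_smul, Nat.cast_smul_eq_nsmul]

/-- Rescaling a frame by a unit $v$ adds $dv/v$ to its connection form. -/
theorem exists_basis_tensorPower
    (hd : ∀ s a, partials' s (algebraMap R A a) = algebraMap R A (partials s a)) (he : l e = 1)
    (h : ∀ x : M, (1 : A) ⊗ₜ[R] x = l x • ((1 : A) ⊗ₜ[R] e)) (q : ℕ) {v : A} (hv : IsUnit v)
    (η : ι → A) (hη : ∀ s, partials' s v = v * η s) :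
    ∃ b : Module.Basis Unit A (A ⊗[R] ⨂[R]^q M), ∀ s,
      ((D.tensorPower q).baseChange hd).nabla s (b ()) =
        (η s + q * l (D.nabla s e)) • b () := by
  obtain ⟨v, rfl⟩ := hv
  refine ⟨unitBasis (tensorPowerLinear l q) (PiTensorProduct.tprod R fun _ => e)
    (by simp [tensorPowerLinear_tprod, he]) (one_tmul_tensorPower_eq l e h q) v, fun s => ?_⟩
  rw [unitBasis_apply, D.baseChange_tensorPower_nabla hd he h, hη, smul_smul]
  congr 1
  ring

end Connection

/-- The value of a combination of functionals at a combination of vectors. -/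
theorem exists_apply_eq_sum {a : ℕ} (s : M →ₗ[R] (Fin a → R)) (g : Fin a → M) (b d : Fin a → R) :
    ∃ (e : M) (ψ : M →ₗ[R] R), algebraMap R A (ψ e) = ∑ l, ∑ j,
      algebraMap R A (b l) * (algebraMap R A (d j) * algebraMap R A (s (g l) j)) := by
  refine ⟨∑ l, b l • g l, ∑ j, d j • (LinearMap.proj j ∘ₗ s), ?_⟩
  simp only [map_sum, map_smul, LinearMap.sum_apply, LinearMap.smul_apply,
    LinearMap.comp_apply, LinearMap.proj_apply, smul_eq_mul, Finset.mul_sum, map_mul]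

theorem rankAtStalk_tensorProduct_eq_one [Module.Finite R M] [Module.Projective R M]
    (h : ∀ P : PrimeSpectrum R, Module.rankAtStalk M P = 1) (P : PrimeSpectrum A) :
    Module.rankAtStalk (A ⊗[R] M) P = 1 := by
  rw [Module.rankAtStalk_baseChange, h]

end LineBundle

/-! ### A decaying frame and the conclusion -/

namespace Polyannulus

open Laurent

section Frame

variable {K : Type u} [NormedField K] [IsUltrametricDist K] [CompleteSpace K] {n m : ℕ}
  {p : ℕ} [hp : Fact p.Prime] {r : ℝ}

/-- If `𝒜 ⊗ M` is free of rank one, it has a basis `e ∈ M`, whose coordinate function is given by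
an element of the dual of `M` up to a factor with fast decay. -/
theorem exists_frame {ρ : ℝ} (hρ : 0 ≤ ρ) (hr : r * ρ ≤ 1) (M : Type*) [AddCommGroup M]
    [Module (ringAr K n m p r) M] [Module.Finite (ringAr K n m p r) M]
    [Module.Projective (ringAr K n m p r) M]
    (E : ringA K n m ≃ₗ[ringA K n m] ringA K n m ⊗[ringAr K n m p r] M) :
    ∃ (e : M) (ψ : M →ₗ[ringAr K n m p r] ringAr K n m p r) (z : ringA K n m) (C : ℝ),
      (ψ e : ringA K n m) * z = 1 ∧ DecayBound ρ C z := by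
  obtain ⟨a, g, s, α, β, hαβ, hβ⟩ := exists_coordinates_of_baseChange_equiv E
  have h2ρ : (1 : ℝ) ≤ 2 ^ ρ := Real.one_le_rpow (by norm_num) hρ
  -- The bound $2^\rho\eta\le1$ is what the inversion with uniform decay constant requires.
  obtain ⟨η, hη0, hη1, hη2⟩ : ∃ η : ℝ, 0 < η ∧ η < 1 ∧ (2 : ℝ) ^ ρ * η ≤ 1 := by
    refine ⟨(2 * 2 ^ ρ)⁻¹, by positivity, inv_lt_one_of_one_lt₀ (by linarith), ?_⟩
    rw [mul_inv, mul_left_comm, mul_inv_cancel₀ (by positivity)]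
    norm_num
  obtain ⟨N, b, d, hb, hd, hN⟩ := exists_ringTate_approximation α β
    (fun l j => algebraMap (ringAr K n m p r) (ringA K n m) (s (g l) j)) hαβ hβ hη0 hη1
  let b' : Fin a → ringAr K n m p r := fun j => ⟨b j, ringTate_le_ringAr p r (hb j)⟩
  let d' : Fin a → ringAr K n m p r := fun j => ⟨d j, ringTate_le_ringAr p r (hd j)⟩
  obtain ⟨e, ψ, hψe⟩ := exists_apply_eq_sum (A := ringA K n m) s g b' d'
  change (ψ e : ringA K n m) =
    ∑ l, ∑ j, b l * (d j * algebraMap (ringAr K n m p r) (ringA K n m) (s (g l) j)) at hψe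
  rw [← hψe] at hN
  obtain ⟨CY, hCY⟩ := exists_decayBound_logVarPow (K := K) (n := n) (m := m) ρ (-N)
  obtain ⟨Ce, hCe⟩ := exists_decayBound_of_mem_ringAr hρ hr (ψ e).2
  -- With $Y=(T_1\cdots T_n)^{-N}$, the element $y=1-Y^2\psi(e)$ decays and has norm at most $\eta$.
  -- So $1-y$ has a decaying inverse, and multiplying that by $Y^2$ inverts $\psi(e)$ in `𝒜`.
  have hYY := DecayBound.mul hρ hCY hCY
  have hyC := (DecayBound.one ρ).add (DecayBound.mul hρ hYY hCe).neg
  rw [← sub_eq_add_neg] at hyC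
  obtain ⟨z, hz, hzC⟩ := exists_inverse_decayBound hρ hyC
    ((mul_le_mul_of_nonneg_left hN (by positivity)).trans hη2) (hN.trans_lt hη1)
  refine ⟨e, ψ, _, _, ?_, DecayBound.mul hρ hYY hzC⟩
  rw [sub_sub_cancel] at hz
  rw [← hz]
  ring

theorem continuous_derivA (s : Fin n ⊕ Fin m) : Continuous (derivA K n m s) :=
  AddMonoidHomClass.continuous_of_bound (derivA K n m s) 1 fun x => by
    rw [one_mul]
    exact norm_deriv_le s x.1

/-- The only use of $r<1$: for $r>0$ take $\rho=1/r$. -/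
theorem exists_decay_exponent {r : ℝ} (hr : r < 1) : ∃ ρ : ℝ, 1 < ρ ∧ r * ρ ≤ 1 := by
  rcases le_or_gt r 0 with h | h
  · exact ⟨2, by norm_num, by linarith⟩
  · exact ⟨r⁻¹, (one_lt_inv₀ h).2 hr, (mul_inv_cancel₀ h.ne').le⟩

theorem exists_norm_natCast_pow_mul_le {A : Type*} [NormedRing A] (hpA : ‖(p : A)‖ ≤ (p : ℝ)⁻¹)
    (f : A) {ε : ℝ} (hε : 0 < ε) : ∃ N : ℕ, ‖((p ^ N : ℕ) : A) * f‖ ≤ ε := by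
  have hpi : (p : ℝ)⁻¹ < 1 := inv_lt_one_of_one_lt₀ (by exact_mod_cast hp.out.one_lt)
  obtain ⟨N, hN⟩ := exists_pow_lt_of_lt_one (show 0 < ε / (‖f‖ + 1) by positivity) hpi
  refine ⟨N + 1, ?_⟩
  rw [lt_div_iff₀ (by positivity)] at hN
  push_cast
  calc _ ≤ ‖(p : A) ^ (N + 1)‖ * ‖f‖ := norm_mul_le _ _
    _ ≤ ‖(p : A)‖ ^ (N + 1) * ‖f‖ :=
        mul_le_mul_of_nonneg_right (norm_pow_le' _ N.succ_pos) (norm_nonneg _)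
    _ ≤ ((p : ℝ)⁻¹) ^ (N + 1) * ‖f‖ :=
        mul_le_mul_of_nonneg_right (pow_le_pow_left₀ (norm_nonneg _) hpA _) (norm_nonneg _)
    _ ≤ ((p : ℝ)⁻¹) ^ N * (‖f‖ + 1) :=
        mul_le_mul (pow_le_pow_of_le_one (by positivity) hpi.le N.le_succ) (by linarith)
          (norm_nonneg _) (by positivity)
    _ ≤ ε := hN.le

set_option synthInstance.maxHeartbeats 200000 in
theorem exists_hasRegularSingularities [CharZero K] (hr : r < 1)
    (hz : ∀ z : ℤ, ‖(z : K)⁻¹‖ ≤ z.natAbs)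
    (hdisc : ∀ x : K, ‖x‖ < 1 → ‖x‖ ≤ ‖(p : K)‖)
    (hf : ∀ l : ℕ, ‖((Nat.factorial l : ℕ) : K)⁻¹‖ ≤ (p : ℝ) ^ l) (hpK : ‖(p : K)‖ = (p : ℝ)⁻¹)
    {M : Type*} [AddCommGroup M]
    [Module (ringAr K n m p r) M] [Module.Finite (ringAr K n m p r) M]
    [Module.Projective (ringAr K n m p r) M]
    (hrank : ∀ P : PrimeSpectrum (ringAr K n m p r), Module.rankAtStalk M P = 1)
    (D : Connection (derivAr K n m p r) M) (hD : D.Integrable) :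
    ∃ N : ℕ, HasRegularSingularities (D.tensorPower (p ^ N)) := by
  have hp0 : (0 : ℝ) < p := by exact_mod_cast hp.out.pos
  obtain ⟨E⟩ := exists_linearEquiv_of_rankAtStalk_eq_one (K := K) (n := n) (m := m) (ϖ := (p : K))
    (by exact_mod_cast hp.out.ne_zero)
    (by rw [hpK]; exact inv_lt_one_of_one_lt₀ (by exact_mod_cast hp.out.one_lt)) hdisc
    (ringA K n m ⊗[ringAr K n m p r] M) (rankAtStalk_tensorProduct_eq_one hrank)
  obtain ⟨ρ, hρ1, hrρ⟩ := exists_decay_exponent hr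
  have hρ0 : 0 ≤ ρ := by linarith
  obtain ⟨e, ψ, z, C, hψz, hzC⟩ := exists_frame hρ0 hrρ M E
  let l : M →ₗ[ringAr K n m p r] ringA K n m :=
    (LinearMap.toSpanSingleton (ringAr K n m p r) (ringA K n m) z) ∘ₗ ψ
  have hl : ∀ x, l x = (ψ x : ringA K n m) * z := fun x => rfl
  have he : l e = 1 := hψz
  have h := tmul_eq_smul_of_apply_eq_one E he
  have hd : ∀ (s : Fin n ⊕ Fin m) (a : ringAr K n m p r), derivA K n m s (algebraMap _ _ a) =
    algebraMap (ringAr K n m p r) (ringA K n m) (derivAr K n m p r s a) := fun _ _ => rfl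
  -- The connection form is an element of `𝒜^r` times $z$, and both factors decay.
  have hω : ∀ s, ∃ C, DecayBound ρ C (l (D.nabla s e)) := fun s => by
    obtain ⟨C', hC'⟩ := exists_decayBound_of_mem_ringAr hρ0 hrρ (ψ (D.nabla s e)).2
    rw [hl]
    exact ⟨_, DecayBound.mul hρ0 hC' hzC⟩
  obtain ⟨f, c, g, hg, hinl, hinr⟩ := exists_primitive hρ1 hz (fun s => l (D.nabla s e)) hω
    (D.coordinate_closed hd he h hD)
  have hpA : ‖(p : ringA K n m)‖ ≤ (p : ℝ)⁻¹ := by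
    rw [← map_natCast (algebraMap K (ringA K n m)), norm_algebraMap_eq, hpK]
  obtain ⟨N, hN⟩ := exists_norm_natCast_pow_mul_le hpA f (ε := ((p : ℝ)⁻¹) ^ 2) (by positivity)
  -- Rescaling by $\exp(-p^Nf)$ turns $p^N\omega$ into $p^N(\omega-df)$, which is logarithmic.
  obtain ⟨v, hvu, hv⟩ := exists_isUnit_exp hf (-(((p ^ N : ℕ) : ringA K n m) * f))
    ((norm_neg _).trans_le hN)
  obtain ⟨b, hb⟩ := D.exists_basis_tensorPower hd he h (p ^ N) hvu
    (fun s => -(((p ^ N : ℕ) : ringA K n m) * derivA K n m s f)) fun s => by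
      rw [hv _ (continuous_derivA s), map_neg, Derivation.leibniz, Derivation.map_natCast,
        smul_zero, add_zero, smul_eq_mul]
  refine ⟨N, b, fun i => ((p ^ N : ℕ) : K) * c i, fun s => ((p ^ N : ℕ) : ringA K n m) * g s,
    fun s => mul_mem (natCast_mem _ _) (hg s), fun i => ?_, fun j => ?_⟩
  · refine (hb (Sum.inl i)).trans ?_
    congr 1
    rw [hinl, mul_smul, Nat.cast_smul_eq_nsmul, nsmul_eq_mul]
    ring
  · refine (hb (Sum.inr j)).trans ?_
    congr 1
    rw [hinr]
    ring

end Frame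

end Polyannulus

theorem mainTheorem5 (p : ℕ) [Fact p.Prime] (k : Type*) [Field k] [CharP k p] [PerfectRing k p]
    (n m : ℕ) (r : ℝ) (hr : r < 1)
    (M : Type*) [AddCommGroup M] [Module (Polyannulus.ringAr (WittField p k) n m p r) M]
    [Module.Finite (Polyannulus.ringAr (WittField p k) n m p r) M]
    [Module.Projective (Polyannulus.ringAr (WittField p k) n m p r) M]
    (hrank : ∀ P : PrimeSpectrum (Polyannulus.ringAr (WittField p k) n m p r),
      Module.rankAtStalk M P = 1)
    (D : Connection (Polyannulus.derivAr (WittField p k) n m p r) M) (hD : D.Integrable) :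
    ∃ N : ℕ, Polyannulus.HasRegularSingularities (D.tensorPower (p ^ N)) := by
  exact Polyannulus.exists_hasRegularSingularities hr (WittField.norm_inv_intCast_le p k)
    (WittField.norm_le_inv_of_norm_lt_one p k) (WittField.norm_inv_factorial_le p k)
    (WittField.norm_p p k) hrank D hD
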